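/- **Setting.** Let $2\le p<\infty$. For $\beta\ge 0$ consider the planar system $$(\mathcal S_\beta)\qquad \begin{cases}-\Delta u+\phi_{u,v}u=|u|^{2p-2}u+\beta|v|^p|u|^{p-2}u,\\ -\Delta v+\phi_{u,v}v=|v|^{2p-2}v+\beta|u|^p|v|^{p-2}v,\end{cases}\quad\text{in }\mathbb R^2,\qquad \phi_{u,v}(x)=\int_{\mathbb R^2}\log|x-y|\,(u^2(y)+v^2(y))\,dy .$$ For $\lambda>e^{1/4}$ let $W^\lambda=\{u\in H^1(\mathbb R^2):\ \|u\|_{\lambda,*}^2:=\int\log(\lambda+|x|)u^2\,dx<\infty\}$ with norm $\|u\|_{W^\lambda}=(\|\nabla u\|_2^2+\|u\|_2^2+\|u\|_{\lambda,*}^2)^{1/2}$. For $u,v\in W^\lambda$ put $$\mathcal V(u,v)=\iint\log|x-y|\,(u^2(y)+v^2(y))(u^2(x)+v^2(x))\,dy\,dx,\qquad \psi_\beta(u,v)=\|u\|_{2p}^{2p}+\|v\|_{2p}^{2p}+2\beta\int|uv|^p\,dx,$$ $$I_\beta(u,v)=\tfrac12(\|\nabla u\|_2^2+\|\nabla v\|_2^2)+\tfrac14\mathcal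 V(u,v)-\tfrac1{2p}\psi_\beta(u,v),$$ $$J_\beta(u,v)=2(\|\nabla u\|_2^2+\|\nabla v\|_2^2)-\tfrac14(\|u\|_2^2+\|v\|_2^2)^2+\mathcal V(u,v)-\tfrac{4p-2}{2p}\psi_\beta(u,v),$$ $$\mathcal M_\beta=\{(u,v)\in (W^\lambda\times W^\lambda)\setminus\{(0,0)\}: J_\beta(u,v)=0\},\qquad c_\beta=\inf_{\mathcal M_\beta}I_\beta .$$ A pair $(u,v)\in W^\lambda\times W^\lambda$ is a weak solution of $(\mathcal S_\beta)$ if for all $\varphi,\psi\in C_0^\infty(\mathbb R^2)$ $$\int\nabla u\cdot\nabla\varphi+\int\phi_{u,v}u\varphi=\int(|u|^{2p-2}u+\beta|v|^p|u|^{p-2}u)\varphi,\qquad \int\nabla v\cdot\nabla\psi+\int\phi_{u,v}v\psi=\int(|v|^{2p-2}v+\beta|u|^p|v|^{p-2}v)\psi .$$ **Theorem.** Let $2\le p<\infty$ and $\lambda>e^{1/4}$. For every $\beta\ge0$ the infimum $c_\beta$ is finite and attained, and $(\mathcal S_\beta)$ has a weak solution $(u_\beta,v_\beta)\in\mathcal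 M_\beta$ with $u_\beta,v_\beta\ge0$ a.e. and $I_\beta(u_\beta,v_\beta)=c_\beta$. Moreover: (a) These solutions can be chosen so that, as $\beta\to0^+$, $u_\beta\rightharpoonup u$ and $v_\beta\rightharpoonup v$ weakly in $W^\lambda$ for some $(u,v)\in\mathcal M_0$ with $I_0(u,v)=c_0$. For an arbitrary choice of such solutions the convergence holds up to translations and subsequences: if $\beta_n>0$, $\beta_n\to0$, and $(u_n,v_n)\in\mathcal M_{\beta_n}$ is a nonnegative weak solution of $(\mathcal S_{\beta_n})$ with $I_{\beta_n}(u_n,v_n)=c_{\beta_n}$, then there are a subsequence $(n_k)$, points $y_k\in\mathbb R^2$ and $(u,v)\in\mathcal M_0$ with $I_0(u,v)=c_0$ such that $u_{n_k}(\cdot-y_k)\rightharpoonup u$ and $v_{n_k}(\cdot-y_k)\rightharpoonup v$ weakly in $W^\lambda$. (b) For every choice of such solutions, $\|u_\beta\|_2\to0$ and $\|v_\beta\|_2\to0$ as $\beta\to\infty$. -/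

import Mathlib

open MeasureTheory Filter Topology Set
open scoped ContDiff

noncomputable section

namespace HartreeFock

/-- The Euclidean plane `ℝ²`. -/
abbrev Plane : Type := EuclideanSpace ℝ (Fin 2)

/-- Test functions: `φ ∈ C₀^∞(ℝ²)`. -/
def IsTest (φ : Plane → ℝ) : Prop :=
  ContDiff ℝ ∞ φ ∧ HasCompactSupport φ

/-- `g` is the weak (distributional) gradient of `u`: `∫ u ∂ᵢφ = - ∫ gᵢ φ` for all test functions
`φ` and `i = 1, 2`.  (Only used when `u` and `g` are square integrable.) -/
def IsWeakGradient (u : Plane → ℝ) (g : Plane → Plane) : Prop :=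
  ∀ φ : Plane → ℝ, IsTest φ → ∀ i : Fin 2,
    ∫ x, u x * fderiv ℝ φ x (EuclideanSpace.single i 1) = - ∫ x, g x i * φ x

/-- `u ∈ H¹(ℝ²)`: `u ∈ L²` and `u` has a weak gradient in `L²`. -/
def MemH1 (u : Plane → ℝ) : Prop :=
  MemLp u 2 volume ∧ ∃ g : Plane → Plane, MemLp g 2 volume ∧ IsWeakGradient u g

open Classical in
/-- The weak gradient `∇u` of `u ∈ H¹(ℝ²)` (it is unique up to null sets), and `0` otherwise. -/
def weakGrad (u : Plane → ℝ) : Plane → Plane :=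
  if h : ∃ g : Plane → Plane, MemLp g 2 volume ∧ IsWeakGradient u g then h.choose else 0

/-- `u ∈ W^λ`: `u ∈ H¹(ℝ²)` and `∫ log(λ + |x|) u² < ∞`. -/
def MemW (lam : ℝ) (u : Plane → ℝ) : Prop :=
  MemH1 u ∧ Integrable (fun x => Real.log (lam + ‖x‖) * u x ^ 2) volume

section Auxiliary

lemma IsTest.memLp {φ : Plane → ℝ} (hφ : IsTest φ) : MemLp φ 2 volume :=
  hφ.1.continuous.memLp_of_hasCompactSupport hφ.2

lemma IsTest.memLp_fderiv {φ : Plane → ℝ} (hφ : IsTest φ) (v : Plane) :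
    MemLp (fun x => fderiv ℝ φ x v) 2 volume := by
  have hc : Continuous fun x => fderiv ℝ φ x v :=
    (hφ.1.continuous_fderiv (by simp)).clm_apply continuous_const
  exact hc.memLp_of_hasCompactSupport (hφ.2.fderiv_apply ℝ v)

lemma memLp_coord {g : Plane → Plane} (hg : MemLp g 2 volume) (i : Fin 2) :
    MemLp (fun x => g x i) 2 volume :=
  hg.of_le ((PiLp.continuous_apply 2 (fun _ : Fin 2 => ℝ) i).comp_aestronglyMeasurable hg.1)
    (Eventually.of_forall fun x => PiLp.norm_apply_le (g x) i)

lemma IsWeakGradient.congr {u v : Plane → ℝ} {g : Plane → Plane} (huv : u =ᵐ[volume] v)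
    (h : IsWeakGradient u g) : IsWeakGradient v g := by
  intro φ hφ i
  rw [← h φ hφ i]
  refine integral_congr_ae ?_
  filter_upwards [huv] with x hx
  rw [hx]

lemma MemW.congr {lam : ℝ} {u v : Plane → ℝ} (huv : u =ᵐ[volume] v) (h : MemW lam u) :
    MemW lam v := by
  obtain ⟨⟨hu, g, hg, hug⟩, hl⟩ := h
  refine ⟨⟨hu.ae_eq huv, g, hg, hug.congr huv⟩, hl.congr ?_⟩
  filter_upwards [huv] with x hx
  rw [hx]

lemma MemW.zero (lam : ℝ) : MemW lam (fun _ => 0) := by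
  refine ⟨⟨MemLp.zero, fun _ => 0, MemLp.zero, ?_⟩, by simp⟩
  intro φ _ i
  simp

lemma MemW.add {lam : ℝ} {u v : Plane → ℝ} (hu : MemW lam u) (hv : MemW lam v) :
    MemW lam (fun x => u x + v x) := by
  obtain ⟨⟨hu2, g, hg, hug⟩, hul⟩ := hu
  obtain ⟨⟨hv2, k, hk, hvk⟩, hvl⟩ := hv
  refine ⟨⟨hu2.add hv2, fun x => g x + k x, hg.add hk, ?_⟩, ?_⟩
  · intro φ hφ i
    have e1 := hug φ hφ i
    have e2 := hvk φ hφ i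
    have i1 := hu2.integrable_mul (hφ.memLp_fderiv (EuclideanSpace.single i 1))
    have i2 := hv2.integrable_mul (hφ.memLp_fderiv (EuclideanSpace.single i 1))
    have i3 := (memLp_coord hg i).integrable_mul hφ.memLp
    have i4 := (memLp_coord hk i).integrable_mul hφ.memLp
    have h1 : ∫ x, (u x + v x) * fderiv ℝ φ x (EuclideanSpace.single i 1) =
        (∫ x, u x * fderiv ℝ φ x (EuclideanSpace.single i 1)) +
          ∫ x, v x * fderiv ℝ φ x (EuclideanSpace.single i 1) :=
      (integral_congr_ae (Eventually.of_forall fun x => add_mul _ _ _)).trans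
        (integral_add i1 i2)
    have h2 : ∫ x, (g x + k x) i * φ x = (∫ x, g x i * φ x) + ∫ x, k x i * φ x :=
      (integral_congr_ae (Eventually.of_forall fun x => add_mul _ _ _)).trans
        (integral_add i3 i4)
    rw [h1, h2, e1, e2, neg_add]
  · have hm : AEStronglyMeasurable
        (fun x : Plane => Real.log (lam + ‖x‖) * (u x + v x) ^ 2) volume := by
      refine AEStronglyMeasurable.mul ?_ ((hu2.1.add hv2.1).pow 2)
      exact (Real.measurable_log.comp (by fun_prop)).aestronglyMeasurable
    refine ((hul.norm.add hvl.norm).const_mul 2).mono' hm (Eventually.of_forall fun x => ?_)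
    have hs : (u x + v x) ^ 2 ≤ 2 * (u x ^ 2 + v x ^ 2) := by nlinarith [sq_nonneg (u x - v x)]
    have ha := abs_nonneg (Real.log (lam + ‖x‖))
    simp only [Pi.add_apply, norm_mul, Real.norm_eq_abs, abs_pow, sq_abs]
    nlinarith [mul_le_mul_of_nonneg_left hs ha]

lemma MemW.smul {lam : ℝ} {u : Plane → ℝ} (c : ℝ) (hu : MemW lam u) :
    MemW lam (fun x => c * u x) := by
  obtain ⟨⟨hu2, g, hg, hug⟩, hul⟩ := hu
  refine ⟨⟨hu2.const_mul c, fun x => c • g x, hg.const_smul c, ?_⟩, ?_⟩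
  · intro φ hφ i
    have h1 : ∫ x, c * u x * fderiv ℝ φ x (EuclideanSpace.single i 1) =
        c * ∫ x, u x * fderiv ℝ φ x (EuclideanSpace.single i 1) := by
      rw [← integral_const_mul]
      exact integral_congr_ae (Eventually.of_forall fun x => mul_assoc _ _ _)
    have h2 : ∫ x, (c • g x) i * φ x = c * ∫ x, g x i * φ x := by
      rw [← integral_const_mul]
      exact integral_congr_ae (Eventually.of_forall fun x => mul_assoc _ _ _)
    rw [h1, h2, hug φ hφ i, mul_neg]
  · refine (hul.const_mul (c ^ 2)).congr (Eventually.of_forall fun x => ?_)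
    simp only
    ring

end Auxiliary

/-- The space `W^λ`, as a vector subspace of the space `L²(ℝ²)` of almost-everywhere classes.
It is used with the norm `wNorm` below, not with the norm inherited from `L²`. -/
def W (lam : ℝ) : Submodule ℝ (Lp ℝ 2 (volume : Measure Plane)) where
  carrier := {u | MemW lam u}
  zero_mem' := (MemW.zero lam).congr (Lp.coeFn_zero ℝ 2 volume).symm
  add_mem' {u v} hu hv := (MemW.add hu hv).congr (Lp.coeFn_add u v).symm
  smul_mem' c u hu := (MemW.smul c hu).congr (Lp.coeFn_smul c u).symm

/-- The function `ℝ² → ℝ` underlying an element of `W^λ`. -/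
abbrev rep {lam : ℝ} (u : W lam) : Plane → ℝ := ⇑(u : Lp ℝ 2 (volume : Measure Plane))

/-- `‖u‖₂²`. -/
def massSq (u : Plane → ℝ) : ℝ := ∫ x, u x ^ 2

/-- `‖∇u‖₂²`. -/
def gradSq (u : Plane → ℝ) : ℝ := ∫ x, ‖weakGrad u x‖ ^ 2

/-- `‖u‖_{λ,*}² = ∫ log(λ + |x|) u² dx`. -/
def logSq (lam : ℝ) (u : Plane → ℝ) : ℝ := ∫ x, Real.log (lam + ‖x‖) * u x ^ 2

/-- The norm `‖u‖_{W^λ} = (‖∇u‖₂² + ‖u‖₂² + ‖u‖_{λ,*}²)^{1/2}` of `W^λ`. -/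
def wNorm {lam : ℝ} (u : W lam) : ℝ := √(gradSq (rep u) + massSq (rep u) + logSq lam (rep u))

/-- Weak convergence in `(W^λ, ‖·‖_{W^λ})`: convergence against every linear functional that is
bounded for the norm `wNorm`. -/
def WeakTendsto {lam : ℝ} {ι : Type*} (w : ι → W lam) (l : Filter ι) (w₀ : W lam) : Prop :=
  ∀ ℓ : W lam →ₗ[ℝ] ℝ, (∃ C : ℝ, ∀ z, |ℓ z| ≤ C * wNorm z) →
    Tendsto (fun i => ℓ (w i)) l (𝓝 (ℓ w₀))

/-- The logarithmic potential `φ_{u,v}(x) = ∫ log|x - y| (u²(y) + v²(y)) dy`. -/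
def potential (u v : Plane → ℝ) (x : Plane) : ℝ :=
  ∫ y, Real.log ‖x - y‖ * (u y ^ 2 + v y ^ 2)

/-- `𝒱(u,v) = ∬ log|x - y| (u²(y) + v²(y)) (u²(x) + v²(x)) dy dx`. -/
def logEnergy (u v : Plane → ℝ) : ℝ :=
  ∫ x, ∫ y, Real.log ‖x - y‖ * (u y ^ 2 + v y ^ 2) * (u x ^ 2 + v x ^ 2)

/-- `ψ_β(u,v) = ‖u‖_{2p}^{2p} + ‖v‖_{2p}^{2p} + 2β ∫ |uv|^p`. -/
def powerTerm (p β : ℝ) (u v : Plane → ℝ) : ℝ :=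
  (∫ x, |u x| ^ (2 * p)) + (∫ x, |v x| ^ (2 * p)) + 2 * β * ∫ x, |u x * v x| ^ p

/-- The energy functional `I_β` on `W^λ × W^λ`. -/
def energy (p β : ℝ) {lam : ℝ} (w : W lam × W lam) : ℝ :=
  1 / 2 * (gradSq (rep w.1) + gradSq (rep w.2)) + 1 / 4 * logEnergy (rep w.1) (rep w.2)
    - 1 / (2 * p) * powerTerm p β (rep w.1) (rep w.2)

/-- The Nehari–Pohozaev functional `J_β` on `W^λ × W^λ`. -/
def nehariPohozaev (p β : ℝ) {lam : ℝ} (w : W lam × W lam) : ℝ :=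
  2 * (gradSq (rep w.1) + gradSq (rep w.2)) - 1 / 4 * (massSq (rep w.1) + massSq (rep w.2)) ^ 2
    + logEnergy (rep w.1) (rep w.2) - (4 * p - 2) / (2 * p) * powerTerm p β (rep w.1) (rep w.2)

/-- The Nehari–Pohozaev manifold `M_β = {w ∈ (W^λ × W^λ) \ {(0,0)} : J_β(w) = 0}`. -/
def manifold (p β lam : ℝ) : Set (W lam × W lam) :=
  {w | w ≠ 0 ∧ nehariPohozaev p β w = 0}

/-- `c_β = inf_{M_β} I_β`. -/
def groundLevel (p β lam : ℝ) : ℝ := sInf (energy p β '' manifold p β lam)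

/-- One equation of the system, in weak form:
`∫ ∇u·∇φ + ∫ φ_{u,v} u φ = ∫ (|u|^{2p-2} u + β |v|^p |u|^{p-2} u) φ` for all `φ ∈ C₀^∞(ℝ²)`. -/
def WeakEquation (p β : ℝ) (u v : Plane → ℝ) : Prop :=
  ∀ φ : Plane → ℝ, IsTest φ →
    (∫ x, inner ℝ (weakGrad u x) (gradient φ x)) + ∫ x, potential u v x * u x * φ x =
      ∫ x, (|u x| ^ (2 * p - 2) * u x + β * |v x| ^ p * |u x| ^ (p - 2) * u x) * φ x

/-- `w = (u,v) ∈ W^λ × W^λ` is a weak solution of the system `(S_β)`.  (The potential is symmetric: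
`φ_{u,v} = φ_{v,u}`.) -/
def IsWeakSolution (p β : ℝ) {lam : ℝ} (w : W lam × W lam) : Prop :=
  WeakEquation p β (rep w.1) (rep w.2) ∧ WeakEquation p β (rep w.2) (rep w.1)

/-- `w = (u,v)` is a nonnegative weak solution of `(S_β)` that lies on `M_β` and has energy `c_β`. -/
structure IsMinimalSolution (p β : ℝ) {lam : ℝ} (w : W lam × W lam) : Prop where
  nonneg_fst : ∀ᵐ x, 0 ≤ rep w.1 x
  nonneg_snd : ∀ᵐ x, 0 ≤ rep w.2 x
  weakSolution : IsWeakSolution p β w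
  mem_manifold : w ∈ manifold p β lam
  energy_eq : energy p β w = groundLevel p β lam

/-- `z` is the translate `u(· - y)` of `u`. -/
def IsTranslate {lam : ℝ} (z u : W lam) (y : Plane) : Prop :=
  rep z =ᵐ[volume] fun x => rep u (x - y)

end HartreeFock

end

open HartreeFock

namespace HartreeFock

/-! ### Square integrable functions -/

section SquareIntegrable

variable {α : Type*} [MeasurableSpace α] {μ : Measure α}
  {E : Type*} [NormedAddCommGroup E] [InnerProductSpace ℝ E]

/-! Everything rests on the fibres `t ↦ (t² u(t·), t² v(t·))`. Write `A`, `V`, `M`, `P` for the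
gradient, logarithmic, mass and power terms. Along a fibre they become `t⁴ A`, `t⁴ (V - M² log t)`,
`t² M` and `t^(4p-2) P`. The functional `J_β` is the derivative of the energy along the fibre at `t
= 1`. Divided by `t⁴` it is strictly decreasing in `t` and tends to `+∞` at `0`, so each nonzero
pair meets `M_β` exactly once, at the maximum of its fibre (`exists_fibreReduced_eq_zero`,
`fibreReduced_lt`, `fibreEnergy_le_one`). On `M_β` the energy equals `I_β - J_β / 4 = M² / 16 + (2p
- 3) / (4p) P`, which is nonnegative, increases with `t`, and no longer contains the indefinite term
`V`.

Compactness is proved under the inequality `J_β ≤ 0`, which survives limits, instead of `J_β = 0`.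
The logarithm is split into `log⁺ |z| - log⁺ |z|⁻¹`. The near kernel is in `L²`, so its energy is
controlled by mass and gradient and is continuous for strong `L²` convergence under `H¹` bounds. The
far energy is nonnegative and lower semicontinuous by Fatou. A bound on `M² / 16 + (2p - 3) / (4p)
P` thus bounds mass, gradient and far energy (`exists_bound_of_nehari_nonpos`). The mass is also
bounded below for bounded `β` (`exists_mass_lower_bound`). Together these bounds yield a translation
after which the pair is bounded in `W^λ` (`exists_translate_bound`). The embedding of `W^λ` into
`L²` is compact, because the weight controls tails and the gradient controls mollification errors
(`exists_strong_subseq`). The limit satisfies `J_β ≤ 0`, and its reduced energy is the limit of the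
reduced energies. If `J_β` were negative there, moving down the fibre to `M_β` would strictly lower
the reduced energy, so the limit of a minimizing sequence is a minimizer
(`minimizer_of_pairReduced_le`). Taking absolute values does not increase the gradient term, and the
same projection argument gives a nonnegative minimizer.

The Euler–Lagrange equation needs no Lagrange multiplier: a minimizer on `M_β` is a minimum over
fibres of the maximum along the fibre. Comparing a perturbed fibre with the original one at the same
parameter gives a local minimum to which Fermat's rule applies (`fibre_critical`).

For `β ≤ 1` the pair `(√(u² + v²), 0)` has the same mass and logarithmic energy as `(u, v)`, no
larger gradient term, and at least as large a power term. Since the energy of a pair `(U, 0)` does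
not depend on `β`, one pair `(U, 0)` is a minimizer for all `β` in `[0, 1]`, and the family required
in (a) can be constant near `0` (`exists_semitrivial_isGround`). For arbitrary minimizers with `β_n
→ 0`, the compactness argument applies because `c_β ≤ c_0`. For (b), the projection of a fixed test
pair to `M_β` has parameter tending to `0` as `β → ∞`, so `c_β → 0`, and `M² / 16 ≤ c_β`
(`tendsto_groundLevel`). -/

lemma inner_toLp {f g : α → E} (hf : MemLp f 2 μ) (hg : MemLp g 2 μ) :
    inner ℝ (hf.toLp f) (hg.toLp g) = ∫ x, inner ℝ (f x) (g x) ∂μ := by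
  rw [L2.inner_def]
  refine integral_congr_ae ?_
  filter_upwards [hf.coeFn_toLp, hg.coeFn_toLp] with x h1 h2
  rw [h1, h2]

lemma norm_toLp_sq {f : α → E} (hf : MemLp f 2 μ) :
    ‖hf.toLp f‖ ^ 2 = ∫ x, ‖f x‖ ^ 2 ∂μ := by
  rw [← real_inner_self_eq_norm_sq, inner_toLp hf hf]
  simp_rw [real_inner_self_eq_norm_sq]

lemma integrable_norm_sq {E : Type*} [NormedAddCommGroup E] {f : α → E} (hf : MemLp f 2 μ) :
    Integrable (fun x => ‖f x‖ ^ 2) μ :=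
  (memLp_two_iff_integrable_sq_norm hf.1).1 hf

lemma abs_integral_inner_le {f g : α → E} (hf : MemLp f 2 μ) (hg : MemLp g 2 μ) :
    |∫ x, inner ℝ (f x) (g x) ∂μ| ≤ √(∫ x, ‖f x‖ ^ 2 ∂μ) * √(∫ x, ‖g x‖ ^ 2 ∂μ) := by
  rw [← inner_toLp hf hg, ← norm_toLp_sq hf, ← norm_toLp_sq hg, Real.sqrt_sq (norm_nonneg _),
    Real.sqrt_sq (norm_nonneg _)]
  exact abs_real_inner_le_norm _ _

lemma abs_integral_mul_le {f g : α → ℝ} (hf : MemLp f 2 μ) (hg : MemLp g 2 μ) :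
    |∫ x, f x * g x ∂μ| ≤ √(∫ x, f x ^ 2 ∂μ) * √(∫ x, g x ^ 2 ∂μ) := by
  simpa [mul_comm] using abs_integral_inner_le hg hf

lemma integral_mul_sq_le {f g : α → ℝ} (hf : MemLp f 2 μ) (hg : MemLp g 2 μ) :
    (∫ x, f x * g x ∂μ) ^ 2 ≤ (∫ x, f x ^ 2 ∂μ) * ∫ x, g x ^ 2 ∂μ := by
  have h := abs_integral_mul_le hf hg
  rw [← Real.sqrt_mul (integral_nonneg fun x => sq_nonneg _)] at h
  rw [← sq_abs]
  exact (Real.le_sqrt (abs_nonneg _) (mul_nonneg (integral_nonneg fun x => sq_nonneg _)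
    (integral_nonneg fun x => sq_nonneg _))).1 h

/-- Bounded sequences in a separable Hilbert space have weakly convergent subsequences. -/
lemma exists_weak_subseq {H : Type*} [NormedAddCommGroup H] [InnerProductSpace ℝ H]
    [CompleteSpace H] [TopologicalSpace.SeparableSpace H] {f : ℕ → H} {K : ℝ}
    (hf : ∀ n, ‖f n‖ ≤ K) :
    ∃ (k : ℕ → ℕ) (g : H), StrictMono k ∧ ‖g‖ ≤ K ∧
      ∀ h, Tendsto (fun n => inner ℝ (f (k n)) h) atTop (𝓝 (inner ℝ g h)) := by
  have hc := WeakDual.isSeqCompact_closedBall ℝ H 0 K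
  let F : ℕ → WeakDual ℝ H := fun n => StrongDual.toWeakDual (InnerProductSpace.toDual ℝ H (f n))
  have hF : ∀ n, F n ∈ WeakDual.toStrongDual ⁻¹' Metric.closedBall (0 : StrongDual ℝ H) K := by
    intro n
    simp only [F, mem_preimage, Metric.mem_closedBall, dist_zero_right]
    simpa using hf n
  obtain ⟨L, hL, k, hk, hlim⟩ := hc hF
  refine ⟨k, (InnerProductSpace.toDual ℝ H).symm (WeakDual.toStrongDual L), hk, ?_, fun h => ?_⟩
  · simpa using hL
  · have h1 := (WeakDual.eval_continuous h).tendsto L |>.comp hlim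
    simp only [InnerProductSpace.toDual_symm_apply]
    exact h1

end SquareIntegrable

/-! ### Test functions and weak gradients -/

lemma IsTest.continuous {φ : Plane → ℝ} (hφ : IsTest φ) : Continuous φ := hφ.1.continuous

lemma ae_eq_of_test {f g : Plane → ℝ} (hf : MemLp f 2 volume) (hg : MemLp g 2 volume)
    (h : ∀ φ, IsTest φ → ∫ x, f x * φ x = ∫ x, g x * φ x) : f =ᵐ[volume] g := by
  refine ae_eq_of_integral_contDiff_smul_eq (hf.locallyIntegrable (by norm_num))
    (hg.locallyIntegrable (by norm_num)) fun φ h1 h2 => ?_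
  simpa [mul_comm] using h φ ⟨h1, h2⟩

lemma IsWeakGradient.ae_eq {u : Plane → ℝ} {g k : Plane → Plane} (hg : MemLp g 2 volume)
    (hk : MemLp k 2 volume) (h1 : IsWeakGradient u g) (h2 : IsWeakGradient u k) :
    g =ᵐ[volume] k := by
  have h : ∀ i : Fin 2, (fun x => g x i) =ᵐ[volume] fun x => k x i := fun i =>
    ae_eq_of_test (memLp_coord hg i) (memLp_coord hk i) fun φ hφ =>
      neg_injective ((h1 φ hφ i).symm.trans (h2 φ hφ i))
  filter_upwards [h 0, h 1] with x h0 h1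
  ext i
  fin_cases i
  · exact h0
  · exact h1

lemma MemH1.memLp_weakGrad {u : Plane → ℝ} (hu : MemH1 u) : MemLp (weakGrad u) 2 volume := by
  rw [weakGrad, dif_pos hu.2]
  exact hu.2.choose_spec.1

lemma MemH1.isWeakGradient {u : Plane → ℝ} (hu : MemH1 u) : IsWeakGradient u (weakGrad u) := by
  rw [weakGrad, dif_pos hu.2]
  exact hu.2.choose_spec.2

lemma weakGrad_ae_eq {u : Plane → ℝ} {g : Plane → Plane} (hg : MemLp g 2 volume)
    (h : IsWeakGradient u g) : weakGrad u =ᵐ[volume] g := by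
  have hex : ∃ g : Plane → Plane, MemLp g 2 volume ∧ IsWeakGradient u g := ⟨g, hg, h⟩
  rw [weakGrad, dif_pos hex]
  exact IsWeakGradient.ae_eq hex.choose_spec.1 hg hex.choose_spec.2 h

/-- The predicate from which `weakGrad` chooses depends only on the almost-everywhere class of the
function, so the chosen gradients are equal as functions and not merely almost everywhere. -/
lemma weakGrad_congr {u v : Plane → ℝ} (h : u =ᵐ[volume] v) : weakGrad u = weakGrad v := by
  have : IsWeakGradient u = IsWeakGradient v := by
    funext g
    exact propext ⟨fun hu => hu.congr h, fun hv => hv.congr h.symm⟩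
  unfold weakGrad
  rw [this]

lemma gradSq_congr {u v : Plane → ℝ} (h : u =ᵐ[volume] v) : gradSq u = gradSq v := by
  rw [gradSq, gradSq, weakGrad_congr h]

lemma gradSq_eq {u : Plane → ℝ} {g : Plane → Plane} (hg : MemLp g 2 volume)
    (h : IsWeakGradient u g) : gradSq u = ∫ x, ‖g x‖ ^ 2 := by
  refine integral_congr_ae ?_
  filter_upwards [weakGrad_ae_eq hg h] with x hx
  rw [hx]

lemma gradSq_nonneg (u : Plane → ℝ) : 0 ≤ gradSq u := integral_nonneg fun _ => sq_nonneg _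

lemma massSq_nonneg (u : Plane → ℝ) : 0 ≤ massSq u := integral_nonneg fun _ => sq_nonneg _

lemma integrable_mul_test {f φ : Plane → ℝ} (hf : MemLp f 2 volume) (hφ : IsTest φ) :
    Integrable (fun x => f x * φ x) := hf.integrable_mul hφ.memLp

lemma IsWeakGradient.add {u v : Plane → ℝ} {g k : Plane → Plane} (hu : MemLp u 2 volume)
    (hv : MemLp v 2 volume) (hg : MemLp g 2 volume) (hk : MemLp k 2 volume)
    (hug : IsWeakGradient u g) (hvk : IsWeakGradient v k) :
    IsWeakGradient (fun x => u x + v x) (fun x => g x + k x) := by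
  intro φ hφ i
  have h1 : ∫ x, (u x + v x) * fderiv ℝ φ x (EuclideanSpace.single i 1) =
      (∫ x, u x * fderiv ℝ φ x (EuclideanSpace.single i 1)) +
        ∫ x, v x * fderiv ℝ φ x (EuclideanSpace.single i 1) := by
    simp_rw [add_mul]
    exact integral_add (hu.integrable_mul (hφ.memLp_fderiv _))
      (hv.integrable_mul (hφ.memLp_fderiv _))
  have h2 : ∫ x, (g x + k x) i * φ x = (∫ x, g x i * φ x) + ∫ x, k x i * φ x := by
    simp_rw [PiLp.add_apply, add_mul]
    exact integral_add (integrable_mul_test (memLp_coord hg i) hφ)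
      (integrable_mul_test (memLp_coord hk i) hφ)
  rw [h1, h2, hug φ hφ i, hvk φ hφ i, neg_add]

lemma IsWeakGradient.smul {u : Plane → ℝ} {g : Plane → Plane} (c : ℝ)
    (hug : IsWeakGradient u g) : IsWeakGradient (fun x => c * u x) (fun x => c • g x) := by
  intro φ hφ i
  simp_rw [PiLp.smul_apply, smul_eq_mul, mul_assoc, integral_const_mul, hug φ hφ i, mul_neg]

lemma IsTest.integrable {φ : Plane → ℝ} (hφ : IsTest φ) : Integrable φ :=
  hφ.continuous.integrable_of_hasCompactSupport hφ.2

lemma IsTest.gradient_apply {φ : Plane → ℝ} (x : Plane) (i : Fin 2) :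
    gradient φ x i = fderiv ℝ φ x (EuclideanSpace.single i 1) := by
  have h : inner ℝ (gradient φ x) (EuclideanSpace.single i (1 : ℝ)) =
      fderiv ℝ φ x (EuclideanSpace.single i 1) := by
    rw [gradient, InnerProductSpace.toDual_symm_apply]
  rw [← h, EuclideanSpace.inner_single_right]
  simp

lemma norm_gradient (φ : Plane → ℝ) (x : Plane) : ‖gradient φ x‖ = ‖fderiv ℝ φ x‖ := by
  rw [gradient, LinearIsometryEquiv.norm_map]

lemma IsTest.memLp_gradient {φ : Plane → ℝ} (hφ : IsTest φ) :
    MemLp (fun x => gradient φ x) 2 volume := by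
  have hc : Continuous fun x => gradient φ x :=
    (InnerProductSpace.toDual ℝ Plane).symm.continuous.comp (hφ.1.continuous_fderiv (by simp))
  refine hc.memLp_of_hasCompactSupport (hφ.2.fderiv ℝ |>.mono fun x hx => ?_)
  simp only [Function.mem_support, ne_eq] at hx ⊢
  rw [← norm_eq_zero, norm_gradient] at hx
  simpa using hx

lemma IsTest.isWeakGradient {φ : Plane → ℝ} (hφ : IsTest φ) :
    IsWeakGradient φ (fun x => gradient φ x) := by
  intro ψ hψ i
  simp_rw [IsTest.gradient_apply]
  refine integral_mul_fderiv_eq_neg_fderiv_mul_of_integrable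
    ((hφ.memLp_fderiv _).integrable_mul hψ.memLp) (hφ.memLp.integrable_mul (hψ.memLp_fderiv _))
    (hφ.memLp.integrable_mul hψ.memLp) (fun x _ => hφ.1.differentiable (by simp) x)
    (fun x _ => hψ.1.differentiable (by simp) x)

lemma IsTest.memH1 {φ : Plane → ℝ} (hφ : IsTest φ) : MemH1 φ :=
  ⟨hφ.memLp, _, hφ.memLp_gradient, hφ.isWeakGradient⟩

lemma IsTest.memW {lam : ℝ} (hlam : 0 < lam) {φ : Plane → ℝ} (hφ : IsTest φ) : MemW lam φ := by
  refine ⟨hφ.memH1, Continuous.integrable_of_hasCompactSupport ?_ ?_⟩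
  · refine Continuous.mul (Continuous.log (by fun_prop) fun x => ?_) (hφ.continuous.pow 2)
    positivity
  · refine hφ.2.mono fun x hx => ?_
    simp only [Function.mem_support, ne_eq, mul_eq_zero, not_or] at hx ⊢
    exact fun h => hx.2 (by simp [h])

lemma gradSq_add_smul_test {u φ : Plane → ℝ} (hu : MemH1 u) (hφ : IsTest φ) (s : ℝ) :
    gradSq (fun x => u x + s * φ x) = gradSq u +
      s * (2 * ∫ x, inner ℝ (weakGrad u x) (gradient φ x)) + s ^ 2 * ∫ x, ‖gradient φ x‖ ^ 2 := by
  have hg := hu.memLp_weakGrad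
  have hk := hφ.memLp_gradient
  rw [gradSq_eq (hg.add (hk.const_smul s)) (IsWeakGradient.add hu.1 (hφ.memLp.const_mul s) hg
    (hk.const_smul s) hu.isWeakGradient (hφ.isWeakGradient.smul s))]
  have h : ∀ x, ‖weakGrad u x + s • gradient φ x‖ ^ 2 = ‖weakGrad u x‖ ^ 2 +
      s * (2 * inner ℝ (weakGrad u x) (gradient φ x)) + s ^ 2 * ‖gradient φ x‖ ^ 2 := by
    intro x
    rw [norm_add_sq_real, inner_smul_right, norm_smul, mul_pow, Real.norm_eq_abs, sq_abs]
    ring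
  have hi : Integrable (fun x => inner ℝ (weakGrad u x) (gradient φ x)) :=
    (hg.norm.integrable_mul hk.norm).mono' (hg.1.inner hk.1)
      (Eventually.of_forall fun x => norm_inner_le_norm _ _)
  simp only [Pi.add_apply, Pi.smul_apply]
  simp_rw [h]
  have i1 : Integrable (fun x => ‖weakGrad u x‖ ^ 2 +
      s * (2 * inner ℝ (weakGrad u x) (gradient φ x))) :=
    (integrable_norm_sq hg).add ((hi.const_mul 2).const_mul s)
  rw [integral_add i1 ((integrable_norm_sq hk).const_mul _),
    integral_add (integrable_norm_sq hg) ((hi.const_mul 2).const_mul s), integral_const_mul, integral_const_mul, integral_const_mul]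
  rfl

/-! ### Translations and dilations -/

lemma memLp_comp_sub_right {F : Type*} [NormedAddCommGroup F] {f : Plane → F}
    (hf : MemLp f 2 volume) (y : Plane) : MemLp (fun x => f (x - y)) 2 volume :=
  hf.comp_measurePreserving (measurePreserving_sub_right volume y)

lemma IsTest.comp_add_right {φ : Plane → ℝ} (hφ : IsTest φ) (y : Plane) :
    IsTest (fun x => φ (x + y)) :=
  ⟨hφ.1.comp (contDiff_id.add contDiff_const), hφ.2.comp_homeomorph (Homeomorph.addRight y)⟩

lemma IsWeakGradient.comp_sub_right {u : Plane → ℝ} {g : Plane → Plane}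
    (h : IsWeakGradient u g) (y : Plane) :
    IsWeakGradient (fun x => u (x - y)) (fun x => g (x - y)) := by
  intro φ hφ i
  have h1 := h _ (hφ.comp_add_right y) i
  rw [← integral_sub_right_eq_self _ y, ← integral_sub_right_eq_self (μ := volume)
    (fun x => g x i * φ (x + y)) y] at h1
  simpa [fderiv_comp_add_right] using h1

lemma MemH1.comp_sub_right {u : Plane → ℝ} (hu : MemH1 u) (y : Plane) :
    MemH1 (fun x => u (x - y)) :=
  ⟨memLp_comp_sub_right hu.1 y, _, memLp_comp_sub_right hu.memLp_weakGrad y,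
    hu.isWeakGradient.comp_sub_right y⟩

lemma gradSq_comp_sub_right {u : Plane → ℝ} (hu : MemH1 u) (y : Plane) :
    gradSq (fun x => u (x - y)) = gradSq u := by
  rw [gradSq_eq (memLp_comp_sub_right hu.memLp_weakGrad y) (hu.isWeakGradient.comp_sub_right y)]
  exact integral_sub_right_eq_self (fun x => ‖weakGrad u x‖ ^ 2) y

lemma integral_comp_smul_plane {F : Type*} [NormedAddCommGroup F] [NormedSpace ℝ F]
    (f : Plane → F) (t : ℝ) : ∫ x, f (t • x) = (t ^ 2)⁻¹ • ∫ x, f x := by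
  rw [Measure.integral_comp_smul]
  simp [abs_of_nonneg (sq_nonneg t)]

lemma memLp_comp_smul {F : Type*} [NormedAddCommGroup F] {f : Plane → F} {q : ENNReal}
    (hf : MemLp f q volume) {t : ℝ} (ht : t ≠ 0) : MemLp (fun x => f (t • x)) q volume := by
  have h : Measure.map (fun x : Plane => t • x) volume =
      ENNReal.ofReal |(t ^ Module.finrank ℝ Plane)⁻¹| • volume :=
    Measure.map_addHaar_smul volume ht
  have h2 : MemLp f q (Measure.map (fun x : Plane => t • x) volume) := by
    rw [h]
    exact hf.smul_measure ENNReal.ofReal_ne_top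
  exact h2.comp_of_map (by fun_prop)

lemma IsTest.comp_smul {φ : Plane → ℝ} (hφ : IsTest φ) {t : ℝ} (ht : t ≠ 0) :
    IsTest (fun x => φ (t • x)) :=
  ⟨hφ.1.comp (contDiff_const_smul t), hφ.2.comp_homeomorph (Homeomorph.smulOfNeZero t ht)⟩

lemma IsWeakGradient.comp_smul {u : Plane → ℝ} {g : Plane → Plane}
    (h : IsWeakGradient u g) {t : ℝ} (ht : t ≠ 0) :
    IsWeakGradient (fun x => u (t • x)) (fun x => t • g (t • x)) := by
  intro φ hφ i
  have h1 := h _ (hφ.comp_smul (inv_ne_zero ht)) i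
  have e1 := integral_comp_smul_plane (fun x => u x * fderiv ℝ φ (t⁻¹ • x)
    (EuclideanSpace.single i 1)) t
  have e2 := integral_comp_smul_plane (fun x => g x i * φ (t⁻¹ • x)) t
  simp only [smul_smul, inv_mul_cancel₀ ht, one_smul] at e1 e2
  have e3 : ∀ x, fderiv ℝ (fun y => φ (t⁻¹ • y)) x = t⁻¹ • fderiv ℝ φ (t⁻¹ • x) := fun x =>
    fderiv_comp_smul _
  simp only [e3, _root_.smul_apply, smul_eq_mul] at h1
  have e4 : ∫ x, u x * (t⁻¹ * fderiv ℝ φ (t⁻¹ • x) (EuclideanSpace.single i 1)) =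
      t⁻¹ * ∫ x, u x * fderiv ℝ φ (t⁻¹ • x) (EuclideanSpace.single i 1) := by
    rw [← integral_const_mul]
    exact integral_congr_ae (Eventually.of_forall fun x => by ring)
  rw [e4] at h1
  simp_rw [PiLp.smul_apply, smul_eq_mul, mul_assoc, integral_const_mul]
  rw [e1, e2, smul_eq_mul, smul_eq_mul]
  rw [inv_mul_eq_iff_eq_mul₀ ht] at h1
  rw [h1]
  ring

lemma MemH1.dilate {u : Plane → ℝ} (hu : MemH1 u) (c : ℝ) {t : ℝ} (ht : t ≠ 0) :
    MemH1 (fun x => c * u (t • x)) :=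
  ⟨(memLp_comp_smul hu.1 ht).const_mul c, _,
    ((memLp_comp_smul hu.memLp_weakGrad ht).const_smul t).const_smul c,
    (hu.isWeakGradient.comp_smul ht).smul c⟩

/-- In dimension two the factor `t²` from the chain rule cancels the Jacobian `t⁻²`, so only the
amplitude `c` is left. -/
lemma gradSq_dilate {u : Plane → ℝ} (hu : MemH1 u) (c : ℝ) {t : ℝ} (ht : t ≠ 0) :
    gradSq (fun x => c * u (t • x)) = c ^ 2 * gradSq u := by
  rw [gradSq_eq (((memLp_comp_smul hu.memLp_weakGrad ht).const_smul t).const_smul c)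
    ((hu.isWeakGradient.comp_smul ht).smul c)]
  have h : ∀ x, ‖c • t • weakGrad u (t • x)‖ ^ 2 = c ^ 2 * (t ^ 2 * ‖weakGrad u (t • x)‖ ^ 2) := by
    intro x
    simp [norm_smul, mul_pow]
  simp only [Pi.smul_apply]
  simp_rw [h, integral_const_mul, integral_comp_smul_plane (fun x => ‖weakGrad u x‖ ^ 2)]
  rw [smul_eq_mul, mul_inv_cancel_left₀ (pow_ne_zero 2 ht)]
  rfl

/-! ### Difference quotients -/

/-- The subspace of `L²` spanned by test functions. -/
def testSubmodule : Submodule ℝ (Lp ℝ 2 (volume : Measure Plane)) where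
  carrier := {f | ∃ φ, IsTest φ ∧ f =ᵐ[volume] φ}
  zero_mem' := ⟨fun _ => 0, ⟨contDiff_const, HasCompactSupport.zero⟩, Lp.coeFn_zero ℝ 2 volume⟩
  add_mem' := by
    rintro f g ⟨φ, hφ, hf⟩ ⟨ψ, hψ, hg⟩
    exact ⟨φ + ψ, ⟨hφ.1.add hψ.1, hφ.2.add hψ.2⟩, (Lp.coeFn_add f g).trans (hf.add hg)⟩
  smul_mem' := by
    rintro c f ⟨φ, hφ, hf⟩
    exact ⟨c • φ, ⟨hφ.1.const_smul c, hφ.2.smul_left (f := fun _ => c)⟩,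
      (Lp.coeFn_smul c f).trans (hf.const_smul c)⟩

lemma toLp_mem_testSubmodule {φ : Plane → ℝ} (hφ : IsTest φ) :
    hφ.memLp.toLp φ ∈ testSubmodule := ⟨φ, hφ, hφ.memLp.coeFn_toLp⟩

/-- A vector orthogonal to all test functions vanishes by the fundamental lemma of the calculus of
variations. -/
lemma testSubmodule_dense : testSubmodule.topologicalClosure = ⊤ := by
  rw [Submodule.topologicalClosure_eq_top_iff, Submodule.eq_bot_iff]
  intro f hf
  rw [Submodule.mem_orthogonal'] at hf
  have h0 : f =ᵐ[volume] fun _ => (0 : ℝ) := by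
    refine ae_eq_of_test (Lp.memLp f) MemLp.zero fun φ hφ => ?_
    have h := hf _ (toLp_mem_testSubmodule hφ)
    rw [L2.inner_def] at h
    simp only [zero_mul, integral_zero]
    rw [← h]
    refine integral_congr_ae ?_
    filter_upwards [hφ.memLp.coeFn_toLp] with x hx
    simp [hx, mul_comm]
  exact Lp.ext (h0.trans (Lp.coeFn_zero ℝ 2 volume).symm)

/-- The `L²` norm is computed by duality against test functions. -/
lemma integral_sq_le_of_test {f : Plane → ℝ} (hf : MemLp f 2 volume) {C : ℝ}
    (h : ∀ φ, IsTest φ → |∫ x, f x * φ x| ≤ C * √(∫ x, φ x ^ 2)) :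
    ∫ x, f x ^ 2 ≤ C ^ 2 := by
  set F := hf.toLp f with hF
  have hcl : IsClosed {g : Lp ℝ 2 (volume : Measure Plane) | |inner ℝ F g| ≤ C * ‖g‖} :=
    isClosed_le (by fun_prop) (by fun_prop)
  have hsub : (testSubmodule : Set (Lp ℝ 2 (volume : Measure Plane))) ⊆
      {g | |inner ℝ F g| ≤ C * ‖g‖} := by
    rintro g ⟨φ, hφ, hg⟩
    have hgφ : g = hφ.memLp.toLp φ := Lp.ext (hg.trans hφ.memLp.coeFn_toLp.symm)
    have h1 := h φ hφ
    rw [Set.mem_ofPred_eq, hgφ, hF, inner_toLp, ← Real.sqrt_sq (norm_nonneg (hφ.memLp.toLp φ)),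
      norm_toLp_sq]
    simpa [mul_comm] using h1
  have hmem : F ∈ {g : Lp ℝ 2 (volume : Measure Plane) | |inner ℝ F g| ≤ C * ‖g‖} := by
    refine closure_minimal hsub hcl ?_
    rw [← Submodule.topologicalClosure_coe, testSubmodule_dense]
    trivial
  rw [Set.mem_ofPred_eq, real_inner_self_eq_norm_sq, abs_of_nonneg (sq_nonneg _)] at hmem
  have h2 := norm_toLp_sq hf
  simp only [Real.norm_eq_abs, sq_abs] at h2
  rw [← h2]
  -- `C` is not assumed nonnegative, so dividing `‖F‖² ≤ C ‖F‖` by `‖F‖` requires the case `‖F‖ = 0`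
  -- to be set apart.
  have h3 : ‖F‖ ≤ C ∨ ‖F‖ = 0 := by
    by_contra! h3
    have := lt_of_le_of_ne (norm_nonneg F) h3.2.symm
    nlinarith [h3.1]
  rcases h3 with h3 | h3
  · exact pow_le_pow_left₀ (norm_nonneg _) h3 2
  · rw [h3]
    nlinarith [sq_nonneg C]

/-- The integral is the convolution of `u` with `φ(-·)` evaluated at `t e`, so the derivative falls
on the smooth factor and `u` only has to be locally integrable. -/
lemma hasDerivAt_integral_translate {u φ : Plane → ℝ} (hu : MemLp u 2 volume) (hφ : IsTest φ)
    (e : Plane) (t : ℝ) :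
    HasDerivAt (fun t : ℝ => ∫ x, u x * φ (x - t • e))
      (-∫ x, u x * fderiv ℝ φ (x - t • e) e) t := by
  have hψ : ContDiff ℝ 1 fun x => φ (-x) := (hφ.1.of_le (by simp)).comp contDiff_neg
  have hψc : HasCompactSupport fun x => φ (-x) := hφ.2.comp_homeomorph (Homeomorph.neg Plane)
  have hul : LocallyIntegrable u volume := hu.locallyIntegrable (by norm_num)
  have h1 := hψc.hasFDerivAt_convolution_right (ContinuousLinearMap.mul ℝ ℝ) hul hψ (t • e)
  have h2 := h1.comp_hasDerivAt t ((hasDerivAt_id t).smul_const e)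
  have h3 : ∀ x, fderiv ℝ (fun x => φ (-x)) x = -fderiv ℝ φ (-x) := fun x => by
    simpa using fderiv_comp_smul (f := φ) (x := x) (-1 : ℝ)
  have e1 : (fun t : ℝ => ∫ x, u x * φ (x - t • e)) = convolution u (fun x => φ (-x))
      (ContinuousLinearMap.mul ℝ ℝ) volume ∘ fun y : ℝ => id y • e := by
    funext s
    simp [convolution_def]
  rw [e1]
  refine h2.congr_deriv ?_
  · rw [one_smul, convolution_precompR_apply _ hul (hψc.fderiv ℝ)
      (hψ.continuous_fderiv one_ne_zero), convolution_def, ← integral_neg]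
    simp [h3]

lemma integral_translate_mul {u φ : Plane → ℝ} (y : Plane) :
    ∫ x, u (x + y) * φ x = ∫ x, u x * φ (x - y) := by
  rw [← integral_sub_right_eq_self _ y]
  simp

lemma IsTest.comp_sub_right {φ : Plane → ℝ} (hφ : IsTest φ) (y : Plane) :
    IsTest (fun x => φ (x - y)) := by
  simpa [sub_eq_add_neg] using hφ.comp_add_right (-y)

lemma memLp_comp_add_right {F : Type*} [NormedAddCommGroup F] {f : Plane → F}
    (hf : MemLp f 2 volume) (y : Plane) : MemLp (fun x => f (x + y)) 2 volume :=
  hf.comp_measurePreserving (measurePreserving_add_right volume y)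

/-- By duality it suffices to test the difference against `φ`. The function `t ↦ ∫ u φ(· - t e)` has
derivative `∫ gᵢ φ(· - t e)`, bounded uniformly in `t` by Cauchy–Schwarz, and the mean value
inequality concludes. -/
lemma IsWeakGradient.integral_translate_sub_sq_le {u : Plane → ℝ} {g : Plane → Plane}
    (hu : MemLp u 2 volume) (hg : MemLp g 2 volume) (h : IsWeakGradient u g) (i : Fin 2) (t : ℝ) :
    ∫ x, (u (x + t • EuclideanSpace.single i (1 : ℝ)) - u x) ^ 2 ≤ t ^ 2 * ∫ x, g x i ^ 2 := by
  set e : Plane := EuclideanSpace.single i (1 : ℝ) with he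
  have hD : 0 ≤ ∫ x, g x i ^ 2 := integral_nonneg fun _ => sq_nonneg _
  have key := integral_sq_le_of_test (C := |t| * √(∫ x, g x i ^ 2))
    ((memLp_comp_add_right hu (t • e)).sub hu) ?_
  · rw [mul_pow, sq_abs, Real.sq_sqrt hD] at key
    exact key
  intro φ hφ
  have hb : ∀ s ∈ (univ : Set ℝ), ‖-∫ x, u x * fderiv ℝ φ (x - s • e) e‖ ≤
      √(∫ x, g x i ^ 2) * √(∫ x, φ x ^ 2) := by
    intro s _
    have h1 := h _ (hφ.comp_sub_right (s • e)) i
    have h0 : ∀ x, fderiv ℝ (fun x => φ (x - s • e)) x = fderiv ℝ φ (x - s • e) := fun x => by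
      simpa [sub_eq_add_neg] using fderiv_comp_add_right (𝕜 := ℝ) (f := φ) (x := x) (-(s • e))
    simp only [h0] at h1
    rw [h1, neg_neg]
    refine (abs_integral_mul_le (memLp_coord hg i) (hφ.comp_sub_right (s • e)).memLp).trans_eq ?_
    rw [integral_sub_right_eq_self (fun x => φ x ^ 2)]
  have hmv := convex_univ.norm_image_sub_le_of_norm_hasDerivWithin_le
    (fun s _ => (hasDerivAt_integral_translate hu hφ e s).hasDerivWithinAt) hb
    (mem_univ 0) (mem_univ t)
  simp only [zero_smul, sub_zero, Real.norm_eq_abs] at hmv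
  have e1 : ∫ x, (u (x + t • e) - u x) * φ x =
      (∫ x, u x * φ (x - t • e)) - ∫ x, u x * φ x := by
    rw [← integral_translate_mul, ← integral_sub
      (integrable_mul_test (memLp_comp_add_right hu (t • e)) hφ) (integrable_mul_test hu hφ)]
    simp_rw [sub_mul]
  simp only [Pi.sub_apply]
  rw [e1]
  linarith

lemma coord_sq_add (y : Plane) : y 0 ^ 2 + y 1 ^ 2 = ‖y‖ ^ 2 := by
  rw [EuclideanSpace.norm_sq_eq]
  simp

/-- Summing over the two coordinate directions gives the full gradient with constant `1`. With the
converse `memH1_of_translate`, this lets pointwise contractions pass to gradients without loss and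
without a chain rule. -/
lemma MemH1.sum_integral_translate_sub_sq_le {u : Plane → ℝ} (hu : MemH1 u) (t : ℝ) :
    ∑ i : Fin 2, ∫ x, (u (x + t • EuclideanSpace.single i (1 : ℝ)) - u x) ^ 2 ≤
      t ^ 2 * gradSq u := by
  have h := hu.isWeakGradient.integral_translate_sub_sq_le hu.1 hu.memLp_weakGrad (t := t)
  refine (Finset.sum_le_sum fun i _ => h i).trans_eq ?_
  rw [← Finset.mul_sum, Fin.sum_univ_two, ← integral_add
    (memLp_coord hu.memLp_weakGrad 0).integrable_sq (memLp_coord hu.memLp_weakGrad 1).integrable_sq]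
  simp_rw [coord_sq_add]
  rfl

lemma memLp_plane_of_coord {f : Fin 2 → Plane → ℝ} (hf : ∀ i, MemLp (f i) 2 volume) :
    MemLp (fun x => (WithLp.toLp 2 (fun i => f i x) : Plane)) 2 volume := by
  rw [memLp_two_iff_integrable_sq_norm]
  · simp_rw [← coord_sq_add]
    exact (hf 0).integrable_sq.add (hf 1).integrable_sq
  · exact (PiLp.continuous_toLp 2 (fun _ : Fin 2 => ℝ)).comp_aestronglyMeasurable
      (aemeasurable_pi_lambda _ fun i => (hf i).1.aemeasurable).aestronglyMeasurable

/-- The difference quotients of `u` form an approximate gradient. -/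
lemma memH1_of_translate {u : Plane → ℝ} (hu : MemLp u 2 volume) {C : ℝ} (hC : 0 ≤ C)
    (h : ∀ t : ℝ, ∑ i : Fin 2, ∫ x, (u (x + t • EuclideanSpace.single i (1 : ℝ)) - u x) ^ 2 ≤
      t ^ 2 * C) : MemH1 u ∧ gradSq u ≤ C := by
  let e : Fin 2 → Plane := fun i => EuclideanSpace.single i (1 : ℝ)
  let τ : ℕ → ℝ := fun n => ((n : ℝ) + 1)⁻¹
  have hτ : ∀ n, 0 < τ n := fun n => by positivity
  have hd : ∀ n i, MemLp (fun x => (τ n)⁻¹ * (u (x + τ n • e i) - u x)) 2 volume := fun n i =>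
    ((memLp_comp_add_right hu _).sub hu).const_mul _
  have hG := fun n => memLp_plane_of_coord (hd n)
  have hGn : ∀ n, ‖(hG n).toLp‖ ≤ √C := by
    intro n
    refine Real.le_sqrt_of_sq_le ?_
    rw [norm_toLp_sq]
    simp_rw [← coord_sq_add]
    have := h (τ n)
    rw [Fin.sum_univ_two] at this
    rw [integral_add (hd n 0).integrable_sq (hd n 1).integrable_sq]
    simp_rw [mul_pow, integral_const_mul]
    rw [← mul_add, inv_pow, inv_mul_le_iff₀ (pow_pos (hτ n) 2)]
    exact this
  have : Fact ((2 : ENNReal) ≠ ⊤) := ⟨ENNReal.ofNat_ne_top⟩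
  obtain ⟨k, G, hk, hGC, hlim⟩ := exists_weak_subseq (H := Lp Plane 2 volume) hGn
  have hτ0 : Tendsto τ atTop (𝓝 0) := by
    simpa [τ] using tendsto_one_div_add_atTop_nhds_zero_nat (𝕜 := ℝ)
  have hweak : IsWeakGradient u G := by
    intro φ hφ i
    have hv : MemLp (fun x => φ x • e i) 2 volume :=
      hφ.memLp.of_le (hφ.memLp.1.smul_const (e i)) (Eventually.of_forall fun x => by
        simp [norm_smul, e])
    have h1 := hlim (hv.toLp)
    have e1 : inner ℝ G hv.toLp = ∫ x, G x i * φ x := by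
      have : G = (Lp.memLp G).toLp := (Lp.toLp_coeFn G _).symm
      rw [this, inner_toLp]
      refine integral_congr_ae ?_
      filter_upwards [(Lp.memLp G).coeFn_toLp] with x hx
      rw [hx, inner_smul_right, EuclideanSpace.inner_single_right]
      simp [mul_comm]
    have e2 : ∀ n, inner ℝ (hG n).toLp hv.toLp =
        (τ n)⁻¹ * ((∫ x, u x * φ (x - τ n • e i)) - ∫ x, u x * φ x) := by
      intro n
      rw [inner_toLp, ← integral_translate_mul, ← integral_sub
        (integrable_mul_test (memLp_comp_add_right hu (τ n • e i)) hφ) (integrable_mul_test hu hφ),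
        ← integral_const_mul]
      refine integral_congr_ae (Eventually.of_forall fun x => ?_)
      simp only [e, inner_smul_right, EuclideanSpace.inner_single_right]
      simp
      ring
    -- The pairing of the weak limit with `φ` and the derivative of `t ↦ ∫ u φ(· - t e)` at `0` are
    -- limits of the same difference quotients.
    have h2 := (hasDerivAt_integral_translate hu hφ (e i) 0).tendsto_slope_zero
    have hτ1 : Tendsto (fun n => τ (k n)) atTop (𝓝[≠] 0) :=
      tendsto_nhdsWithin_iff.2 ⟨hτ0.comp hk.tendsto_atTop,
        Eventually.of_forall fun n => (hτ _).ne'⟩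
    have h3 := h2.comp hτ1
    simp only [zero_smul, sub_zero, zero_add, smul_eq_mul, Function.comp_def] at h3
    simp_rw [e2, e1] at h1
    have := tendsto_nhds_unique h1 h3
    rw [this, neg_neg]
  refine ⟨⟨hu, G, Lp.memLp G, hweak⟩, ?_⟩
  rw [gradSq_eq (Lp.memLp G) hweak, ← norm_toLp_sq (Lp.memLp G), Lp.toLp_coeFn]
  calc ‖G‖ ^ 2 ≤ √C ^ 2 := pow_le_pow_left₀ (norm_nonneg _) hGC 2
    _ = C := Real.sq_sqrt hC

/-! ### Gradient inequalities from pointwise contractions -/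

/-- The Euclidean norm of `ℝ²` is `1`-Lipschitz, which is Cauchy–Schwarz for the two vectors. -/
lemma sqrt_add_sq_sub_sq_le (a b c d : ℝ) :
    (√(a ^ 2 + b ^ 2) - √(c ^ 2 + d ^ 2)) ^ 2 ≤ (a - c) ^ 2 + (b - d) ^ 2 := by
  have h1 := Real.sq_sqrt (add_nonneg (sq_nonneg a) (sq_nonneg b))
  have h2 := Real.sq_sqrt (add_nonneg (sq_nonneg c) (sq_nonneg d))
  have h3 : a * c + b * d ≤ √(a ^ 2 + b ^ 2) * √(c ^ 2 + d ^ 2) := by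
    rw [← Real.sqrt_mul (by positivity)]
    refine Real.le_sqrt_of_sq_le ?_
    nlinarith [sq_nonneg (a * d - b * c)]
  nlinarith

lemma memLp_sqrt_add_sq {u v : Plane → ℝ} (hu : MemLp u 2 volume) (hv : MemLp v 2 volume) :
    MemLp (fun x => √(u x ^ 2 + v x ^ 2)) 2 volume := by
  have hm : AEStronglyMeasurable (fun x => √(u x ^ 2 + v x ^ 2)) volume :=
    Real.continuous_sqrt.comp_aestronglyMeasurable ((hu.1.pow 2).add (hv.1.pow 2))
  rw [memLp_two_iff_integrable_sq hm]
  have : ∀ x, √(u x ^ 2 + v x ^ 2) ^ 2 = u x ^ 2 + v x ^ 2 := fun x => Real.sq_sqrt (by positivity)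
  simp_rw [this]
  exact hu.integrable_sq.add hv.integrable_sq

/-- The pointwise contraction bounds each difference quotient of `√(u² + v²)` by those of `u` and
`v`. -/
lemma MemH1.sqrt_add_sq {u v : Plane → ℝ} (hu : MemH1 u) (hv : MemH1 v) :
    MemH1 (fun x => √(u x ^ 2 + v x ^ 2)) ∧
      gradSq (fun x => √(u x ^ 2 + v x ^ 2)) ≤ gradSq u + gradSq v := by
  refine memH1_of_translate (memLp_sqrt_add_sq hu.1 hv.1)
    (add_nonneg (gradSq_nonneg _) (gradSq_nonneg _)) fun t => ?_
  have h1 := add_le_add (hu.sum_integral_translate_sub_sq_le t)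
    (hv.sum_integral_translate_sub_sq_le t)
  rw [← mul_add, ← Finset.sum_add_distrib] at h1
  refine le_trans (Finset.sum_le_sum fun i _ => ?_) h1
  have i1 := ((memLp_comp_add_right hu.1 (t • EuclideanSpace.single i (1 : ℝ))).sub
    hu.1).integrable_sq
  have i2 := ((memLp_comp_add_right hv.1 (t • EuclideanSpace.single i (1 : ℝ))).sub
    hv.1).integrable_sq
  have i3 := ((memLp_comp_add_right (memLp_sqrt_add_sq hu.1 hv.1)
    (t • EuclideanSpace.single i (1 : ℝ))).sub (memLp_sqrt_add_sq hu.1 hv.1)).integrable_sq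
  simp only [Pi.sub_apply] at i1 i2 i3
  rw [← integral_add i1 i2]
  exact integral_mono i3 (i1.add i2) fun x => sqrt_add_sq_sub_sq_le _ _ _ _

lemma MemH1.abs {u : Plane → ℝ} (hu : MemH1 u) :
    MemH1 (fun x => |u x|) ∧ gradSq (fun x => |u x|) ≤ gradSq u := by
  refine memH1_of_translate (by simpa using hu.1.norm) (gradSq_nonneg _) fun t => ?_
  refine le_trans (Finset.sum_le_sum fun i _ => ?_) (hu.sum_integral_translate_sub_sq_le t)
  have i1 := ((memLp_comp_add_right hu.1 (t • EuclideanSpace.single i (1 : ℝ))).sub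
    hu.1).integrable_sq
  have i3 := ((memLp_comp_add_right hu.1.norm
    (t • EuclideanSpace.single i (1 : ℝ))).sub hu.1.norm).integrable_sq
  refine integral_mono i3 i1 fun x => ?_
  exact sq_le_sq.2 (abs_abs_sub_abs_le _ _)

/-- Fatou's lemma for real integrals. -/
lemma integral_le_of_tendsto_ae {α : Type*} [MeasurableSpace α] {μ : Measure α}
    {f : ℕ → α → ℝ} {g : α → ℝ} {a : ℕ → ℝ} {A : ℝ} (hf : ∀ n, Integrable (f n) μ)
    (h0 : ∀ n x, 0 ≤ f n x) (hlim : ∀ᵐ x ∂μ, Tendsto (fun n => f n x) atTop (𝓝 (g x)))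
    (ha : ∀ n, ∫ x, f n x ∂μ ≤ a n) (hA : Tendsto a atTop (𝓝 A)) :
    Integrable g μ ∧ ∫ x, g x ∂μ ≤ A := by
  have hg0 : 0 ≤ᵐ[μ] g := by
    filter_upwards [hlim] with x hx
    exact ge_of_tendsto' hx fun n => h0 n x
  have hgm : AEStronglyMeasurable g μ :=
    aestronglyMeasurable_of_tendsto_ae atTop (fun n => (hf n).1) hlim
  have hA0 : 0 ≤ A := ge_of_tendsto' hA fun n => (integral_nonneg (h0 n)).trans (ha n)
  have key : ∫⁻ x, ENNReal.ofReal (g x) ∂μ ≤ ENNReal.ofReal A := by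
    calc ∫⁻ x, ENNReal.ofReal (g x) ∂μ
        = ∫⁻ x, liminf (fun n => ENNReal.ofReal (f n x)) atTop ∂μ := by
          refine lintegral_congr_ae ?_
          filter_upwards [hlim] with x hx
          exact ((ENNReal.continuous_ofReal.tendsto _).comp hx).liminf_eq.symm
      _ ≤ liminf (fun n => ∫⁻ x, ENNReal.ofReal (f n x) ∂μ) atTop :=
          lintegral_liminf_le' fun n => (hf n).1.aemeasurable.ennreal_ofReal
      _ ≤ liminf (fun n => ENNReal.ofReal (a n)) atTop := by
          refine liminf_le_liminf (Eventually.of_forall fun n => ?_)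
          rw [← ofReal_integral_eq_lintegral_ofReal (hf n) (Eventually.of_forall (h0 n))]
          exact ENNReal.ofReal_le_ofReal (ha n)
      _ = ENNReal.ofReal A := ((ENNReal.continuous_ofReal.tendsto _).comp hA).liminf_eq
  refine ⟨⟨hgm, ?_⟩, ?_⟩
  · rw [hasFiniteIntegral_iff_ofReal hg0]
    exact key.trans_lt ENNReal.ofReal_lt_top
  · rw [integral_eq_lintegral_of_nonneg_ae hg0 hgm]
    exact ENNReal.toReal_le_of_le_ofReal hA0 key

/-! ### Gagliardo–Nirenberg inequalities -/

/-- This is the endpoint Sobolev inequality `W^{1,1} ⊂ L^{n/(n-1)}`, whose exponent is `2` in the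
plane. -/
lemma exists_sobolev_test : ∃ C : ℝ, 0 ≤ C ∧ ∀ f : Plane → ℝ, IsTest f →
    ∫ x, f x ^ 2 ≤ C * (∫ x, ‖fderiv ℝ f x‖) ^ 2 := by
  have hp : Real.HolderConjugate (Module.finrank ℝ Plane : ℝ) 2 := by
    simpa using Real.HolderConjugate.two_two
  refine ⟨lintegralPowLePowLIntegralFDerivConst (volume : Measure Plane) 2, by positivity,
    fun f hf => ?_⟩
  have h := lintegral_pow_le_pow_lintegral_fderiv volume (hf.1.of_le (by simp)) hf.2 hp
  have hi : Integrable (fun x => fderiv ℝ f x) :=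
    (hf.1.continuous_fderiv (by simp)).integrable_of_hasCompactSupport (hf.2.fderiv ℝ)
  have e1 : ∫⁻ x, ‖f x‖ₑ ^ (2 : ℝ) = ENNReal.ofReal (∫ x, f x ^ 2) := by
    rw [ofReal_integral_eq_lintegral_ofReal hf.memLp.integrable_sq
      (Eventually.of_forall fun x => sq_nonneg _)]
    refine lintegral_congr fun x => ?_
    rw [← sq_abs, ENNReal.ofReal_pow (abs_nonneg _), ← Real.enorm_eq_ofReal_abs]
    norm_num
  rw [e1, ← ofReal_integral_norm_eq_lintegral_enorm hi,
    ENNReal.ofReal_rpow_of_nonneg (integral_nonneg fun x => norm_nonneg _) (by norm_num),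
    ← ENNReal.ofReal_coe_nnreal, ← ENNReal.ofReal_mul (by positivity),
    ENNReal.ofReal_le_ofReal_iff (by positivity)] at h
  simpa using h

lemma IsTest.pow {φ : Plane → ℝ} (hφ : IsTest φ) (k : ℕ) : IsTest (fun x => φ x ^ (k + 1)) :=
  ⟨hφ.1.pow _, hφ.2.mono fun x hx => by
    simp only [Function.mem_support, ne_eq] at hx ⊢
    exact fun h => hx (by simp [h])⟩

lemma gradSq_test {φ : Plane → ℝ} (hφ : IsTest φ) : gradSq φ = ∫ x, ‖fderiv ℝ φ x‖ ^ 2 := by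
  rw [gradSq_eq hφ.memLp_gradient hφ.isWeakGradient]
  simp_rw [norm_gradient]

/-- Induction on the exponent: the `W^{1,1}` inequality is applied to `f^(k+2)`, whose gradient is
`(k + 2) f^(k+1) ∇f`, and Cauchy–Schwarz separates `‖∇f‖₂²` from the integral of the preceding step.
-/
lemma exists_integral_pow_le_test (k : ℕ) : ∃ C : ℝ, 0 ≤ C ∧ ∀ f : Plane → ℝ, IsTest f →
    ∫ x, f x ^ (2 * (k + 1)) ≤ C * (massSq f * gradSq f ^ k) := by
  obtain ⟨S, hS, hSf⟩ := exists_sobolev_test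
  induction k with
  | zero => exact ⟨1, zero_le_one, fun f _ => by simp [massSq]⟩
  | succ k ih =>
    obtain ⟨C, hC, h⟩ := ih
    refine ⟨S * ((k + 2) ^ 2 * C), by positivity, fun f hf => ?_⟩
    have h1 := hSf _ (hf.pow (k + 1))
    have hd : ∀ x, ‖fderiv ℝ (fun x => f x ^ (k + 1 + 1)) x‖ =
        (k + 2) * (|f x ^ (k + 1)| * ‖fderiv ℝ f x‖) := by
      intro x
      have := ((hf.1.differentiable (by simp) x).hasFDerivAt.pow (k + 2)).fderiv
      rw [this, norm_smul]
      simp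
      rw [abs_of_nonneg (by positivity : (0 : ℝ) ≤ k + 2)]
      ring
    simp_rw [hd, integral_const_mul] at h1
    have hg : MemLp (fun x => ‖fderiv ℝ f x‖) 2 volume := by
      simpa only [norm_gradient] using hf.memLp_gradient.norm
    have h2 := integral_mul_sq_le (hf.pow k).memLp.norm hg
    simp only [Real.norm_eq_abs, sq_abs] at h2
    rw [← gradSq_test hf] at h2
    have h3 := h f hf
    have e1 : ∀ x, (f x ^ (k + 1 + 1)) ^ 2 = f x ^ (2 * (k + 1 + 1)) := fun x => by ring
    have e2 : ∀ x, (f x ^ (k + 1)) ^ 2 = f x ^ (2 * (k + 1)) := fun x => by ring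
    simp_rw [e1] at h1
    simp_rw [e2] at h2
    have hG := gradSq_nonneg f
    calc _ ≤ _ := h1
      _ = S * ((k + 2) ^ 2 * (∫ x, |f x ^ (k + 1)| * ‖fderiv ℝ f x‖) ^ 2) := by ring
      _ ≤ S * ((k + 2) ^ 2 * ((C * (massSq f * gradSq f ^ k)) * gradSq f)) := by
          gcongr
          exact h2.trans (mul_le_mul_of_nonneg_right h3 hG)
      _ = _ := by ring

/-! ### Mollification -/

section Mollify

open scoped Convolution
open ContinuousLinearMap

variable (η : ContDiffBump (0 : Plane))

/-- The mollification of `u` by the normalised bump `η`. -/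
noncomputable def mollify (u : Plane → ℝ) : Plane → ℝ := η.normed volume ⋆[lsmul ℝ ℝ, volume] u

lemma mollify_apply (u : Plane → ℝ) (x : Plane) :
    mollify η u x = ∫ y, η.normed volume y * u (x - y) := rfl

lemma integrable_bump_mul {u : Plane → ℝ} (hu : LocallyIntegrable u volume) (x : Plane) :
    Integrable fun y => η.normed volume y * u (x - y) :=
  (η.hasCompactSupport_normed (μ := volume)).convolutionExists_left (lsmul ℝ ℝ)
    (η.continuous_normed (μ := volume)) hu x

/-- Jensen's inequality for the probability density `η`, obtained by expanding the nonnegative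
variance of `u(x - ·)` about its mean `m`. -/
lemma mollify_sq_le {u : Plane → ℝ} (hu : MemLp u 2 volume) (x : Plane) :
    mollify η u x ^ 2 ≤ mollify η (fun y => u y ^ 2) x := by
  set m := mollify η u x with hm
  have i1 := integrable_bump_mul η (hu.locallyIntegrable (by norm_num)) x
  have i2 := integrable_bump_mul η hu.integrable_sq.locallyIntegrable x
  have i3 : Integrable (η.normed volume) :=
    (η.continuous_normed (μ := volume)).integrable_of_hasCompactSupport
      (η.hasCompactSupport_normed (μ := volume))
  have h0 : 0 ≤ ∫ y, η.normed volume y * (u (x - y) - m) ^ 2 :=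
    integral_nonneg fun y => mul_nonneg (η.nonneg_normed y) (sq_nonneg _)
  have e : ∀ y, η.normed volume y * (u (x - y) - m) ^ 2 = (η.normed volume y * u (x - y) ^ 2 -
      2 * m * (η.normed volume y * u (x - y))) + m ^ 2 * η.normed volume y := fun y => by ring
  simp_rw [e] at h0
  have i4 : Integrable fun y => η.normed volume y * u (x - y) ^ 2 -
      2 * m * (η.normed volume y * u (x - y)) := i2.sub (i1.const_mul _)
  rw [integral_add i4 (i3.const_mul _), integral_sub i2 (i1.const_mul _), integral_const_mul,
    integral_const_mul, η.integral_normed, ← mollify_apply, ← hm] at h0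
  rw [mollify_apply]
  linarith

lemma memLp_mollify {u : Plane → ℝ} (hu : MemLp u 2 volume) : MemLp (mollify η u) 2 volume ∧
    ∫ x, mollify η u x ^ 2 ≤ ∫ x, u x ^ 2 := by
  have hc : Continuous (mollify η u) :=
    (η.hasCompactSupport_normed (μ := volume)).continuous_convolution_left (lsmul ℝ ℝ)
      (η.continuous_normed (μ := volume)) (hu.locallyIntegrable (by norm_num))
  have i3 : Integrable (η.normed volume) :=
    (η.continuous_normed (μ := volume)).integrable_of_hasCompactSupport
      (η.hasCompactSupport_normed (μ := volume))
  have hi : Integrable (mollify η fun y => u y ^ 2) :=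
    i3.integrable_convolution (lsmul ℝ ℝ) hu.integrable_sq
  have hi2 : Integrable fun x => mollify η u x ^ 2 :=
    hi.mono' (hc.pow 2).aestronglyMeasurable (Eventually.of_forall fun x => by
      rw [Real.norm_eq_abs, abs_of_nonneg (sq_nonneg _)]
      exact mollify_sq_le η hu x)
  refine ⟨(memLp_two_iff_integrable_sq hc.aestronglyMeasurable).2 hi2, ?_⟩
  refine (integral_mono hi2 hi (mollify_sq_le η hu)).trans_eq ?_
  have := integral_convolution (lsmul ℝ ℝ) i3 hu.integrable_sq (μ := volume) (ν := volume)
  simp only [η.integral_normed, lsmul_apply, one_smul] at this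
  exact this

/-- Mollification commutes with translations and contracts `L²`, so it does not increase any
difference quotient. -/
lemma gradSq_mollify_le {u : Plane → ℝ} (hu : MemH1 u) : MemH1 (mollify η u) ∧
    gradSq (mollify η u) ≤ gradSq u := by
  refine memH1_of_translate (memLp_mollify η hu.1).1 (gradSq_nonneg _) fun t => ?_
  refine le_trans (Finset.sum_le_sum fun i _ => ?_) (hu.sum_integral_translate_sub_sq_le t)
  set e : Plane := t • EuclideanSpace.single i (1 : ℝ)
  have h1 := (memLp_mollify η ((memLp_comp_add_right hu.1 e).sub hu.1)).2
  refine le_trans (le_of_eq ?_) h1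
  refine integral_congr_ae (Eventually.of_forall fun x => ?_)
  have hl := hu.1.locallyIntegrable (by norm_num)
  simp only [mollify_apply, Pi.sub_apply]
  rw [← integral_sub (integrable_bump_mul η hl (x + e)) (integrable_bump_mul η hl x)]
  congr 2
  funext y
  rw [show x + e - y = x - y + e by abel]
  ring

lemma isTest_mollify {u : Plane → ℝ} (hu : LocallyIntegrable u volume) (hc : HasCompactSupport u) :
    IsTest (mollify η u) :=
  ⟨(η.hasCompactSupport_normed (μ := volume)).contDiff_convolution_left (lsmul ℝ ℝ)
    (η.contDiff_normed (μ := volume)) hu,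
    (η.hasCompactSupport_normed (μ := volume)).convolution (lsmul ℝ ℝ) hc⟩

end Mollify

lemma exists_mollifier_seq : ∃ η : ℕ → ContDiffBump (0 : Plane), ∀ u : Plane → ℝ,
    LocallyIntegrable u volume →
      ∀ᵐ x, Tendsto (fun n => mollify (η n) u x) atTop (𝓝 (u x)) := by
  let η : ℕ → ContDiffBump (0 : Plane) := fun n =>
    ⟨((n : ℝ) + 1)⁻¹, 2 * ((n : ℝ) + 1)⁻¹, by positivity, by
      have : (0 : ℝ) < ((n : ℝ) + 1)⁻¹ := by positivity
      linarith⟩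
  refine ⟨η, fun u hu => ?_⟩
  refine ContDiffBump.ae_convolution_tendsto_right_of_locallyIntegrable (K := 2) ?_
    (Eventually.of_forall fun n => le_rfl) hu
  have := (tendsto_one_div_add_atTop_nhds_zero_nat (𝕜 := ℝ)).const_mul 2
  simpa [η] using this

/-- Fatou along mollifications. The constant is kept because mollifying increases neither mass nor
gradient; compact support makes the mollified functions test functions. -/
lemma exists_integral_pow_le_of_compact (k : ℕ) : ∃ C : ℝ, 0 ≤ C ∧ ∀ u : Plane → ℝ, MemH1 u →
    HasCompactSupport u → Integrable (fun x => u x ^ (2 * (k + 1))) ∧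
      ∫ x, u x ^ (2 * (k + 1)) ≤ C * (massSq u * gradSq u ^ k) := by
  obtain ⟨C, hC, h⟩ := exists_integral_pow_le_test k
  obtain ⟨η, hη⟩ := exists_mollifier_seq
  refine ⟨C, hC, fun u hu hc => ?_⟩
  have hl : LocallyIntegrable u volume := hu.1.locallyIntegrable (by norm_num)
  have ht := fun n => isTest_mollify (η n) hl hc
  refine integral_le_of_tendsto_ae (f := fun n x => mollify (η n) u x ^ (2 * (k + 1)))
    (a := fun _ => C * (massSq u * gradSq u ^ k)) (fun n => ?_) (fun n x => ?_) ?_ (fun n => ?_)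
    tendsto_const_nhds
  · exact ((ht n).pow (2 * k + 1)).integrable
  · exact (even_two_mul _).pow_nonneg _
  · filter_upwards [hη u hl] with x hx
    exact hx.pow _
  · refine (h _ (ht n)).trans ?_
    have h1 := (memLp_mollify (η n) hu.1).2
    have h2 := (gradSq_mollify_le (η n) hu).2
    have h3 := gradSq_nonneg (mollify (η n) u)
    have h4 := massSq_nonneg u
    gcongr
    exact h1

/-! ### Truncation -/

lemma IsWeakGradient.mul_test {u χ : Plane → ℝ} {g : Plane → Plane} (hu : MemLp u 2 volume)
    (hg : MemLp g 2 volume) (h : IsWeakGradient u g) (hχ : IsTest χ) :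
    IsWeakGradient (fun x => χ x * u x) (fun x => χ x • g x + u x • gradient χ x) := by
  intro φ hφ i
  have hχφ : IsTest fun x => χ x * φ x := ⟨hχ.1.mul hφ.1, hφ.2.mul_left⟩
  have hχe : IsTest fun x => fderiv ℝ χ x (EuclideanSpace.single i 1) * φ x :=
    ⟨((hχ.1.fderiv_right (m := ∞) (by simp)).clm_apply contDiff_const).mul hφ.1, hφ.2.mul_left⟩
  have h1 := h _ hχφ i
  have hd : ∀ x, fderiv ℝ (fun x => χ x * φ x) x (EuclideanSpace.single i 1) =
      χ x * fderiv ℝ φ x (EuclideanSpace.single i 1) +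
        fderiv ℝ χ x (EuclideanSpace.single i 1) * φ x := by
    intro x
    rw [fderiv_fun_mul (hχ.1.differentiable (by simp) x) (hφ.1.differentiable (by simp) x)]
    simp [mul_comm]
  simp_rw [hd, mul_add] at h1
  have hχd : IsTest fun x => χ x * fderiv ℝ φ x (EuclideanSpace.single i 1) :=
    ⟨hχ.1.mul ((hφ.1.fderiv_right (m := ∞) (by simp)).clm_apply contDiff_const), hχ.2.mul_right⟩
  rw [integral_add (integrable_mul_test hu hχd) (integrable_mul_test hu hχe)] at h1
  have e1 : ∀ x, χ x * u x * fderiv ℝ φ x (EuclideanSpace.single i 1) =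
      u x * (χ x * fderiv ℝ φ x (EuclideanSpace.single i 1)) := fun x => by ring
  have e2 : ∀ x, (χ x • g x + u x • gradient χ x) i * φ x = g x i * (χ x * φ x) +
      u x * (fderiv ℝ χ x (EuclideanSpace.single i 1) * φ x) := fun x => by
    rw [PiLp.add_apply, PiLp.smul_apply, PiLp.smul_apply, IsTest.gradient_apply]
    simp only [smul_eq_mul]
    ring
  simp_rw [e1, e2]
  rw [integral_add (integrable_mul_test (memLp_coord hg i) hχφ) (integrable_mul_test hu hχe)]
  linarith

lemma exists_cutoff_seq : ∃ (c : ℝ) (χ : ℕ → Plane → ℝ), 0 ≤ c ∧ ∀ n, IsTest (χ n) ∧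
    (∀ x, 0 ≤ χ n x ∧ χ n x ≤ 1) ∧ (∀ x, ‖gradient (χ n) x‖ ≤ c / (n + 1)) ∧
      ∀ x, ‖x‖ ≤ n + 1 → χ n x = 1 := by
  let b : ContDiffBump (0 : Plane) := ⟨1, 2, one_pos, one_lt_two⟩
  have hb : IsTest b := ⟨b.contDiff, b.hasCompactSupport⟩
  obtain ⟨c, hc⟩ := (hb.1.continuous_fderiv (by simp)).bounded_above_of_compact_support
    (hb.2.fderiv ℝ)
  refine ⟨c, fun n x => b (((n : ℝ) + 1)⁻¹ • x), (norm_nonneg _).trans (hc 0), fun n =>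
    ⟨hb.comp_smul (by positivity), fun x => ⟨b.nonneg, b.le_one⟩, fun x => ?_, fun x hx => ?_⟩⟩
  · rw [norm_gradient, fderiv_comp_smul, norm_smul, Real.norm_of_nonneg (by positivity),
      div_eq_inv_mul]
    gcongr
    exact hc _
  · refine b.one_of_mem_closedBall ?_
    rw [mem_closedBall_zero_iff, norm_smul, Real.norm_of_nonneg (by positivity)]
    exact inv_mul_le_one_of_le₀ hx (by positivity)

/-- **Gagliardo–Nirenberg inequality**: `∫ u^{2k} ≤ C ‖u‖₂² ‖∇u‖₂^{2k-2}` in the plane. -/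
lemma exists_integral_pow_le (k : ℕ) : ∃ C : ℝ, 0 ≤ C ∧ ∀ u : Plane → ℝ, MemH1 u →
    Integrable (fun x => u x ^ (2 * (k + 1))) ∧
      ∫ x, u x ^ (2 * (k + 1)) ≤ C * (massSq u * gradSq u ^ k) := by
  obtain ⟨C, hC, h⟩ := exists_integral_pow_le_of_compact k
  obtain ⟨c, χ, hc, hχ⟩ := exists_cutoff_seq
  refine ⟨C, hC, fun u hu => ?_⟩
  have hw : ∀ n, MemLp (fun x => χ n x * u x) 2 volume := fun n =>
    hu.1.of_le ((hχ n).1.continuous.aestronglyMeasurable.mul hu.1.1)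
      (Eventually.of_forall fun x => by
        rw [norm_mul, Real.norm_of_nonneg ((hχ n).2.1 x).1]
        exact mul_le_of_le_one_left (norm_nonneg _) ((hχ n).2.1 x).2)
  have hg := hu.memLp_weakGrad
  have hwg : ∀ n, MemLp (fun x => χ n x • weakGrad u x + u x • gradient (χ n) x) 2 volume := by
    intro n
    refine MemLp.add (hg.of_le ((hχ n).1.continuous.aestronglyMeasurable.smul hg.1)
      (Eventually.of_forall fun x => ?_)) ((hu.1.const_mul (c / (n + 1))).of_le
        (hu.1.1.smul (hχ n).1.memLp_gradient.1) (Eventually.of_forall fun x => ?_))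
    · rw [norm_smul, Real.norm_of_nonneg ((hχ n).2.1 x).1]
      exact mul_le_of_le_one_left (norm_nonneg _) ((hχ n).2.1 x).2
    · rw [norm_smul, norm_mul, mul_comm,
        Real.norm_of_nonneg (div_nonneg hc (by positivity) : 0 ≤ c / ((n : ℝ) + 1))]
      exact mul_le_mul_of_nonneg_right ((hχ n).2.2.1 x) (norm_nonneg _)
  have hwk := fun n => hu.isWeakGradient.mul_test hu.1 hg (hχ n).1
  have hw1 : ∀ n, MemH1 (fun x => χ n x * u x) := fun n => ⟨hw n, _, hwg n, hwk n⟩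
  have hcs : ∀ n, HasCompactSupport (fun x => χ n x * u x) := fun n => (hχ n).1.2.mul_right
  -- With `N = n + 1`, this bound comes from expanding `(|∇u| + (c / N) |u|)²`, applying Young's
  -- inequality to the cross term, and using `1 / N² ≤ 1 / N` in the last one. It tends to `gradSq
  -- u`, so truncation costs nothing in the limit.
  let G : ℕ → ℝ := fun n => (1 + 1 / ((n : ℝ) + 1)) * gradSq u +
    2 * c ^ 2 * (1 / ((n : ℝ) + 1)) * massSq u
  have hGn : ∀ n, gradSq (fun x => χ n x * u x) ≤ G n := by
    intro n
    rw [gradSq_eq (hwg n) (hwk n)]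
    have i1 := (integrable_norm_sq hg).const_mul (1 + 1 / ((n : ℝ) + 1))
    have i2 := hu.1.integrable_sq.const_mul (2 * c ^ 2 * (1 / ((n : ℝ) + 1)))
    have e : G n = ∫ x, ((1 + 1 / ((n : ℝ) + 1)) * ‖weakGrad u x‖ ^ 2 +
        2 * c ^ 2 * (1 / ((n : ℝ) + 1)) * u x ^ 2) := by
      rw [integral_add i1 i2, integral_const_mul, integral_const_mul]
      rfl
    rw [e]
    refine integral_mono (integrable_norm_sq (hwg n)) (i1.add i2) fun x => ?_
    set N : ℝ := (n : ℝ) + 1 with hN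
    have hN1 : 1 ≤ N := by simp [hN]
    have hNp : 0 < N := by linarith
    have h1 : ‖χ n x • weakGrad u x + u x • gradient (χ n) x‖ ≤
        ‖weakGrad u x‖ + c / N * |u x| := by
      refine (norm_add_le _ _).trans (add_le_add ?_ ?_)
      · rw [norm_smul, Real.norm_of_nonneg ((hχ n).2.1 x).1]
        exact mul_le_of_le_one_left (norm_nonneg _) ((hχ n).2.1 x).2
      · rw [norm_smul, mul_comm]
        exact mul_le_mul_of_nonneg_right ((hχ n).2.2.1 x) (norm_nonneg _)
    refine (pow_le_pow_left₀ (norm_nonneg _) h1 2).trans ?_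
    set a := ‖weakGrad u x‖
    have h2 : 0 ≤ (a - c * |u x|) ^ 2 := sq_nonneg _
    have h3 : (a + c / N * |u x|) ^ 2 =
        a ^ 2 + (1 / N) * (2 * a * (c * |u x|)) + (1 / N) * (1 / N) * (c ^ 2 * |u x| ^ 2) := by
      field_simp
      ring
    rw [h3, ← sq_abs (u x)]
    have h4 : 1 / N ≤ 1 := by
      rw [div_le_one hNp]
      exact hN1
    have h5 : 0 ≤ 1 / N := by positivity
    have h6 : (1 / N) * (2 * a * (c * |u x|)) ≤ (1 / N) * (a ^ 2 + c ^ 2 * |u x| ^ 2) :=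
      mul_le_mul_of_nonneg_left (by nlinarith) h5
    have h7 : (1 / N) * (1 / N) * (c ^ 2 * |u x| ^ 2) ≤ (1 / N) * 1 * (c ^ 2 * |u x| ^ 2) := by
      gcongr
    nlinarith
  have hG : Tendsto G atTop (𝓝 (gradSq u)) := by
    have h1 := tendsto_one_div_add_atTop_nhds_zero_nat (𝕜 := ℝ)
    have h2 := ((h1.const_add 1).mul_const (gradSq u)).add
      ((h1.const_mul (2 * c ^ 2)).mul_const (massSq u))
    rw [add_zero, one_mul, mul_zero, zero_mul, add_zero] at h2
    exact h2
  refine integral_le_of_tendsto_ae (f := fun n x => (χ n x * u x) ^ (2 * (k + 1)))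
    (a := fun n => C * (massSq u * G n ^ k)) (fun n => (h _ (hw1 n) (hcs n)).1) (fun n x => ?_)
    (Eventually.of_forall fun x => ?_) (fun n => ?_) (((hG.pow k).const_mul _).const_mul _)
  · exact (even_two_mul _).pow_nonneg _
  · refine Tendsto.congr' (f₁ := fun _ => u x ^ (2 * (k + 1))) ?_ tendsto_const_nhds
    obtain ⟨N, hN⟩ := exists_nat_ge ‖x‖
    filter_upwards [eventually_ge_atTop N] with n hn
    have : (N : ℝ) ≤ n := Nat.cast_le.2 hn
    rw [(hχ n).2.2.2 x (by linarith), one_mul]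
  · refine (h _ (hw1 n) (hcs n)).2.trans ?_
    have h1 : massSq (fun x => χ n x * u x) ≤ massSq u :=
      integral_mono (hw n).integrable_sq hu.1.integrable_sq fun x => by
        simp only [mul_pow]
        exact mul_le_of_le_one_left (sq_nonneg _)
          (pow_le_one₀ ((hχ n).2.1 x).1 ((hχ n).2.1 x).2)
    have h3 := gradSq_nonneg (fun x => χ n x * u x)
    have h4 := massSq_nonneg u
    have h5 := hGn n
    gcongr

open Real (posLog)

/-! ### The logarithmic kernel -/

/-- The far part `log⁺ |z|` of the logarithmic kernel. -/
noncomputable def farLog (z : Plane) : ℝ := posLog ‖z‖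

/-- The near part `log⁺ |z|⁻¹` of the logarithmic kernel. -/
noncomputable def nearLog (z : Plane) : ℝ := posLog ‖z‖⁻¹

lemma farLog_nonneg (z : Plane) : 0 ≤ farLog z := Real.posLog_nonneg

lemma nearLog_nonneg (z : Plane) : 0 ≤ nearLog z := Real.posLog_nonneg

lemma farLog_sub_nearLog (z : Plane) : farLog z - nearLog z = Real.log ‖z‖ :=
  Real.posLog_sub_posLog_inv

lemma measurable_farLog : Measurable farLog := by
  unfold farLog posLog
  fun_prop

lemma measurable_nearLog : Measurable nearLog := by
  unfold nearLog posLog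
  fun_prop

/-- For `λ ≥ 1` one has `|x - y| ≤ (λ + |x|)(λ + |y|)`, and the logarithm turns the product into a
sum of two weights. -/
lemma farLog_sub_le {lam : ℝ} (hlam : 1 ≤ lam) (x y : Plane) :
    farLog (x - y) ≤ Real.log (lam + ‖x‖) + Real.log (lam + ‖y‖) := by
  have hx := norm_nonneg x
  have hy := norm_nonneg y
  rw [← Real.log_mul (by positivity) (by positivity)]
  have h1 : ‖x - y‖ ≤ (lam + ‖x‖) * (lam + ‖y‖) := by
    refine (norm_sub_le x y).trans ?_
    nlinarith [mul_nonneg hx hy]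
  refine max_le (Real.log_nonneg ?_) ?_
  · nlinarith [mul_nonneg hx hy]
  · rcases (norm_nonneg (x - y)).eq_or_lt with h | h
    · rw [← h, Real.log_zero]
      exact Real.log_nonneg (by nlinarith [mul_nonneg hx hy])
    · exact Real.log_le_log h h1

/-- Taking the exponent `1/2` in `log r ≤ r^ε / ε` leaves `4 / |z|` after squaring, which is
integrable near the origin of the plane. -/
lemma nearLog_sq_le (z : Plane) : nearLog z ^ 2 ≤ 4 * ‖z‖ ^ (-1 : ℝ) := by
  have h0 := norm_nonneg z
  have h1 : nearLog z ≤ ‖z‖⁻¹ ^ (1 / 2 : ℝ) / (1 / 2) :=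
    max_le (by positivity) (Real.log_le_rpow_div (by positivity) (by norm_num))
  refine (pow_le_pow_left₀ (nearLog_nonneg z) h1 2).trans_eq ?_
  rw [div_pow, ← Real.sqrt_eq_rpow, Real.sq_sqrt (by positivity), Real.rpow_neg_one]
  ring

lemma nearLog_eq_zero {z : Plane} (hz : z ∉ Metric.ball (0 : Plane) 1) : nearLog z = 0 := by
  rw [mem_ball_zero_iff, not_lt] at hz
  rw [nearLog, Real.posLog_eq_zero_iff, abs_of_nonneg (by positivity)]
  exact inv_le_one_of_one_le₀ hz

lemma memLp_nearLog : MemLp nearLog 2 volume := by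
  rw [memLp_two_iff_integrable_sq measurable_nearLog.aestronglyMeasurable]
  have h1 : IntegrableOn (fun z => nearLog z ^ 2) (Metric.ball (0 : Plane) 1) := by
    refine integrableOn_ball_of_norm_le_rpow (α := 1) (C := 4) (by simp) (by simp)
      (Eventually.of_forall fun z => ?_) (measurable_nearLog.pow_const 2).aestronglyMeasurable
    rw [Real.norm_of_nonneg (sq_nonneg _)]
    exact nearLog_sq_le z
  rw [integrableOn_iff_integrable_of_support_subset] at h1
  · exact h1
  · intro z hz
    by_contra hn
    exact hz (by simp [nearLog_eq_zero hn])

/-! ### Densities with finite logarithmic moment -/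

/-- Square integrable densities with finite logarithmic moment. -/
structure LogDensity (lam : ℝ) (f : Plane → ℝ) : Prop where
  integrable : Integrable f
  moment : Integrable fun x => Real.log (lam + ‖x‖) * f x
  memLp : MemLp f 2 volume

namespace LogDensity

variable {lam : ℝ} {f g h : Plane → ℝ}

lemma add (hf : LogDensity lam f) (hg : LogDensity lam g) : LogDensity lam fun x => f x + g x :=
  ⟨hf.integrable.add hg.integrable, (hf.moment.add hg.moment).congr
    (Eventually.of_forall fun _ => (mul_add _ _ _).symm), hf.memLp.add hg.memLp⟩

lemma const_mul (hf : LogDensity lam f) (c : ℝ) : LogDensity lam fun x => c * f x :=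
  ⟨hf.integrable.const_mul c, by
    simpa only [mul_left_comm] using hf.moment.const_mul c, hf.memLp.const_mul c⟩

end LogDensity

lemma MemH1.integrable_pow_four {u : Plane → ℝ} (hu : MemH1 u) : Integrable fun x => u x ^ 4 := by
  obtain ⟨C, -, h⟩ := exists_integral_pow_le 1
  exact (h u hu).1

lemma measurable_logWeight (lam : ℝ) : Measurable fun x : Plane => Real.log (lam + ‖x‖) := by
  fun_prop

lemma logWeight_nonneg {lam : ℝ} (hlam : 1 ≤ lam) (x : Plane) : 0 ≤ Real.log (lam + ‖x‖) :=
  Real.log_nonneg (by linarith [norm_nonneg x])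

/-- Square integrability of the product is where `H¹ ⊂ L⁴` enters; the moment is controlled by `|uv|
≤ u² + v²`. -/
lemma MemW.logDensity_mul {lam : ℝ} (hlam : 1 ≤ lam) {u v : Plane → ℝ} (hu : MemW lam u)
    (hv : MemW lam v) : LogDensity lam fun x => u x * v x := by
  have hm : AEStronglyMeasurable (fun x => u x * v x) volume := hu.1.1.1.mul hv.1.1.1
  refine ⟨hu.1.1.integrable_mul hv.1.1, ?_, ?_⟩
  · refine (hu.2.add hv.2).mono' ((measurable_logWeight lam).aestronglyMeasurable.mul hm)
      (Eventually.of_forall fun x => ?_)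
    rw [norm_mul, Real.norm_of_nonneg (logWeight_nonneg hlam x), Pi.add_apply, ← mul_add]
    refine mul_le_mul_of_nonneg_left ?_ (logWeight_nonneg hlam x)
    rw [Real.norm_eq_abs, abs_le]
    constructor <;> nlinarith [sq_nonneg (u x + v x), sq_nonneg (u x - v x)]
  · rw [memLp_two_iff_integrable_sq hm]
    refine (hu.1.integrable_pow_four.add hv.1.integrable_pow_four).mono' (hm.pow 2)
      (Eventually.of_forall fun x => ?_)
    rw [Real.norm_of_nonneg (sq_nonneg _), Pi.add_apply]
    nlinarith [sq_nonneg (u x ^ 2 - v x ^ 2), sq_nonneg (u x ^ 2), sq_nonneg (v x ^ 2)]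

/-- The density `u² + v²`. -/
def density (u v : Plane → ℝ) (x : Plane) : ℝ := u x ^ 2 + v x ^ 2

lemma density_nonneg (u v : Plane → ℝ) (x : Plane) : 0 ≤ density u v x := by
  unfold density
  positivity

lemma MemW.logDensity {lam : ℝ} (hlam : 1 ≤ lam) {u v : Plane → ℝ} (hu : MemW lam u)
    (hv : MemW lam v) : LogDensity lam (density u v) := by
  have := (hu.logDensity_mul hlam hu).add (hv.logDensity_mul hlam hv)
  simp only [← sq] at this
  exact this

/-! ### Bilinear forms with a convolution kernel -/

/-- The bilinear form `∬ K(x - y) f(y) g(x) dx dy`. -/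
noncomputable def kernelForm (K : Plane → ℝ) (f g : Plane → ℝ) : ℝ :=
  ∫ z : Plane × Plane, K (z.1 - z.2) * f z.2 * g z.1

/-- Convergence of the integral defining `kernelForm`. -/
def KernelIntegrable (K : Plane → ℝ) (f g : Plane → ℝ) : Prop :=
  Integrable fun z : Plane × Plane => K (z.1 - z.2) * f z.2 * g z.1

lemma integrable_mul_comp_sub {k f : Plane → ℝ} (hk : MemLp k 2 volume) (hf : MemLp f 2 volume)
    (x : Plane) : Integrable fun y => k (x - y) * f y := by
  have : MemLp (fun y => k (x - y)) 2 volume :=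
    hk.comp_measurePreserving (Measure.measurePreserving_sub_left volume x)
  exact this.integrable_mul hf

lemma integral_mul_comp_sub_le {k f : Plane → ℝ} (hk : MemLp k 2 volume) (hf : MemLp f 2 volume)
    (x : Plane) : |∫ y, k (x - y) * f y| ≤ √(∫ y, k y ^ 2) * √(∫ y, f y ^ 2) := by
  have : MemLp (fun y => k (x - y)) 2 volume :=
    hk.comp_measurePreserving (Measure.measurePreserving_sub_left volume x)
  refine (abs_integral_mul_le this hf).trans_eq ?_
  rw [integral_sub_left_eq_self (fun y => k y ^ 2)]

lemma aestronglyMeasurable_kernel {K f g : Plane → ℝ} (hK : Measurable K)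
    (hf : AEStronglyMeasurable f volume) (hg : AEStronglyMeasurable g volume) :
    AEStronglyMeasurable (fun z : Plane × Plane => K (z.1 - z.2) * f z.2 * g z.1) volume :=
  ((hK.comp (measurable_fst.sub measurable_snd)).aestronglyMeasurable.mul hf.comp_snd).mul
    hg.comp_fst

/-- Cauchy–Schwarz bounds the inner integral by `‖nearLog‖₂ ‖f‖₂`, uniformly in the outer variable,
so `g` only needs to be integrable. -/
lemma kernelIntegrable_near {f g : Plane → ℝ} (hf : MemLp f 2 volume) (hg : Integrable g) :
    KernelIntegrable nearLog f g := by
  have hm := aestronglyMeasurable_kernel measurable_nearLog hf.1 hg.1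
  refine (integrable_prod_iff hm).2 ⟨Eventually.of_forall fun x => ?_, ?_⟩
  · exact (integrable_mul_comp_sub memLp_nearLog hf x).mul_const (g x)
  · refine (hg.norm.const_mul (√(∫ y, nearLog y ^ 2) * √(∫ y, f y ^ 2))).mono'
      hm.norm.integral_prod_right' (Eventually.of_forall fun x => ?_)
    simp_rw [norm_mul]
    rw [integral_mul_const, norm_mul, norm_norm]
    refine mul_le_mul_of_nonneg_right ?_ (norm_nonneg _)
    have := integral_mul_comp_sub_le memLp_nearLog.norm hf.norm x
    simpa using this

lemma abs_kernelForm_near_le {f g : Plane → ℝ} (hf : MemLp f 2 volume) (hg : Integrable g) :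
    |kernelForm nearLog f g| ≤ √(∫ y, nearLog y ^ 2) * √(∫ y, f y ^ 2) * ∫ x, |g x| := by
  have hi := kernelIntegrable_near hf hg
  rw [kernelForm, Measure.volume_eq_prod, integral_prod _ hi]
  simp_rw [integral_mul_const]
  rw [← integral_const_mul]
  refine norm_integral_le_of_norm_le (f := fun x => (∫ y, nearLog (x - y) * f y) * g x)
    (hg.abs.const_mul _) (Eventually.of_forall fun x => ?_)
  rw [norm_mul]
  exact mul_le_mul_of_nonneg_right (integral_mul_comp_sub_le memLp_nearLog hf x) (abs_nonneg _)

/-- The bound on the kernel is a sum of functions of one variable each, so the integrand is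
dominated by two tensor products of integrable functions. -/
lemma kernelIntegrable_far {lam : ℝ} (hlam : 1 ≤ lam) {f g : Plane → ℝ} (hf : LogDensity lam f)
    (hg : LogDensity lam g) : KernelIntegrable farLog f g := by
  have hm := aestronglyMeasurable_kernel measurable_farLog hf.integrable.1 hg.integrable.1
  have h1 := (hg.moment.norm.mul_prod hf.integrable.norm).add
    (hg.integrable.norm.mul_prod hf.moment.norm)
  refine h1.mono' hm (Eventually.of_forall fun z => ?_)
  simp only [Pi.add_apply, norm_mul, Real.norm_of_nonneg (logWeight_nonneg hlam _),
    Real.norm_of_nonneg (farLog_nonneg _)]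
  have h2 := mul_le_mul_of_nonneg_right (mul_le_mul_of_nonneg_right (farLog_sub_le hlam z.1 z.2)
    (norm_nonneg (f z.2))) (norm_nonneg (g z.1))
  refine h2.trans_eq ?_
  ring

lemma kernelIntegrable_log {lam : ℝ} (hlam : 1 ≤ lam) {f g : Plane → ℝ} (hf : LogDensity lam f)
    (hg : LogDensity lam g) : KernelIntegrable (fun z => Real.log ‖z‖) f g := by
  have := (kernelIntegrable_far hlam hf hg).sub (kernelIntegrable_near hf.memLp hg.integrable)
  refine this.congr (Eventually.of_forall fun z => ?_)
  simp only [Pi.sub_apply, ← farLog_sub_nearLog]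
  ring

lemma kernelForm_log {lam : ℝ} (hlam : 1 ≤ lam) {f g : Plane → ℝ} (hf : LogDensity lam f)
    (hg : LogDensity lam g) : kernelForm (fun z => Real.log ‖z‖) f g =
      kernelForm farLog f g - kernelForm nearLog f g := by
  rw [kernelForm, kernelForm, kernelForm, ← integral_sub (kernelIntegrable_far hlam hf hg)
    (kernelIntegrable_near hf.memLp hg.integrable)]
  refine integral_congr_ae (Eventually.of_forall fun z => ?_)
  simp only [← farLog_sub_nearLog]
  ring

lemma kernelForm_comm {K : Plane → ℝ} (hK : ∀ z, K (-z) = K z) (f g : Plane → ℝ) :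
    kernelForm K f g = kernelForm K g f := by
  rw [kernelForm, kernelForm, Measure.volume_eq_prod, ← integral_prod_swap]
  refine integral_congr_ae (Eventually.of_forall fun z => ?_)
  simp only [Prod.fst_swap, Prod.snd_swap]
  rw [← hK, neg_sub]
  ring

lemma kernelForm_add_right {K f g h : Plane → ℝ} (hg : KernelIntegrable K f g)
    (hh : KernelIntegrable K f h) :
    kernelForm K f (fun x => g x + h x) = kernelForm K f g + kernelForm K f h := by
  rw [kernelForm, kernelForm, kernelForm, ← integral_add hg hh]
  simp_rw [mul_add]

lemma kernelForm_const_mul_right (K f g : Plane → ℝ) (c : ℝ) :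
    kernelForm K f (fun x => c * g x) = c * kernelForm K f g := by
  rw [kernelForm, kernelForm, ← integral_const_mul]
  refine integral_congr_ae (Eventually.of_forall fun z => ?_)
  simp only
  ring

instance isAddHaarMeasure_volume_prod : (volume : Measure (Plane × Plane)).IsAddHaarMeasure :=
  inferInstanceAs ((volume : Measure Plane).prod volume).IsAddHaarMeasure

lemma kernelForm_comp_sub_right (K f g : Plane → ℝ) (y : Plane) :
    kernelForm K (fun x => f (x - y)) (fun x => g (x - y)) = kernelForm K f g := by
  rw [kernelForm, kernelForm, ← integral_sub_right_eq_self
    (fun z : Plane × Plane => K (z.1 - z.2) * f z.2 * g z.1) ((y, y) : Plane × Plane)]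
  simp

lemma logEnergy_eq {lam : ℝ} (hlam : 1 ≤ lam) {u v : Plane → ℝ} (hu : MemW lam u)
    (hv : MemW lam v) :
    logEnergy u v = kernelForm (fun z => Real.log ‖z‖) (density u v) (density u v) := by
  have h := hu.logDensity hlam hv
  rw [kernelForm, Measure.volume_eq_prod, integral_prod _ (kernelIntegrable_log hlam h h)]
  rfl

lemma integral_potential_mul {lam : ℝ} (hlam : 1 ≤ lam) {u v f : Plane → ℝ} (hu : MemW lam u)
    (hv : MemW lam v) (hf : LogDensity lam f) :
    ∫ x, potential u v x * f x =
      kernelForm (fun z => Real.log ‖z‖) (density u v) f := by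
  have h := hu.logDensity hlam hv
  rw [kernelForm, Measure.volume_eq_prod, integral_prod _ (kernelIntegrable_log hlam h hf)]
  simp_rw [integral_mul_const]
  rfl

lemma integral_comp_smul_plane_prod (f : Plane × Plane → ℝ) (t : ℝ) :
    ∫ z, f (t • z) = (t ^ 4)⁻¹ * ∫ z, f z := by
  rw [Measure.integral_comp_smul]
  simp [abs_of_nonneg ((by decide : Even 4).pow_nonneg t)]

/-- The identity `log |t z| = log t + log |z|` can fail on the diagonal, where `Real.log 0 = 0` by
convention; the dilation formula uses it only off this null set. -/
lemma ae_fst_ne_snd : ∀ᵐ z : Plane × Plane, z.1 ≠ z.2 := by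
  rw [ae_iff]
  have hm : MeasurableSet {z : Plane × Plane | z.1 = z.2} := measurableSet_diagonal
  simp only [ne_eq, not_not]
  rw [Measure.volume_eq_prod, Measure.measure_prod_null hm]
  refine Eventually.of_forall fun x => ?_
  have : Prod.mk x ⁻¹' {z : Plane × Plane | z.1 = z.2} = {x} := by
    ext y
    simp [eq_comm]
  simp only [Pi.zero_apply]
  rw [this]
  simp

/-- Changing variables in both planes gives the Jacobian `t⁻⁴`, and scaling the logarithm shifts the
form by `log t` times the product of the two total integrals. -/
lemma kernelForm_log_dilate {lam : ℝ} (hlam : 1 ≤ lam) {f g : Plane → ℝ} (hf : LogDensity lam f)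
    (hg : LogDensity lam g) {t : ℝ} (ht : 0 < t) :
    kernelForm (fun z => Real.log ‖z‖) (fun x => f (t • x)) (fun x => g (t • x)) =
      (t ^ 4)⁻¹ * (kernelForm (fun z => Real.log ‖z‖) f g -
        Real.log t * ((∫ x, f x) * ∫ x, g x)) := by
  have h1 := integral_comp_smul_plane_prod
    (fun z => (Real.log ‖z.1 - z.2‖ - Real.log t) * f z.2 * g z.1) t
  have h2 : kernelForm (fun z => Real.log ‖z‖) (fun x => f (t • x)) (fun x => g (t • x)) =
      ∫ z : Plane × Plane, (Real.log ‖(t • z).1 - (t • z).2‖ - Real.log t) * f (t • z).2 *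
        g (t • z).1 := by
    refine integral_congr_ae ?_
    filter_upwards [ae_fst_ne_snd] with z hz
    have hz' : ‖z.1 - z.2‖ ≠ 0 := norm_ne_zero_iff.2 (sub_ne_zero.2 hz)
    rw [Prod.smul_fst, Prod.smul_snd, ← smul_sub, norm_smul, Real.norm_of_nonneg ht.le,
      Real.log_mul ht.ne' hz']
    ring
  rw [h2, h1]
  congr 1
  have i1 := kernelIntegrable_log hlam hf hg
  have i2 : Integrable (fun z : Plane × Plane => Real.log t * (g z.1 * f z.2)) :=
    (hg.integrable.mul_prod hf.integrable).const_mul _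
  have e : ∀ z : Plane × Plane, (Real.log ‖z.1 - z.2‖ - Real.log t) * f z.2 * g z.1 =
      Real.log ‖z.1 - z.2‖ * f z.2 * g z.1 - Real.log t * (g z.1 * f z.2) := fun z => by ring
  simp_rw [e]
  rw [integral_sub i1 i2, integral_const_mul, Measure.volume_eq_prod, integral_prod_mul]
  rw [kernelForm, Measure.volume_eq_prod]
  ring

/-! ### Translations and dilations in `W` -/

lemma MemW.comp_sub_right {lam : ℝ} (hlam : 1 ≤ lam) {u : Plane → ℝ} (hu : MemW lam u)
    (y : Plane) : MemW lam (fun x => u (x - y)) := by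
  refine ⟨hu.1.comp_sub_right y, ?_⟩
  have h : Integrable fun x => Real.log (lam + ‖x + y‖) * u x ^ 2 := by
    refine (hu.2.add (hu.1.1.integrable_sq.const_mul (Real.log (lam + ‖y‖)))).mono'
      ((by fun_prop : Measurable fun x : Plane => Real.log (lam + ‖x + y‖)).aestronglyMeasurable.mul
        (hu.1.1.1.pow 2)) (Eventually.of_forall fun x => ?_)
    rw [norm_mul, Real.norm_of_nonneg (logWeight_nonneg hlam _), Real.norm_of_nonneg (sq_nonneg _),
      Pi.add_apply, ← add_mul]
    refine mul_le_mul_of_nonneg_right ?_ (sq_nonneg _)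
    have hx := norm_nonneg x
    have hy := norm_nonneg y
    rw [← Real.log_mul (by positivity) (by positivity)]
    refine Real.log_le_log (by positivity) ?_
    nlinarith [norm_add_le x y, mul_nonneg hx hy]
  have h2 := h.comp_sub_right y
  simpa using h2

/-- Rescaling the weight costs at most an additive constant `log m`. That constant is absorbed into
a multiple of the weight because the weight is at least `log λ > 0`. -/
lemma MemW.dilate {lam : ℝ} (hlam : 1 < lam) {u : Plane → ℝ} (hu : MemW lam u) (c : ℝ) {t : ℝ}
    (ht : 0 < t) : MemW lam (fun x => c * u (t • x)) := by
  refine ⟨hu.1.dilate c ht.ne', ?_⟩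
  have hi : 0 < t⁻¹ := inv_pos.2 ht
  have hl : 0 < Real.log lam := Real.log_pos hlam
  set m := max 1 t⁻¹ with hm
  have hm1 : 1 ≤ m := le_max_left _ _
  have h : Integrable fun x => Real.log (lam + ‖t⁻¹ • x‖) * u x ^ 2 := by
    refine (hu.2.const_mul (Real.log m / Real.log lam + 1)).mono'
      ((by fun_prop : Measurable fun x : Plane =>
        Real.log (lam + ‖t⁻¹ • x‖)).aestronglyMeasurable.mul
        (hu.1.1.1.pow 2)) (Eventually.of_forall fun x => ?_)
    rw [norm_mul, Real.norm_of_nonneg (logWeight_nonneg hlam.le _),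
      Real.norm_of_nonneg (sq_nonneg _), ← mul_assoc]
    refine mul_le_mul_of_nonneg_right ?_ (sq_nonneg _)
    have hx := norm_nonneg x
    have h1 : Real.log (lam + ‖t⁻¹ • x‖) ≤ Real.log m + Real.log (lam + ‖x‖) := by
      rw [← Real.log_mul (by positivity) (by positivity)]
      refine Real.log_le_log (by positivity) ?_
      rw [norm_smul, Real.norm_of_nonneg hi.le, mul_add]
      have := mul_le_mul_of_nonneg_right (le_max_right 1 t⁻¹) hx
      nlinarith
    have h2 : Real.log lam ≤ Real.log (lam + ‖x‖) :=
      Real.log_le_log (by positivity) (by linarith)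
    have h3 : Real.log m ≤ Real.log m / Real.log lam * Real.log (lam + ‖x‖) := by
      rw [div_mul_eq_mul_div, le_div_iff₀ hl]
      exact mul_le_mul_of_nonneg_left h2 (Real.log_nonneg hm1)
    linarith
  have h2 := ((integrable_comp_smul_iff volume _ ht.ne').2 h).const_mul (c ^ 2)
  refine h2.congr (Eventually.of_forall fun x => ?_)
  simp only [smul_smul, inv_mul_cancel₀ ht.ne', one_smul]
  ring

/-! ### The fibre maps -/

/-- The energy along the fibre `t ↦ (t² u(t·), t² v(t·))`, in terms of the gradient term `A`, the
logarithmic term `V`, the mass `M` and the power term `P`. -/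
noncomputable def fibreEnergy (p A V M P t : ℝ) : ℝ :=
  1 / 2 * (t ^ 4 * A) + 1 / 4 * (t ^ 4 * (V - Real.log t * M ^ 2)) -
    1 / (2 * p) * (t ^ (4 * p - 2) * P)

/-- The Nehari–Pohozaev functional along the fibre. -/
noncomputable def fibreNehari (p A V M P t : ℝ) : ℝ :=
  2 * (t ^ 4 * A) - 1 / 4 * (t ^ 2 * M) ^ 2 + t ^ 4 * (V - Real.log t * M ^ 2) -
    (4 * p - 2) / (2 * p) * (t ^ (4 * p - 2) * P)

/-- `fibreNehari` divided by `t⁴`. -/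
noncomputable def fibreReduced (p A V M P t : ℝ) : ℝ :=
  2 * A - 1 / 4 * M ^ 2 + V - M ^ 2 * Real.log t - (4 * p - 2) / (2 * p) * P * t ^ (4 * p - 6)

lemma fibreNehari_eq {p A V M P t : ℝ} (ht : 0 < t) :
    fibreNehari p A V M P t = t ^ 4 * fibreReduced p A V M P t := by
  have h : t ^ (4 * p - 2) = t ^ 4 * t ^ (4 * p - 6) := by
    rw [← Real.rpow_natCast t 4, ← Real.rpow_add ht]
    congr 1
    push_cast
    ring
  rw [fibreNehari, fibreReduced, h]
  ring

lemma fibreNehari_eq_zero_iff {p A V M P t : ℝ} (ht : 0 < t) :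
    fibreNehari p A V M P t = 0 ↔ fibreReduced p A V M P t = 0 := by
  rw [fibreNehari_eq ht, mul_eq_zero]
  simp [ht.ne']

/-- Strictness comes from `-M² log t` alone; the power term is monotone because `4p - 6 ≥ 0` and `P
≥ 0`. -/
lemma fibreReduced_lt {p A V M P s t : ℝ} (hp : 2 ≤ p) (hM : 0 < M) (hP : 0 ≤ P) (hs : 0 < s)
    (hst : s < t) : fibreReduced p A V M P t < fibreReduced p A V M P s := by
  have h1 : M ^ 2 * Real.log s < M ^ 2 * Real.log t :=
    mul_lt_mul_of_pos_left (Real.log_lt_log hs hst) (by positivity)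
  have h2 : (4 * p - 2) / (2 * p) * P * s ^ (4 * p - 6) ≤
      (4 * p - 2) / (2 * p) * P * t ^ (4 * p - 6) :=
    mul_le_mul_of_nonneg_left (Real.rpow_le_rpow hs.le hst.le (by linarith))
      (mul_nonneg (div_nonneg (by linarith) (by linarith)) hP)
  unfold fibreReduced
  linarith

lemma exists_fibreReduced_eq_zero_of_le {p A V M P T : ℝ} (hp : 2 ≤ p) (hM : 0 < M) (hP : 0 ≤ P)
    (hT : 1 ≤ T) (h : fibreReduced p A V M P T ≤ 0) :
    ∃ t, 0 < t ∧ t ≤ T ∧ fibreReduced p A V M P t = 0 := by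
  set a := 2 * A - 1 / 4 * M ^ 2 + V with ha
  set c := (4 * p - 2) / (2 * p) * P with hc
  have hc0 : 0 ≤ c := mul_nonneg (div_nonneg (by linarith) (by linarith)) hP
  have hM2 : 0 < M ^ 2 := by positivity
  -- `S` solves `M² log S = -(|a| + c)`, so the logarithm compensates both the constant and the
  -- power term, the latter being at most `c` on `(0, 1]`.
  set S := Real.exp (-((|a| + c) / M ^ 2)) with hS
  have hS0 : 0 < S := Real.exp_pos _
  have hS1 : S ≤ 1 := Real.exp_le_one_iff.2 (neg_nonpos.2 (by positivity))
  have h1 : 0 ≤ fibreReduced p A V M P S := by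
    have h2 : S ^ (4 * p - 6) ≤ 1 := Real.rpow_le_one hS0.le hS1 (by linarith)
    have h3 : M ^ 2 * Real.log S = -(|a| + c) := by
      rw [hS, Real.log_exp]
      field_simp
    have h4 : c * S ^ (4 * p - 6) ≤ c := mul_le_of_le_one_right hc0 h2
    rw [fibreReduced, h3]
    linarith [neg_abs_le a]
  have hcont : ContinuousOn (fibreReduced p A V M P) (Icc S T) := by
    unfold fibreReduced
    intro t ht
    have ht0 : t ≠ 0 := (hS0.trans_le ht.1).ne'
    refine ContinuousAt.continuousWithinAt ?_
    exact (continuousAt_const.sub (continuousAt_const.mul (Real.continuousAt_log ht0))).sub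
      (continuousAt_const.mul (Real.continuousAt_rpow_const t _ (Or.inl ht0)))
  obtain ⟨t, ht, ht0⟩ := intermediate_value_Icc' (hS1.trans hT) hcont ⟨h, h1⟩
  exact ⟨t, hS0.trans_le ht.1, ht.2, ht0⟩

lemma exists_fibreReduced_eq_zero {p A V M P : ℝ} (hp : 2 ≤ p) (hM : 0 < M) (hP : 0 ≤ P) :
    ∃ t, 0 < t ∧ fibreReduced p A V M P t = 0 := by
  set a := 2 * A - 1 / 4 * M ^ 2 + V with ha
  have hM2 : 0 < M ^ 2 := by positivity
  -- At this parameter the logarithmic term equals `|a|`, which already makes the reduced function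
  -- nonpositive.
  have hT : 1 ≤ Real.exp (|a| / M ^ 2) := Real.one_le_exp (by positivity)
  obtain ⟨t, ht, -, h⟩ := exists_fibreReduced_eq_zero_of_le hp hM hP (A := A) (V := V) hT (by
    have h3 : M ^ 2 * Real.log (Real.exp (|a| / M ^ 2)) = |a| := by
      rw [Real.log_exp]
      field_simp
    have h4 : 0 ≤ (4 * p - 2) / (2 * p) * P * Real.exp (|a| / M ^ 2) ^ (4 * p - 6) :=
      mul_nonneg (mul_nonneg (div_nonneg (by linarith) (by linarith)) hP) (by positivity)
    rw [fibreReduced, h3]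
    linarith [le_abs_self a])
  exact ⟨t, ht, h⟩

/-- A zero of `fibreNehari` maximises the energy along the fibre. -/
lemma fibreEnergy_le_one {p A V M P s : ℝ} (hp : 2 ≤ p) (hP : 0 ≤ P) (hs : 0 < s)
    (h : fibreNehari p A V M P 1 = 0) :
    fibreEnergy p A V M P s ≤ fibreEnergy p A V M P 1 := by
  -- In the variable `x = s⁴` the loss of energy is `M² / 16 (1 - x + x log x) + P / (2p) ((q - 1) -
  -- q x + x^q)`, once `V` is eliminated by the constraint. Both brackets are nonnegative, by
  -- convexity of `x log x` and by Bernoulli's inequality.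
  set q := (2 * p - 1) / 2 with hq
  have hx : 0 < s ^ 4 := by positivity
  have h1 : s ^ (4 * p - 2) = (s ^ 4) ^ q := by
    rw [← Real.rpow_natCast s 4, ← Real.rpow_mul hs.le]
    congr 1
    push_cast
    ring
  have h2 : 4 * Real.log s = Real.log (s ^ 4) := by
    rw [Real.log_pow]
    norm_num
  simp only [fibreNehari, one_pow, Real.log_one, Real.one_rpow] at h
  simp only [fibreEnergy, one_pow, Real.log_one, Real.one_rpow]
  rw [h1]
  set x := s ^ 4
  have h3 : 0 ≤ 1 - x + x * Real.log x := by
    have := mul_le_mul_of_nonneg_left (Real.one_sub_inv_le_log_of_pos hx) hx.le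
    rw [mul_sub, mul_inv_cancel₀ hx.ne'] at this
    linarith
  have h4 : 0 ≤ (q - 1) - q * x + x ^ q := by
    have := one_add_mul_self_le_rpow_one_add (s := x - 1) (by linarith) (p := q)
      (by rw [hq]; linarith)
    rw [add_sub_cancel] at this
    linarith
  have hV : V = 1 / 4 * M ^ 2 + (4 * p - 2) / (2 * p) * P - 2 * A := by linarith
  have hp0 : 0 < p := by linarith
  have h5 : 0 ≤ M ^ 2 / 16 * (1 - x + x * Real.log x) +
      P / (2 * p) * ((q - 1) - q * x + x ^ q) := by positivity
  have h6 : (4 * p - 2) / (2 * p) * P = P / (2 * p) * (4 * q) := by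
    rw [hq]
    ring
  rw [← h2] at h5
  have h7 : 1 / (2 * p) * (x ^ q * P) = P / (2 * p) * x ^ q := by ring
  have h8 : 1 / (2 * p) * (1 * P) = P / (2 * p) := by ring
  rw [hV, h6, h7, h8]
  nlinarith [h5]

/-- Because `f` vanishes at `x`, continuity of the coefficient `c` suffices. This is what spares
proving that the fibre parameter depends differentiably on the perturbation. -/
lemma hasDerivAt_mul_of_continuousAt {c f : ℝ → ℝ} {d x : ℝ} (hc : ContinuousAt c x)
    (hf : HasDerivAt f d x) (h0 : f x = 0) : HasDerivAt (fun s => c s * f s) (c x * d) x := by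
  rw [hasDerivAt_iff_tendsto_slope] at hf ⊢
  refine ((hc.tendsto.mono_left nhdsWithin_le_nhds).mul hf).congr fun s => ?_
  rw [slope_def_field, slope_def_field, h0]
  ring

/-- First order condition for a minimum of the fibrewise maximum along a curve. -/
lemma fibre_critical {p : ℝ} (hp : 2 ≤ p) {A V M P : ℝ → ℝ} {A' V' M' P' : ℝ}
    (hA : HasDerivAt A A' 0) (hV : HasDerivAt V V' 0) (hM : HasDerivAt M M' 0)
    (hP : HasDerivAt P P' 0) (hM0 : 0 < M 0) (hP0 : ∀ s, 0 ≤ P s)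
    (h1 : fibreNehari p (A 0) (V 0) (M 0) (P 0) 1 = 0)
    (hmin : ∀ s t, 0 < t → 0 < M s → fibreNehari p (A s) (V s) (M s) (P s) t = 0 →
      fibreEnergy p (A 0) (V 0) (M 0) (P 0) 1 ≤ fibreEnergy p (A s) (V s) (M s) (P s) t) :
    1 / 2 * A' + 1 / 4 * V' - 1 / (2 * p) * P' = 0 := by
  classical
  have hex : ∀ s, ∃ t, 0 < t ∧ (0 < M s → fibreReduced p (A s) (V s) (M s) (P s) t = 0) := by
    intro s
    by_cases hs : 0 < M s
    · obtain ⟨t, ht, h⟩ := exists_fibreReduced_eq_zero hp hs (hP0 s) (A := A s) (V := V s)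
      exact ⟨t, ht, fun _ => h⟩
    · exact ⟨1, one_pos, fun h => absurd h hs⟩
  choose τ hτ0 hτ using hex
  have hMev : ∀ᶠ s in 𝓝 0, 0 < M s := hM.continuousAt.eventually (lt_mem_nhds hM0)
  have hr0 : fibreReduced p (A 0) (V 0) (M 0) (P 0) 1 = 0 :=
    (fibreNehari_eq_zero_iff one_pos).1 h1
  have hcont : ∀ t, ContinuousAt (fun s => fibreReduced p (A s) (V s) (M s) (P s) t) 0 := by
    intro t
    unfold fibreReduced
    have a1 := hA.continuousAt
    have a2 := hV.continuousAt
    have a3 := hM.continuousAt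
    have a4 := hP.continuousAt
    fun_prop
  -- Each reduced function is strictly decreasing with its zero at `τ s`. Its sign at a fixed
  -- parameter other than `1` is preserved for small `s`, which traps `τ s` on the correct side.
  have hlim : Tendsto τ (𝓝 0) (𝓝 1) := by
    refine tendsto_order.2 ⟨fun a ha => ?_, fun a ha => ?_⟩
    · have hb : 0 < max a (1 / 2) := lt_max_of_lt_right (by norm_num)
      have h2 := fibreReduced_lt hp hM0 (hP0 0) hb (max_lt ha (by norm_num)) (A := A 0) (V := V 0)
      rw [hr0] at h2
      filter_upwards [hMev, (hcont _).eventually (lt_mem_nhds h2)] with s hs hs2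
      refine lt_of_le_of_lt (le_max_left a (1 / 2)) ?_
      by_contra! hle
      rcases hle.eq_or_lt with heq | hlt
      · rw [← heq, hτ s hs] at hs2
        exact lt_irrefl _ hs2
      · have := fibreReduced_lt hp hs (hP0 s) (hτ0 s) hlt (A := A s) (V := V s)
        rw [hτ s hs] at this
        exact lt_asymm this hs2
    · have h2 := fibreReduced_lt hp hM0 (hP0 0) one_pos ha (A := A 0) (V := V 0)
      rw [hr0] at h2
      filter_upwards [hMev, (hcont _).eventually (gt_mem_nhds h2)] with s hs hs2
      by_contra! hle
      rcases hle.eq_or_lt with heq | hlt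
      · rw [heq, hτ s hs] at hs2
        exact lt_irrefl _ hs2
      · have := fibreReduced_lt hp hs (hP0 s) (one_pos.trans ha) hlt (A := A s) (V := V s)
        rw [hτ s hs] at this
        exact lt_asymm this hs2
  have hτ1 : τ 0 = 1 := tendsto_nhds_unique (tendsto_pure_nhds τ 0) (hlim.mono_left (pure_le_nhds 0))
  have hτc : ContinuousAt τ 0 := by
    rw [ContinuousAt, hτ1]
    exact hlim
  have d1 := hasDerivAt_mul_of_continuousAt (c := fun s => 1 / 2 * τ s ^ 4)
    (continuousAt_const.mul (hτc.pow 4)) (hA.sub_const (A 0)) (sub_self _)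
  have d2 := hasDerivAt_mul_of_continuousAt (c := fun s => 1 / 4 * τ s ^ 4)
    (continuousAt_const.mul (hτc.pow 4)) (hV.sub_const (V 0)) (sub_self _)
  have d3 := hasDerivAt_mul_of_continuousAt (c := fun s => 1 / 4 * τ s ^ 4 * Real.log (τ s))
    ((continuousAt_const.mul (hτc.pow 4)).mul (hτc.log (hτ0 0).ne'))
    ((hM.pow 2).sub_const (M 0 ^ 2)) (sub_self _)
  have d4 := hasDerivAt_mul_of_continuousAt (c := fun s => 1 / (2 * p) * τ s ^ (4 * p - 2))
    (continuousAt_const.mul (hτc.rpow_const (Or.inl (hτ0 0).ne'))) (hP.sub_const (P 0))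
    (sub_self _)
  have d := ((d1.add d2).sub d3).sub d4
  -- The value at `s` is the energy of the perturbed fibre minus that of the original fibre, both at
  -- the parameter `τ s`. The first is at least the minimal level and the second at most it, since
  -- the original fibre is maximal at `1`.
  have hloc : IsLocalMin ((((fun s => 1 / 2 * τ s ^ 4 * (A s - A 0)) +
      fun s => 1 / 4 * τ s ^ 4 * (V s - V 0)) - fun s => 1 / 4 * τ s ^ 4 * Real.log (τ s) *
      ((M ^ 2) s - M 0 ^ 2)) - fun s => 1 / (2 * p) * τ s ^ (4 * p - 2) * (P s - P 0)) 0 := by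
    filter_upwards [hMev] with s hs
    have g1 := hmin s (τ s) (hτ0 s) hs ((fibreNehari_eq_zero_iff (hτ0 s)).2 (hτ s hs))
    have g2 := fibreEnergy_le_one hp (hP0 0) (hτ0 s) h1
    simp only [Pi.sub_apply, Pi.add_apply, Pi.pow_apply, sub_self, mul_zero, add_zero]
    have g3 := g2.trans g1
    rw [fibreEnergy, fibreEnergy] at g3
    linarith
  have := hloc.hasDerivAt_eq_zero d
  rw [hτ1] at this
  simpa using this

/-! ### Powers of `H¹` functions -/

/-- A real exponent lies between two integer ones: the lower power dominates for `r ≤ 1` and the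
upper one for `r ≥ 1`. This reduces all integrals to even integer powers. -/
lemma rpow_le_pow_add_pow {r q : ℝ} {m n : ℕ} (hr : 0 ≤ r) (hm0 : m ≠ 0) (hm : m ≤ q) (hn : q ≤ n) :
    r ^ q ≤ r ^ m + r ^ n := by
  rcases hr.eq_or_lt with rfl | hr0
  · have : (0 : ℝ) < m := by exact_mod_cast Nat.pos_of_ne_zero hm0
    rw [Real.zero_rpow (by linarith)]
    positivity
  rcases le_total r 1 with h | h
  · have := Real.rpow_le_rpow_of_exponent_ge hr0 h hm
    rw [Real.rpow_natCast] at this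
    have := pow_nonneg hr n
    linarith
  · have := Real.rpow_le_rpow_of_exponent_le h hn
    rw [Real.rpow_natCast] at this
    have := pow_nonneg hr m
    linarith

lemma exists_even_ge (q : ℝ) : ∃ k : ℕ, q ≤ (2 * (k + 1) : ℕ) := by
  obtain ⟨k, hk⟩ := exists_nat_ge q
  refine ⟨k, hk.trans ?_⟩
  exact_mod_cast (by omega : k ≤ 2 * (k + 1))

lemma aestronglyMeasurable_abs_rpow {u : Plane → ℝ} (hu : AEStronglyMeasurable u volume) (q : ℝ) :
    AEStronglyMeasurable (fun x => |u x| ^ q) volume :=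
  (hu.norm.aemeasurable.pow_const q).aestronglyMeasurable

lemma MemH1.integrable_rpow {u : Plane → ℝ} (hu : MemH1 u) {q : ℝ} (hq : 2 ≤ q) :
    Integrable fun x => |u x| ^ q := by
  obtain ⟨k, hk⟩ := exists_even_ge q
  obtain ⟨C, -, h⟩ := exists_integral_pow_le k
  refine (hu.1.integrable_sq.add (h u hu).1).mono' (aestronglyMeasurable_abs_rpow hu.1.1 q)
    (Eventually.of_forall fun x => ?_)
  rw [Real.norm_of_nonneg (by positivity)]
  refine (rpow_le_pow_add_pow (abs_nonneg (u x)) (m := 2) (by norm_num) (by simpa using hq)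
    hk).trans_eq ?_
  rw [sq_abs, (even_two_mul _).pow_abs]
  rfl

/-- `∫ |u|^q ≤ C ‖u‖₂² (‖∇u‖₂² + ‖∇u‖₂^{2k+2})` for `q ≥ 4`. -/
lemma exists_integral_rpow_le {q : ℝ} (hq : 4 ≤ q) : ∃ (C : ℝ) (k : ℕ), 0 ≤ C ∧
    ∀ u : Plane → ℝ, MemH1 u →
      ∫ x, |u x| ^ q ≤ C * (massSq u * (gradSq u + gradSq u ^ (k + 1))) := by
  obtain ⟨k, hk⟩ := exists_even_ge q
  obtain ⟨C₁, hC₁, h₁⟩ := exists_integral_pow_le 1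
  obtain ⟨C₂, hC₂, h₂⟩ := exists_integral_pow_le (k + 1)
  refine ⟨C₁ + C₂, k, by positivity, fun u hu => ?_⟩
  obtain ⟨i1, h1⟩ := h₁ u hu
  obtain ⟨i2, h2⟩ := h₂ u hu
  have hle : ∫ x, |u x| ^ q ≤ ∫ x, (u x ^ 4 + u x ^ (2 * (k + 1 + 1))) := by
    refine integral_mono (hu.integrable_rpow (by linarith)) (i1.add i2) fun x => ?_
    refine (rpow_le_pow_add_pow (abs_nonneg (u x)) (m := 4) (n := 2 * (k + 1 + 1)) (by norm_num)
      (by exact_mod_cast hq) (hk.trans (by exact_mod_cast (by omega)))).trans_eq ?_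
    rw [(even_two_mul _).pow_abs, (by decide : Even 4).pow_abs]
  rw [integral_add i1 i2] at hle
  have hM := massSq_nonneg u
  have hG := gradSq_nonneg u
  rw [pow_one] at h1
  calc _ ≤ _ := hle
    _ ≤ C₁ * (massSq u * gradSq u) + C₂ * (massSq u * gradSq u ^ (k + 1)) := add_le_add h1 h2
    _ ≤ (C₁ + C₂) * (massSq u * (gradSq u + gradSq u ^ (k + 1))) := by
      have a1 : 0 ≤ C₁ * (massSq u * gradSq u ^ (k + 1)) := by positivity
      have a2 : 0 ≤ C₂ * (massSq u * gradSq u) := by positivity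
      nlinarith

lemma two_mul_abs_mul_rpow_le {p : ℝ} (a b : ℝ) :
    2 * |a * b| ^ p ≤ |a| ^ (2 * p) + |b| ^ (2 * p) := by
  rw [abs_mul, Real.mul_rpow (abs_nonneg _) (abs_nonneg _), mul_comm 2 p,
    Real.rpow_mul (abs_nonneg _), Real.rpow_mul (abs_nonneg _), Real.rpow_two, Real.rpow_two]
  nlinarith [sq_nonneg (|a| ^ p - |b| ^ p)]

lemma integrable_abs_mul_rpow {p : ℝ} (hp : 1 ≤ p) {u v : Plane → ℝ} (hu : MemH1 u)
    (hv : MemH1 v) : Integrable fun x => |u x * v x| ^ p := by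
  refine ((hu.integrable_rpow (q := 2 * p) (by linarith)).add
    (hv.integrable_rpow (q := 2 * p) (by linarith))).mono'
      (aestronglyMeasurable_abs_rpow (hu.1.1.mul hv.1.1) p) (Eventually.of_forall fun x => ?_)
  rw [Real.norm_of_nonneg (by positivity), Pi.add_apply]
  have := two_mul_abs_mul_rpow_le (p := p) (u x) (v x)
  have : 0 ≤ |u x * v x| ^ p := by positivity
  linarith

lemma powerTerm_nonneg {p β : ℝ} (hβ : 0 ≤ β) (u v : Plane → ℝ) : 0 ≤ powerTerm p β u v := by
  have h1 : 0 ≤ ∫ x, |u x| ^ (2 * p) := integral_nonneg fun x => by positivity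
  have h2 : 0 ≤ ∫ x, |v x| ^ (2 * p) := integral_nonneg fun x => by positivity
  have h3 : 0 ≤ ∫ x, |u x * v x| ^ p := integral_nonneg fun x => by positivity
  unfold powerTerm
  positivity

lemma powerTerm_le {p β : ℝ} (hp : 1 ≤ p) (hβ : 0 ≤ β) {u v : Plane → ℝ} (hu : MemH1 u)
    (hv : MemH1 v) : powerTerm p β u v ≤
      (1 + β) * ((∫ x, |u x| ^ (2 * p)) + ∫ x, |v x| ^ (2 * p)) := by
  have i1 := hu.integrable_rpow (q := 2 * p) (by linarith)
  have i2 := hv.integrable_rpow (q := 2 * p) (by linarith)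
  have h : 2 * ∫ x, |u x * v x| ^ p ≤ (∫ x, |u x| ^ (2 * p)) + ∫ x, |v x| ^ (2 * p) := by
    rw [← integral_const_mul, ← integral_add i1 i2]
    exact integral_mono ((integrable_abs_mul_rpow hp hu hv).const_mul 2) (i1.add i2)
      fun x => two_mul_abs_mul_rpow_le _ _
  unfold powerTerm
  nlinarith [mul_le_mul_of_nonneg_left h hβ]

/-! ### The functionals on pairs of functions -/

/-- The total mass `‖u‖₂² + ‖v‖₂²`. -/
noncomputable def pairMass (u v : Plane → ℝ) : ℝ := massSq u + massSq v

/-- The total gradient term `‖∇u‖₂² + ‖∇v‖₂²`. -/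
noncomputable def pairGrad (u v : Plane → ℝ) : ℝ := gradSq u + gradSq v

/-- The energy of a pair of functions. -/
noncomputable def pairEnergy (p β : ℝ) (u v : Plane → ℝ) : ℝ :=
  1 / 2 * pairGrad u v + 1 / 4 * logEnergy u v - 1 / (2 * p) * powerTerm p β u v

/-- The Nehari–Pohozaev functional of a pair of functions. -/
noncomputable def pairNehari (p β : ℝ) (u v : Plane → ℝ) : ℝ :=
  2 * pairGrad u v - 1 / 4 * pairMass u v ^ 2 + logEnergy u v -
    (4 * p - 2) / (2 * p) * powerTerm p β u v

/-- The value of the energy minus a quarter of the Nehari–Pohozaev functional. -/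
noncomputable def pairReduced (p β : ℝ) (u v : Plane → ℝ) : ℝ :=
  pairMass u v ^ 2 / 16 + (2 * p - 3) / (4 * p) * powerTerm p β u v

lemma pairMass_nonneg (u v : Plane → ℝ) : 0 ≤ pairMass u v :=
  add_nonneg (massSq_nonneg _) (massSq_nonneg _)

lemma pairGrad_nonneg (u v : Plane → ℝ) : 0 ≤ pairGrad u v :=
  add_nonneg (gradSq_nonneg _) (gradSq_nonneg _)

/-- Subtracting `J_β / 4` cancels both the gradient term and the indefinite logarithmic term; the
remaining coefficient of the power term is `1/4 · (4p - 2) / (2p) - 1 / (2p)`. -/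
lemma pairEnergy_eq_pairReduced {p β : ℝ} (hp : 2 ≤ p) {u v : Plane → ℝ}
    (h : pairNehari p β u v = 0) : pairEnergy p β u v = pairReduced p β u v := by
  have hV : logEnergy u v = 1 / 4 * pairMass u v ^ 2 - 2 * pairGrad u v +
      (4 * p - 2) / (2 * p) * powerTerm p β u v := by
    unfold pairNehari at h
    linarith
  have hp0 : p ≠ 0 := by linarith
  rw [pairEnergy, pairReduced, hV]
  field_simp
  ring

lemma integral_density {u v : Plane → ℝ} (hu : MemLp u 2 volume) (hv : MemLp v 2 volume) :
    ∫ x, density u v x = pairMass u v :=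
  integral_add hu.integrable_sq hv.integrable_sq

section Congr

variable {u u' v v' : Plane → ℝ}

lemma massSq_congr (h : u =ᵐ[volume] u') : massSq u = massSq u' :=
  integral_congr_ae (h.mono fun x hx => by simp only [hx])

lemma logSq_congr {lam : ℝ} (h : u =ᵐ[volume] u') : logSq lam u = logSq lam u' :=
  integral_congr_ae (h.mono fun x hx => by simp only [hx])

lemma logEnergy_congr (hu : u =ᵐ[volume] u') (hv : v =ᵐ[volume] v') :
    logEnergy u v = logEnergy u' v' := by
  refine integral_congr_ae ?_
  filter_upwards [hu, hv] with x h1 h2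
  refine integral_congr_ae ?_
  filter_upwards [hu, hv] with y h3 h4
  simp only [h1, h2, h3, h4]

lemma powerTerm_congr {p β : ℝ} (hu : u =ᵐ[volume] u') (hv : v =ᵐ[volume] v') :
    powerTerm p β u v = powerTerm p β u' v' := by
  have h1 : ∫ x, |u x| ^ (2 * p) = ∫ x, |u' x| ^ (2 * p) :=
    integral_congr_ae (hu.mono fun x hx => by simp only [hx])
  have h2 : ∫ x, |v x| ^ (2 * p) = ∫ x, |v' x| ^ (2 * p) :=
    integral_congr_ae (hv.mono fun x hx => by simp only [hx])
  have h3 : ∫ x, |u x * v x| ^ p = ∫ x, |u' x * v' x| ^ p := by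
    refine integral_congr_ae ?_
    filter_upwards [hu, hv] with x h1 h2
    rw [h1, h2]
  rw [powerTerm, powerTerm, h1, h2, h3]

lemma pairMass_congr (hu : u =ᵐ[volume] u') (hv : v =ᵐ[volume] v') :
    pairMass u v = pairMass u' v' := by
  rw [pairMass, pairMass, massSq_congr hu, massSq_congr hv]

lemma pairGrad_congr (hu : u =ᵐ[volume] u') (hv : v =ᵐ[volume] v') :
    pairGrad u v = pairGrad u' v' := by
  rw [pairGrad, pairGrad, gradSq_congr hu, gradSq_congr hv]

lemma pairNehari_congr {p β : ℝ} (hu : u =ᵐ[volume] u') (hv : v =ᵐ[volume] v') :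
    pairNehari p β u v = pairNehari p β u' v' := by
  rw [pairNehari, pairNehari, pairGrad_congr hu hv, pairMass_congr hu hv, logEnergy_congr hu hv,
    powerTerm_congr hu hv]

lemma pairEnergy_congr {p β : ℝ} (hu : u =ᵐ[volume] u') (hv : v =ᵐ[volume] v') :
    pairEnergy p β u v = pairEnergy p β u' v' := by
  rw [pairEnergy, pairEnergy, pairGrad_congr hu hv, logEnergy_congr hu hv, powerTerm_congr hu hv]

end Congr

/-! ### Dilations -/

/-- The mass-changing dilation `t² u(t·)`. -/
def dilate (t : ℝ) (u : Plane → ℝ) (x : Plane) : ℝ := t ^ 2 * u (t • x)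

lemma dilate_one (u : Plane → ℝ) : dilate 1 u = u := by
  funext x
  simp [dilate]

lemma memW_dilate {lam : ℝ} (hlam : 1 < lam) {u : Plane → ℝ} (hu : MemW lam u) {t : ℝ}
    (ht : 0 < t) : MemW lam (dilate t u) := hu.dilate hlam _ ht

lemma massSq_dilate (u : Plane → ℝ) {t : ℝ} (ht : 0 < t) :
    massSq (dilate t u) = t ^ 2 * massSq u := by
  unfold massSq dilate
  simp_rw [mul_pow]
  rw [integral_const_mul, integral_comp_smul_plane (fun x => u x ^ 2), smul_eq_mul]
  field_simp

lemma pairMass_dilate (u v : Plane → ℝ) {t : ℝ} (ht : 0 < t) :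
    pairMass (dilate t u) (dilate t v) = t ^ 2 * pairMass u v := by
  rw [pairMass, massSq_dilate u ht, massSq_dilate v ht, pairMass]
  ring

lemma pairGrad_dilate {u v : Plane → ℝ} (hu : MemH1 u) (hv : MemH1 v) {t : ℝ} (ht : 0 < t) :
    pairGrad (dilate t u) (dilate t v) = t ^ 4 * pairGrad u v := by
  have h1 : gradSq (dilate t u) = (t ^ 2) ^ 2 * gradSq u := gradSq_dilate hu _ ht.ne'
  have h2 : gradSq (dilate t v) = (t ^ 2) ^ 2 * gradSq v := gradSq_dilate hv _ ht.ne'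
  rw [pairGrad, h1, h2, pairGrad]
  ring

lemma rpow_four_mul_sub_two {t p : ℝ} (ht : 0 < t) :
    (t ^ 2) ^ (2 * p) * (t ^ 2)⁻¹ = t ^ (4 * p - 2) := by
  rw [← Real.rpow_natCast t 2, ← Real.rpow_mul ht.le, ← Real.rpow_neg ht.le, ← Real.rpow_add ht]
  congr 1
  push_cast
  ring

lemma powerTerm_dilate (p β : ℝ) (u v : Plane → ℝ) {t : ℝ} (ht : 0 < t) :
    powerTerm p β (dilate t u) (dilate t v) = t ^ (4 * p - 2) * powerTerm p β u v := by
  have h1 : ∀ w : Plane → ℝ, ∫ x, |dilate t w x| ^ (2 * p) =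
      t ^ (4 * p - 2) * ∫ x, |w x| ^ (2 * p) := by
    intro w
    have e : ∀ x, |dilate t w x| ^ (2 * p) = (t ^ 2) ^ (2 * p) * |w (t • x)| ^ (2 * p) := by
      intro x
      rw [dilate, abs_mul, abs_of_nonneg (by positivity), Real.mul_rpow (by positivity)
        (abs_nonneg _)]
    simp_rw [e]
    rw [integral_const_mul, integral_comp_smul_plane (fun x => |w x| ^ (2 * p)), smul_eq_mul,
      ← mul_assoc, rpow_four_mul_sub_two ht]
  have h2 : ∫ x, |dilate t u x * dilate t v x| ^ p =
      t ^ (4 * p - 2) * ∫ x, |u x * v x| ^ p := by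
    have e : ∀ x, |dilate t u x * dilate t v x| ^ p =
        (t ^ 2) ^ (2 * p) * |u (t • x) * v (t • x)| ^ p := by
      intro x
      have : dilate t u x * dilate t v x = (t ^ 2) ^ 2 * (u (t • x) * v (t • x)) := by
        simp only [dilate]
        ring
      rw [this, abs_mul, abs_of_nonneg (by positivity), Real.mul_rpow (by positivity)
        (abs_nonneg _), Real.rpow_mul (by positivity) 2 p, Real.rpow_two]
    simp_rw [e]
    rw [integral_const_mul, integral_comp_smul_plane (fun x => |u x * v x| ^ p), smul_eq_mul,
      ← mul_assoc, rpow_four_mul_sub_two ht]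
  rw [powerTerm, h1, h1, h2, powerTerm]
  ring

lemma logEnergy_dilate {lam : ℝ} (hlam : 1 < lam) {u v : Plane → ℝ} (hu : MemW lam u)
    (hv : MemW lam v) {t : ℝ} (ht : 0 < t) : logEnergy (dilate t u) (dilate t v) =
      t ^ 4 * (logEnergy u v - Real.log t * pairMass u v ^ 2) := by
  have hd := hu.logDensity hlam.le hv
  rw [logEnergy_eq hlam.le (memW_dilate hlam hu ht) (memW_dilate hlam hv ht), logEnergy_eq hlam.le hu hv]
  have e : density (dilate t u) (dilate t v) = fun x => t ^ 4 * density u v (t • x) := by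
    funext x
    simp only [density, dilate]
    ring
  have hcomm : ∀ z : Plane, Real.log ‖-z‖ = Real.log ‖z‖ := fun z => by rw [norm_neg]
  rw [e, kernelForm_const_mul_right, kernelForm_comm hcomm, kernelForm_const_mul_right,
    kernelForm_log_dilate hlam.le hd hd ht, integral_density hu.1.1 hv.1.1]
  field_simp

lemma pairEnergy_dilate {lam : ℝ} (hlam : 1 < lam) (p β : ℝ) {u v : Plane → ℝ} (hu : MemW lam u)
    (hv : MemW lam v) {t : ℝ} (ht : 0 < t) : pairEnergy p β (dilate t u) (dilate t v) =
      fibreEnergy p (pairGrad u v) (logEnergy u v) (pairMass u v) (powerTerm p β u v) t := by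
  rw [pairEnergy, pairGrad_dilate hu.1 hv.1 ht, logEnergy_dilate hlam hu hv ht,
    powerTerm_dilate p β u v ht, fibreEnergy]

lemma pairNehari_dilate {lam : ℝ} (hlam : 1 < lam) (p β : ℝ) {u v : Plane → ℝ} (hu : MemW lam u)
    (hv : MemW lam v) {t : ℝ} (ht : 0 < t) : pairNehari p β (dilate t u) (dilate t v) =
      fibreNehari p (pairGrad u v) (logEnergy u v) (pairMass u v) (powerTerm p β u v) t := by
  rw [pairNehari, pairGrad_dilate hu.1 hv.1 ht, logEnergy_dilate hlam hu hv ht,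
    powerTerm_dilate p β u v ht, pairMass_dilate u v ht, fibreNehari]

lemma pairNehari_eq_fibre (p β : ℝ) (u v : Plane → ℝ) : pairNehari p β u v =
    fibreNehari p (pairGrad u v) (logEnergy u v) (pairMass u v) (powerTerm p β u v) 1 := by
  simp [pairNehari, fibreNehari]

lemma pairEnergy_eq_fibre (p β : ℝ) (u v : Plane → ℝ) : pairEnergy p β u v =
    fibreEnergy p (pairGrad u v) (logEnergy u v) (pairMass u v) (powerTerm p β u v) 1 := by
  simp [pairEnergy, fibreEnergy]

/-! ### Translations -/

lemma massSq_comp_sub_right (u : Plane → ℝ) (y : Plane) :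
    massSq (fun x => u (x - y)) = massSq u :=
  integral_sub_right_eq_self (fun x => u x ^ 2) y

lemma pairMass_comp_sub_right (u v : Plane → ℝ) (y : Plane) :
    pairMass (fun x => u (x - y)) (fun x => v (x - y)) = pairMass u v := by
  rw [pairMass, massSq_comp_sub_right, massSq_comp_sub_right, pairMass]

lemma pairGrad_comp_sub_right {u v : Plane → ℝ} (hu : MemH1 u) (hv : MemH1 v) (y : Plane) :
    pairGrad (fun x => u (x - y)) (fun x => v (x - y)) = pairGrad u v := by
  rw [pairGrad, gradSq_comp_sub_right hu, gradSq_comp_sub_right hv, pairGrad]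

lemma powerTerm_comp_sub_right (p β : ℝ) (u v : Plane → ℝ) (y : Plane) :
    powerTerm p β (fun x => u (x - y)) (fun x => v (x - y)) = powerTerm p β u v := by
  rw [powerTerm, powerTerm, integral_sub_right_eq_self (fun x => |u x| ^ (2 * p)),
    integral_sub_right_eq_self (fun x => |v x| ^ (2 * p)),
    integral_sub_right_eq_self (fun x => |u x * v x| ^ p)]

lemma logEnergy_comp_sub_right {lam : ℝ} (hlam : 1 ≤ lam) {u v : Plane → ℝ} (hu : MemW lam u)
    (hv : MemW lam v) (y : Plane) :
    logEnergy (fun x => u (x - y)) (fun x => v (x - y)) = logEnergy u v := by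
  rw [logEnergy_eq hlam (hu.comp_sub_right hlam y) (hv.comp_sub_right hlam y),
    logEnergy_eq hlam hu hv]
  exact kernelForm_comp_sub_right _ (density u v) (density u v) y

lemma pairNehari_comp_sub_right {lam : ℝ} (hlam : 1 ≤ lam) (p β : ℝ) {u v : Plane → ℝ}
    (hu : MemW lam u) (hv : MemW lam v) (y : Plane) :
    pairNehari p β (fun x => u (x - y)) (fun x => v (x - y)) = pairNehari p β u v := by
  rw [pairNehari, pairGrad_comp_sub_right hu.1 hv.1, logEnergy_comp_sub_right hlam hu hv,
    pairMass_comp_sub_right, powerTerm_comp_sub_right, pairNehari]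

/-! ### The ground level -/

/-- The element of `W^λ` given by a function. -/
noncomputable def toW {lam : ℝ} {u : Plane → ℝ} (hu : MemW lam u) : W lam :=
  ⟨hu.1.1.toLp u, hu.congr hu.1.1.coeFn_toLp.symm⟩

lemma rep_toW {lam : ℝ} {u : Plane → ℝ} (hu : MemW lam u) : rep (toW hu) =ᵐ[volume] u :=
  hu.1.1.coeFn_toLp

lemma memW_rep {lam : ℝ} (w : W lam) : MemW lam (rep w) := w.2

lemma massSq_rep {lam : ℝ} (w : W lam) :
    massSq (rep w) = ‖(w : Lp ℝ 2 (volume : Measure Plane))‖ ^ 2 := by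
  have h := norm_toLp_sq (memW_rep w).1.1
  simp only [Lp.toLp_coeFn, Real.norm_eq_abs, sq_abs] at h
  exact h.symm

lemma massSq_rep_eq_zero {lam : ℝ} {w : W lam} : massSq (rep w) = 0 ↔ w = 0 := by
  rw [massSq_rep, sq_eq_zero_iff, norm_eq_zero, ZeroMemClass.coe_eq_zero]

lemma pairMass_rep_pos {lam : ℝ} {w : W lam × W lam} :
    0 < pairMass (rep w.1) (rep w.2) ↔ w ≠ 0 := by
  rw [(pairMass_nonneg _ _).lt_iff_ne, ne_comm, not_iff_not, pairMass,
    add_eq_zero_iff_of_nonneg (massSq_nonneg _) (massSq_nonneg _), massSq_rep_eq_zero,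
    massSq_rep_eq_zero, Prod.ext_iff]
  rfl

lemma energy_eq_pairEnergy (p β : ℝ) {lam : ℝ} (w : W lam × W lam) :
    energy p β w = pairEnergy p β (rep w.1) (rep w.2) := rfl

lemma nehariPohozaev_eq_pairNehari (p β : ℝ) {lam : ℝ} (w : W lam × W lam) :
    nehariPohozaev p β w = pairNehari p β (rep w.1) (rep w.2) := rfl

lemma energy_toW (p β : ℝ) {lam : ℝ} {u v : Plane → ℝ} (hu : MemW lam u) (hv : MemW lam v) :
    energy p β (toW hu, toW hv) = pairEnergy p β u v :=
  pairEnergy_congr (rep_toW hu) (rep_toW hv)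

lemma toW_mem_manifold {p β lam : ℝ} {u v : Plane → ℝ} (hu : MemW lam u) (hv : MemW lam v)
    (hM : 0 < pairMass u v) (h : pairNehari p β u v = 0) :
    (toW hu, toW hv) ∈ manifold p β lam := by
  refine ⟨pairMass_rep_pos.1 ?_, ?_⟩
  · rwa [pairMass_congr (rep_toW hu) (rep_toW hv)]
  · rwa [nehariPohozaev_eq_pairNehari, pairNehari_congr (rep_toW hu) (rep_toW hv)]

lemma pairReduced_nonneg {p β : ℝ} (hp : 2 ≤ p) (hβ : 0 ≤ β) (u v : Plane → ℝ) :
    0 ≤ pairReduced p β u v := by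
  have h := powerTerm_nonneg (p := p) hβ u v
  exact add_nonneg (by positivity)
    (mul_nonneg (div_nonneg (by linarith) (by linarith)) h)

lemma energy_nonneg_of_mem {p β lam : ℝ} (hp : 2 ≤ p) (hβ : 0 ≤ β) {w : W lam × W lam}
    (hw : w ∈ manifold p β lam) : 0 ≤ energy p β w := by
  rw [energy_eq_pairEnergy, pairEnergy_eq_pairReduced hp hw.2]
  exact pairReduced_nonneg hp hβ _ _

lemma bddBelow_energy {p β : ℝ} (lam : ℝ) (hp : 2 ≤ p) (hβ : 0 ≤ β) :
    BddBelow (energy p β '' manifold p β lam) := by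
  refine ⟨0, ?_⟩
  rintro _ ⟨w, hw, rfl⟩
  exact energy_nonneg_of_mem hp hβ hw

lemma groundLevel_le {p β lam : ℝ} (hp : 2 ≤ p) (hβ : 0 ≤ β) {u v : Plane → ℝ} (hu : MemW lam u)
    (hv : MemW lam v) (hM : 0 < pairMass u v) (h : pairNehari p β u v = 0) :
    groundLevel p β lam ≤ pairEnergy p β u v := by
  rw [← energy_toW p β hu hv]
  exact csInf_le (bddBelow_energy lam hp hβ) ⟨_, toW_mem_manifold hu hv hM h, rfl⟩

/-- A pair with nonpositive Nehari–Pohozaev functional and reduced energy at most the ground level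
is a minimizer. -/
lemma minimizer_of_pairReduced_le {p β lam : ℝ} (hp : 2 ≤ p) (hlam : 1 < lam) (hβ : 0 ≤ β)
    {u v : Plane → ℝ} (hu : MemW lam u) (hv : MemW lam v) (hM : 0 < pairMass u v)
    (hJ : pairNehari p β u v ≤ 0) (hI : pairReduced p β u v ≤ groundLevel p β lam) :
    pairNehari p β u v = 0 ∧ pairEnergy p β u v = groundLevel p β lam := by
  have hP := powerTerm_nonneg (p := p) hβ u v
  rw [pairNehari_eq_fibre, fibreNehari_eq one_pos, one_pow, one_mul] at hJ
  obtain ⟨t, ht, ht1, h0⟩ := exists_fibreReduced_eq_zero_of_le hp hM hP le_rfl hJ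
  rw [← fibreNehari_eq_zero_iff ht, ← pairNehari_dilate hlam p β hu hv ht] at h0
  have hMt : 0 < pairMass (dilate t u) (dilate t v) := by
    rw [pairMass_dilate u v ht]
    positivity
  have hle := groundLevel_le hp hβ (memW_dilate hlam hu ht) (memW_dilate hlam hv ht) hMt h0
  -- For `t < 1` the mass, and hence the reduced energy, drops strictly, so the projected pair would
  -- lie on the manifold below the ground level.
  have ht_eq : t = 1 := by
    by_contra hne
    have hlt : t < 1 := lt_of_le_of_ne ht1 hne
    rw [pairEnergy_eq_pairReduced hp h0, pairReduced, pairMass_dilate u v ht,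
      powerTerm_dilate p β u v ht] at hle
    have h1 : t ^ (4 * p - 2) * powerTerm p β u v ≤ powerTerm p β u v :=
      mul_le_of_le_one_left hP (Real.rpow_le_one ht.le ht1 (by linarith))
    have h2 : (t ^ 2 * pairMass u v) ^ 2 < pairMass u v ^ 2 := by
      refine pow_lt_pow_left₀ ?_ (by positivity) two_ne_zero
      exact mul_lt_of_lt_one_left hM (pow_lt_one₀ ht.le hlt two_ne_zero)
    have h3 := mul_le_mul_of_nonneg_left h1
      (div_nonneg (by linarith) (by linarith) : 0 ≤ (2 * p - 3) / (4 * p))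
    rw [pairReduced] at hI
    linarith
  rw [ht_eq, dilate_one, dilate_one] at h0 hle
  exact ⟨h0, le_antisymm ((pairEnergy_eq_pairReduced hp h0).trans_le hI) hle⟩

/-! ### Weak compactness in `W` -/

/-- The square of the norm of `W^λ`. -/
noncomputable def wSq (lam : ℝ) (u : Plane → ℝ) : ℝ := gradSq u + massSq u + logSq lam u

/-- The function `√log(λ + |x|) u(x)`. -/
noncomputable def weighted (lam : ℝ) (u : Plane → ℝ) (x : Plane) : ℝ :=
  √(Real.log (lam + ‖x‖)) * u x

lemma logSq_nonneg {lam : ℝ} (hlam : 1 ≤ lam) (u : Plane → ℝ) : 0 ≤ logSq lam u :=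
  integral_nonneg fun x => mul_nonneg (logWeight_nonneg hlam x) (sq_nonneg _)

lemma weighted_sq {lam : ℝ} (hlam : 1 ≤ lam) (u : Plane → ℝ) (x : Plane) :
    weighted lam u x ^ 2 = Real.log (lam + ‖x‖) * u x ^ 2 := by
  rw [weighted, mul_pow, Real.sq_sqrt (logWeight_nonneg hlam x)]

lemma aestronglyMeasurable_weighted {lam : ℝ} {u : Plane → ℝ} (hu : AEStronglyMeasurable u volume) :
    AEStronglyMeasurable (weighted lam u) volume :=
  (by fun_prop : Measurable fun x : Plane => √(Real.log (lam + ‖x‖))).aestronglyMeasurable.mul hu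

lemma MemW.memLp_weighted {lam : ℝ} (hlam : 1 ≤ lam) {u : Plane → ℝ} (hu : MemW lam u) :
    MemLp (weighted lam u) 2 volume := by
  rw [memLp_two_iff_integrable_sq (aestronglyMeasurable_weighted hu.1.1.1)]
  simp_rw [weighted_sq hlam]
  exact hu.2

lemma integral_weighted_sq {lam : ℝ} (hlam : 1 ≤ lam) (u : Plane → ℝ) :
    ∫ x, weighted lam u x ^ 2 = logSq lam u := by
  simp_rw [weighted_sq hlam]
  rfl

/-- Weak convergence in `L²(ℝ²; E)`, tested against square integrable functions. -/
def L2WeakTendsto {E : Type*} [NormedAddCommGroup E] [InnerProductSpace ℝ E]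
    (f : ℕ → Plane → E) (g : Plane → E) : Prop :=
  ∀ h : Plane → E, MemLp h 2 volume →
    Tendsto (fun n => ∫ x, inner ℝ (f n x) (h x)) atTop (𝓝 (∫ x, inner ℝ (g x) (h x)))

lemma L2WeakTendsto.comp {E : Type*} [NormedAddCommGroup E] [InnerProductSpace ℝ E]
    {f : ℕ → Plane → E} {g : Plane → E} (h : L2WeakTendsto f g) {k : ℕ → ℕ} (hk : StrictMono k) :
    L2WeakTendsto (fun n => f (k n)) g := fun φ hφ => (h φ hφ).comp hk.tendsto_atTop

lemma L2WeakTendsto.congr_right {E : Type*} [NormedAddCommGroup E] [InnerProductSpace ℝ E]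
    {f : ℕ → Plane → E} {g g' : Plane → E} (h : L2WeakTendsto f g) (hg : g =ᵐ[volume] g') :
    L2WeakTendsto f g' := fun φ hφ => by
  have e : ∫ x, inner ℝ (g x) (φ x) = ∫ x, inner ℝ (g' x) (φ x) :=
    integral_congr_ae (hg.mono fun x hx => by simp only [hx])
  rw [← e]
  exact h φ hφ

lemma L2WeakTendsto.tendsto_mul {f : ℕ → Plane → ℝ} {g : Plane → ℝ} (h : L2WeakTendsto f g)
    {φ : Plane → ℝ} (hφ : MemLp φ 2 volume) :
    Tendsto (fun n => ∫ x, f n x * φ x) atTop (𝓝 (∫ x, g x * φ x)) := by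
  simpa [mul_comm] using h φ hφ

lemma exists_L2WeakTendsto {E : Type*} [NormedAddCommGroup E] [InnerProductSpace ℝ E]
    [CompleteSpace E] [TopologicalSpace.SeparableSpace E] {f : ℕ → Plane → E} {K : ℝ}
    (hf : ∀ n, MemLp (f n) 2 volume) (hK : ∀ n, ∫ x, ‖f n x‖ ^ 2 ≤ K) :
    ∃ (k : ℕ → ℕ) (g : Plane → E), StrictMono k ∧ MemLp g 2 volume ∧
      L2WeakTendsto (fun n => f (k n)) g := by
  have : Fact ((2 : ENNReal) ≠ ⊤) := ⟨ENNReal.ofNat_ne_top⟩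
  obtain ⟨k, G, hk, -, hlim⟩ := exists_weak_subseq (H := Lp E 2 (volume : Measure Plane))
    (f := fun n => (hf n).toLp) (K := √K) fun n => by
      refine Real.le_sqrt_of_sq_le ?_
      rw [norm_toLp_sq]
      exact hK n
  refine ⟨k, G, hk, Lp.memLp G, fun h hh => ?_⟩
  have h1 := hlim hh.toLp
  have e : inner ℝ G hh.toLp = ∫ x, inner ℝ (G x) (h x) := by
    conv_lhs => rw [← Lp.toLp_coeFn G (Lp.memLp G)]
    exact inner_toLp _ _
  simp_rw [inner_toLp, e] at h1
  exact h1

/-- Weak convergence in `W^λ`, componentwise. -/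
structure WWeakTendsto (lam : ℝ) (u : ℕ → Plane → ℝ) (a : Plane → ℝ) : Prop where
  fn : L2WeakTendsto u a
  grad : L2WeakTendsto (fun n => weakGrad (u n)) (weakGrad a)
  weight : L2WeakTendsto (fun n => weighted lam (u n)) (weighted lam a)

/-- The functions, their gradients and their weighted versions get weak `L²` limits one after the
other. The limits are then identified with the corresponding data of one single function. -/
lemma exists_wWeakTendsto {lam : ℝ} (hlam : 1 < lam) {u : ℕ → Plane → ℝ} {K : ℝ}
    (hu : ∀ n, MemW lam (u n)) (hK : ∀ n, wSq lam (u n) ≤ K) :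
    ∃ (k : ℕ → ℕ) (a : Plane → ℝ), StrictMono k ∧ MemW lam a ∧
      WWeakTendsto lam (fun n => u (k n)) a := by
  have hle : ∀ n, massSq (u n) ≤ K ∧ gradSq (u n) ≤ K ∧ logSq lam (u n) ≤ K := by
    intro n
    have h1 := hK n
    have h2 := massSq_nonneg (u n)
    have h3 := gradSq_nonneg (u n)
    have h4 := logSq_nonneg hlam.le (u n)
    unfold wSq at h1
    exact ⟨by linarith, by linarith, by linarith⟩
  obtain ⟨k₁, a, hk₁, ha, h₁⟩ := exists_L2WeakTendsto (f := u) (K := K) (fun n => (hu n).1.1)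
    fun n => by simpa [massSq] using (hle n).1
  obtain ⟨k₂, g, hk₂, hg, h₂⟩ := exists_L2WeakTendsto (f := fun n => weakGrad (u (k₁ n))) (K := K)
    (fun n => (hu _).1.memLp_weakGrad) fun n => (hle _).2.1
  obtain ⟨k₃, b, hk₃, hb, h₃⟩ := exists_L2WeakTendsto
    (f := fun n => weighted lam (u (k₁ (k₂ n)))) (K := K) (fun n => (hu _).memLp_weighted hlam.le)
    fun n => by simpa [integral_weighted_sq hlam.le] using (hle _).2.2
  have l1 := (h₁.comp hk₂).comp hk₃
  have l2 := h₂.comp hk₃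
  have hag : IsWeakGradient a g := by
    intro φ hφ i
    have hv : MemLp (fun x => φ x • (EuclideanSpace.single i (1 : ℝ) : Plane)) 2 volume :=
      hφ.memLp.of_le (hφ.memLp.1.smul_const _) (Eventually.of_forall fun x => by
        simp [norm_smul])
    have e1 := l1.tendsto_mul (hφ.memLp_fderiv (EuclideanSpace.single i 1))
    have e2 := l2 _ hv
    simp only [inner_smul_right, EuclideanSpace.inner_single_right] at e2
    simp only [one_mul, conj_trivial, mul_comm (φ _)] at e2
    have e3 := fun n => (hu (k₁ (k₂ (k₃ n)))).1.isWeakGradient φ hφ i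
    simp_rw [e3] at e1
    exact tendsto_nhds_unique e1 e2.neg
  have hpos : ∀ x : Plane, 0 < √(Real.log (lam + ‖x‖)) := fun x =>
    Real.sqrt_pos.2 (Real.log_pos (by linarith [norm_nonneg x]))
  have hlow : ∀ x : Plane, (√(Real.log (lam + ‖x‖)))⁻¹ ≤ (√(Real.log lam))⁻¹ := fun x => by
    have hl : 0 < √(Real.log lam) := Real.sqrt_pos.2 (Real.log_pos hlam)
    refine inv_anti₀ hl (Real.sqrt_le_sqrt (Real.log_le_log (by linarith) ?_))
    linarith [norm_nonneg x]
  have hmw : Measurable fun x : Plane => (√(Real.log (lam + ‖x‖)))⁻¹ := by fun_prop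
  have hdiv : ∀ f : Plane → ℝ, MemLp f 2 volume →
      MemLp (fun x => (√(Real.log (lam + ‖x‖)))⁻¹ * f x) 2 volume := fun f hf =>
    (hf.const_mul (√(Real.log lam))⁻¹).of_le (hmw.aestronglyMeasurable.mul hf.1)
      (Eventually.of_forall fun x => by
        rw [norm_mul, norm_mul, Real.norm_of_nonneg (inv_nonneg.2 (Real.sqrt_nonneg _)),
          Real.norm_of_nonneg (inv_nonneg.2 (Real.sqrt_nonneg _))]
        exact mul_le_mul_of_nonneg_right (hlow x) (norm_nonneg _))
  -- Testing the weighted sequence against the test function divided by the weight returns the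
  -- unweighted pairing. The division keeps `L²`, the weight being bounded below since `λ > 1`.
  have hba : (fun x => (√(Real.log (lam + ‖x‖)))⁻¹ * b x) =ᵐ[volume] a := by
    refine ae_eq_of_test (hdiv b hb) ha fun φ hφ => ?_
    have e1 := h₃.tendsto_mul (hdiv φ hφ.memLp)
    have e2 := l1.tendsto_mul hφ.memLp
    have e3 : ∀ n, ∫ x, weighted lam (u (k₁ (k₂ (k₃ n)))) x *
        ((√(Real.log (lam + ‖x‖)))⁻¹ * φ x) = ∫ x, u (k₁ (k₂ (k₃ n))) x * φ x := by
      intro n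
      refine integral_congr_ae (Eventually.of_forall fun x => ?_)
      have := (hpos x).ne'
      simp only [weighted]
      field_simp
    simp_rw [e3] at e1
    rw [← tendsto_nhds_unique e1 e2]
    refine integral_congr_ae (Eventually.of_forall fun x => ?_)
    simp only
    ring
  have hbw : b =ᵐ[volume] weighted lam a := by
    filter_upwards [hba] with x hx
    rw [weighted, ← hx, mul_inv_cancel_left₀ (hpos x).ne']
  refine ⟨fun n => k₁ (k₂ (k₃ n)), a, (hk₁.comp hk₂).comp hk₃, ⟨⟨ha, g, hg, hag⟩, ?_⟩, l1,
    l2.congr_right (weakGrad_ae_eq hg hag).symm, h₃.congr_right hbw⟩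
  have := (hb.ae_eq hbw).integrable_sq
  simpa only [weighted_sq hlam.le] using this

/-- Weak lower semicontinuity of the norm: the weak limit is tested against its own gradient,
followed by Cauchy–Schwarz. -/
lemma gradSq_le_of_weak {u : ℕ → Plane → ℝ} {a : Plane → ℝ} {G : ℝ} (hu : ∀ n, MemH1 (u n))
    (ha : MemH1 a) (h : L2WeakTendsto (fun n => weakGrad (u n)) (weakGrad a))
    (hG : Tendsto (fun n => gradSq (u n)) atTop (𝓝 G)) : gradSq a ≤ G := by
  have h1 := h _ ha.memLp_weakGrad
  have h2 : gradSq a ≤ √G * √(gradSq a) := by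
    have e : ∫ x, inner ℝ (weakGrad a x) (weakGrad a x) = gradSq a := by
      simp_rw [real_inner_self_eq_norm_sq]
      rfl
    rw [e] at h1
    refine le_of_tendsto_of_tendsto' h1 ((Real.continuous_sqrt.tendsto _).comp hG |>.mul_const _)
      fun n => ?_
    exact (le_abs_self _).trans
      (abs_integral_inner_le (hu n).memLp_weakGrad ha.memLp_weakGrad)
  have h0 : 0 ≤ G := ge_of_tendsto' hG fun n => gradSq_nonneg _
  have h3 := Real.sq_sqrt h0
  have h4 := Real.sq_sqrt (gradSq_nonneg a)
  have h5 := Real.sqrt_nonneg G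
  have h6 := Real.sqrt_nonneg (gradSq a)
  have h7 : √(gradSq a) ≤ √G := by
    by_contra! h
    nlinarith
  rw [← h3, ← h4]
  exact pow_le_pow_left₀ h6 h7 2

/-! ### Mollification error -/

lemma plane_eq_sum (y : Plane) : y = y 0 • EuclideanSpace.single 0 (1 : ℝ) +
    y 1 • EuclideanSpace.single 1 (1 : ℝ) := by
  ext i
  fin_cases i <;> simp

/-- The translation is made in two coordinate steps; the factor `2` is the price of `(a + b)² ≤ 2a²
+ 2b²` and is harmless where only the order in `‖y‖` matters. -/
lemma MemH1.integral_translate_sub_sq_le {u : Plane → ℝ} (hu : MemH1 u) (y : Plane) :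
    ∫ x, (u (x + y) - u x) ^ 2 ≤ 2 * ‖y‖ ^ 2 * gradSq u := by
  set e₀ : Plane := y 0 • EuclideanSpace.single 0 (1 : ℝ) with he₀
  set e₁ : Plane := y 1 • EuclideanSpace.single 1 (1 : ℝ) with he₁
  have hy : y = e₀ + e₁ := plane_eq_sum y
  have hg := hu.memLp_weakGrad
  have d₀ := hu.isWeakGradient.integral_translate_sub_sq_le hu.1 hg 0 (y 0)
  have d₁ := hu.isWeakGradient.integral_translate_sub_sq_le hu.1 hg 1 (y 1)
  rw [← he₀] at d₀
  rw [← he₁] at d₁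
  have i₀ := ((memLp_comp_add_right hu.1 e₀).sub hu.1).integrable_sq
  have i₁ := ((memLp_comp_add_right hu.1 e₁).sub hu.1).integrable_sq
  have iy := ((memLp_comp_add_right hu.1 y).sub hu.1).integrable_sq
  simp only [Pi.sub_apply] at i₀ i₁ iy
  have i₁' := i₁.comp_add_right e₀
  have e : ∫ x, (u (x + e₁) - u x) ^ 2 = ∫ x, (u (x + e₀ + e₁) - u (x + e₀)) ^ 2 :=
    (integral_add_right_eq_self (fun x => (u (x + e₁) - u x) ^ 2) e₀).symm
  have hG : (∫ x, weakGrad u x 0 ^ 2) + ∫ x, weakGrad u x 1 ^ 2 = gradSq u := by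
    rw [← integral_add (memLp_coord hg 0).integrable_sq (memLp_coord hg 1).integrable_sq]
    simp_rw [coord_sq_add]
    rfl
  have h0 : 0 ≤ ∫ x, weakGrad u x 0 ^ 2 := integral_nonneg fun _ => sq_nonneg _
  have h1 : 0 ≤ ∫ x, weakGrad u x 1 ^ 2 := integral_nonneg fun _ => sq_nonneg _
  calc ∫ x, (u (x + y) - u x) ^ 2
      ≤ ∫ x, (2 * (u (x + e₀ + e₁) - u (x + e₀)) ^ 2 + 2 * (u (x + e₀) - u x) ^ 2) := by
        refine integral_mono iy ((i₁'.const_mul 2).add (i₀.const_mul 2)) fun x => ?_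
        simp only
        have hxy : x + y = x + e₀ + e₁ := by
          conv_lhs => rw [hy]
          rw [add_assoc]
        rw [hxy]
        nlinarith [sq_nonneg ((u (x + e₀ + e₁) - u (x + e₀)) - (u (x + e₀) - u x))]
    _ = 2 * (∫ x, (u (x + e₁) - u x) ^ 2) + 2 * ∫ x, (u (x + e₀) - u x) ^ 2 := by
        rw [integral_add (i₁'.const_mul 2) (i₀.const_mul 2), integral_const_mul,
          integral_const_mul, e]
    _ ≤ 2 * ‖y‖ ^ 2 * gradSq u := by
        rw [← hG, ← coord_sq_add]
        nlinarith [mul_nonneg (sq_nonneg (y 0)) h1, mul_nonneg (sq_nonneg (y 1)) h0]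

/-- Jensen bounds the error by an average over the bump of translation errors, and only `|y| < rOut`
contributes. The rate depends on `u` only through its gradient, hence is uniform on bounded sets. -/
lemma integral_mollify_sub_sq_le (η : ContDiffBump (0 : Plane)) {u : Plane → ℝ} (hu : MemH1 u) :
    ∫ x, (mollify η u x - u x) ^ 2 ≤ 2 * η.rOut ^ 2 * gradSq u := by
  have hηc := η.continuous_normed (μ := volume)
  have i3 : Integrable (η.normed volume) :=
    hηc.integrable_of_hasCompactSupport (η.hasCompactSupport_normed (μ := volume))
  have hl : LocallyIntegrable u volume := hu.1.locallyIntegrable (by norm_num)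
  have hmol := (memLp_mollify η hu.1).1
  have hconv : Integrable (fun z : Plane × Plane => η.normed volume z.2 * u (z.1 - z.2) ^ 2)
      (volume.prod volume) :=
    i3.convolution_integrand (ContinuousLinearMap.lsmul ℝ ℝ) hu.1.integrable_sq
  have hprod : Integrable (fun z : Plane × Plane => η.normed volume z.2 * u z.1 ^ 2)
      (volume.prod volume) := by
    simpa only [mul_comm] using hu.1.integrable_sq.mul_prod i3
  have hmeas : AEStronglyMeasurable (fun z : Plane × Plane =>
      η.normed volume z.2 * (u (z.1 - z.2) - u z.1) ^ 2) (volume.prod volume) :=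
    (hηc.comp continuous_snd).aestronglyMeasurable.mul
      (((hu.1.1.comp_quasiMeasurePreserving (quasiMeasurePreserving_sub volume volume)).sub
        hu.1.1.comp_fst).pow 2)
  have hint : Integrable (fun z : Plane × Plane =>
      η.normed volume z.2 * (u (z.1 - z.2) - u z.1) ^ 2) (volume.prod volume) := by
    refine ((hconv.const_mul 2).add (hprod.const_mul 2)).mono' hmeas
      (Eventually.of_forall fun z => ?_)
    have hη := η.nonneg_normed (μ := volume) z.2
    rw [Real.norm_of_nonneg (mul_nonneg hη (sq_nonneg _)), Pi.add_apply]
    have := mul_le_mul_of_nonneg_left (by nlinarith [sq_nonneg (u (z.1 - z.2) + u z.1)] :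
      (u (z.1 - z.2) - u z.1) ^ 2 ≤ 2 * u (z.1 - z.2) ^ 2 + 2 * u z.1 ^ 2) hη
    linarith
  have hpt : ∀ x, (mollify η u x - u x) ^ 2 ≤
      ∫ y, η.normed volume y * (u (x - y) - u x) ^ 2 := by
    intro x
    have i1 := integrable_bump_mul η hl x
    have i2 := integrable_bump_mul η hu.1.integrable_sq.locallyIntegrable x
    have h0 := mollify_sq_le η hu.1 x
    have e : ∀ y, η.normed volume y * (u (x - y) - u x) ^ 2 = (η.normed volume y * u (x - y) ^ 2 -
        2 * u x * (η.normed volume y * u (x - y))) + u x ^ 2 * η.normed volume y :=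
      fun y => by ring
    have i4 : Integrable fun y => η.normed volume y * u (x - y) ^ 2 -
        2 * u x * (η.normed volume y * u (x - y)) := i2.sub (i1.const_mul _)
    simp_rw [e]
    rw [integral_add i4 (i3.const_mul _), integral_sub i2 (i1.const_mul _), integral_const_mul,
      integral_const_mul, η.integral_normed, ← mollify_apply η u,
      ← mollify_apply η (fun y => u y ^ 2)]
    nlinarith
  calc ∫ x, (mollify η u x - u x) ^ 2
      ≤ ∫ x, ∫ y, η.normed volume y * (u (x - y) - u x) ^ 2 :=
        integral_mono (hmol.sub hu.1).integrable_sq hint.integral_prod_left hpt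
    _ = ∫ y, ∫ x, η.normed volume y * (u (x - y) - u x) ^ 2 := integral_integral_swap hint
    _ ≤ ∫ y, η.normed volume y * (2 * η.rOut ^ 2 * gradSq u) := by
        refine integral_mono hint.integral_prod_right (i3.mul_const _) fun y => ?_
        simp only
        rw [integral_const_mul]
        by_cases hy : y ∈ Metric.ball (0 : Plane) η.rOut
        · refine mul_le_mul_of_nonneg_left ?_ (η.nonneg_normed y)
          have h1 := hu.integral_translate_sub_sq_le (-y)
          simp only [← sub_eq_add_neg, norm_neg] at h1
          refine h1.trans ?_
          have h2 : ‖y‖ ≤ η.rOut := (mem_ball_zero_iff.1 hy).le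
          have h3 := gradSq_nonneg u
          gcongr
        · have : η.normed volume y = 0 := by
            rw [← Function.notMem_support, η.support_normed_eq]
            exact hy
          simp [this]
    _ = 2 * η.rOut ^ 2 * gradSq u := by rw [integral_mul_const, η.integral_normed, one_mul]

/-! ### Strong compactness -/

lemma MemW.sub {lam : ℝ} {u v : Plane → ℝ} (hu : MemW lam u) (hv : MemW lam v) :
    MemW lam (fun x => u x - v x) := by
  have := hu.add (hv.smul (-1))
  simpa [sub_eq_add_neg] using this

lemma gradSq_sub_le {u v : Plane → ℝ} (hu : MemH1 u) (hv : MemH1 v) :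
    gradSq (fun x => u x - v x) ≤ 2 * gradSq u + 2 * gradSq v := by
  have hgu := hu.memLp_weakGrad
  have hgv := hv.memLp_weakGrad.const_smul (-1 : ℝ)
  have e : (fun x => u x - v x) = fun x => u x + -1 * v x := by
    funext x
    ring
  rw [e, gradSq_eq (hgu.add hgv) (IsWeakGradient.add hu.1 (hv.1.const_mul (-1)) hgu hgv
    hu.isWeakGradient (hv.isWeakGradient.smul (-1)))]
  have i1 := (integrable_norm_sq hgu).const_mul 2
  have i2 := (integrable_norm_sq hv.memLp_weakGrad).const_mul 2
  have e2 : 2 * gradSq u + 2 * gradSq v =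
      ∫ x, (2 * ‖weakGrad u x‖ ^ 2 + 2 * ‖weakGrad v x‖ ^ 2) := by
    rw [integral_add i1 i2, integral_const_mul, integral_const_mul]
    rfl
  rw [e2]
  refine integral_mono (integrable_norm_sq (hgu.add hgv)) (i1.add i2) fun x => ?_
  simp only [Pi.add_apply, Pi.neg_apply, neg_smul, one_smul, ← sub_eq_add_neg]
  have := parallelogram_law_with_norm ℝ (weakGrad u x) (weakGrad v x)
  nlinarith [sq_nonneg ‖weakGrad u x + weakGrad v x‖]

lemma wSq_sub_le {lam : ℝ} (hlam : 1 ≤ lam) {u v : Plane → ℝ} (hu : MemW lam u)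
    (hv : MemW lam v) : wSq lam (fun x => u x - v x) ≤ 2 * wSq lam u + 2 * wSq lam v := by
  have h1 := gradSq_sub_le hu.1 hv.1
  have h2 : massSq (fun x => u x - v x) ≤ 2 * massSq u + 2 * massSq v := by
    have i1 := hu.1.1.integrable_sq.const_mul 2
    have i2 := hv.1.1.integrable_sq.const_mul 2
    have e : 2 * massSq u + 2 * massSq v = ∫ x, (2 * u x ^ 2 + 2 * v x ^ 2) := by
      rw [integral_add i1 i2, integral_const_mul, integral_const_mul]
      rfl
    rw [e]
    refine integral_mono (hu.sub hv).1.1.integrable_sq (i1.add i2) fun x => ?_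
    simp only
    nlinarith [sq_nonneg (u x + v x)]
  have h3 : logSq lam (fun x => u x - v x) ≤ 2 * logSq lam u + 2 * logSq lam v := by
    have i1 := hu.2.const_mul 2
    have i2 := hv.2.const_mul 2
    have e : 2 * logSq lam u + 2 * logSq lam v =
        ∫ x, (2 * (Real.log (lam + ‖x‖) * u x ^ 2) + 2 * (Real.log (lam + ‖x‖) * v x ^ 2)) := by
      rw [integral_add i1 i2, integral_const_mul, integral_const_mul]
      rfl
    rw [e]
    refine integral_mono (hu.sub hv).2 (i1.add i2) fun x => ?_
    simp only
    have := mul_le_mul_of_nonneg_left (by nlinarith [sq_nonneg (u x + v x)] :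
      (u x - v x) ^ 2 ≤ 2 * u x ^ 2 + 2 * v x ^ 2) (logWeight_nonneg hlam x)
    linarith
  unfold wSq
  linarith

lemma wSq_nonneg {lam : ℝ} (hlam : 1 ≤ lam) (u : Plane → ℝ) : 0 ≤ wSq lam u :=
  add_nonneg (add_nonneg (gradSq_nonneg _) (massSq_nonneg _)) (logSq_nonneg hlam _)

lemma massSq_le_wSq {lam : ℝ} (hlam : 1 ≤ lam) (u : Plane → ℝ) : massSq u ≤ wSq lam u := by
  have h1 := gradSq_nonneg u
  have h2 := logSq_nonneg hlam u
  unfold wSq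
  linarith

lemma gradSq_le_wSq {lam : ℝ} (hlam : 1 ≤ lam) (u : Plane → ℝ) : gradSq u ≤ wSq lam u := by
  have h1 := massSq_nonneg u
  have h2 := logSq_nonneg hlam u
  unfold wSq
  linarith

lemma logSq_le_wSq {lam : ℝ} (u : Plane → ℝ) : logSq lam u ≤ wSq lam u := by
  have h1 := massSq_nonneg u
  have h2 := gradSq_nonneg u
  unfold wSq
  linarith

lemma mollify_eq_integral (η : ContDiffBump (0 : Plane)) (u : Plane → ℝ) (x : Plane) :
    mollify η u x = ∫ y, η.normed volume (x - y) * u y := by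
  rw [mollify_apply, ← integral_sub_left_eq_self _ _ x]
  simp

lemma memLp_bump (η : ContDiffBump (0 : Plane)) : MemLp (η.normed volume) 2 volume :=
  (η.continuous_normed (μ := volume)).memLp_of_hasCompactSupport
    (η.hasCompactSupport_normed (μ := volume))

/-- For a fixed bump, mollification at a point is a pairing with an `L²` function. Weak convergence
thus gives pointwise convergence, Cauchy–Schwarz a uniform bound, and dominated convergence applies
on a ball. -/
lemma tendsto_setIntegral_mollify_sq (η : ContDiffBump (0 : Plane)) {w : ℕ → Plane → ℝ} {K R : ℝ}
    (hw : ∀ n, MemLp (w n) 2 volume) (hK : ∀ n, massSq (w n) ≤ K)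
    (hweak : L2WeakTendsto w fun _ => 0) :
    Tendsto (fun n => ∫ x in Metric.ball (0 : Plane) R, mollify η (w n) x ^ 2) atTop (𝓝 0) := by
  have hfin : IsFiniteMeasure (volume.restrict (Metric.ball (0 : Plane) R)) :=
    ⟨by
      rw [Measure.restrict_apply_univ]
      exact measure_ball_lt_top⟩
  have hb : ∀ n x, |mollify η (w n) x| ≤ √(∫ y, η.normed volume y ^ 2) * √K := fun n x => by
    rw [mollify_eq_integral]
    refine (integral_mul_comp_sub_le (memLp_bump η) (hw n) x).trans ?_
    gcongr
    exact hK n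
  have h0 : ∀ x, Tendsto (fun n => mollify η (w n) x ^ 2) atTop (𝓝 0) := fun x => by
    have hx : MemLp (fun y => η.normed volume (x - y)) 2 volume :=
      (memLp_bump η).comp_measurePreserving (Measure.measurePreserving_sub_left volume x)
    have := hweak.tendsto_mul hx
    simp only [zero_mul, integral_zero] at this
    have h2 := this.pow 2
    simp only [mollify_eq_integral, mul_comm (η.normed volume _)]
    simpa using h2
  have := tendsto_integral_of_dominated_convergence
    (μ := volume.restrict (Metric.ball (0 : Plane) R))
    (F := fun n x => mollify η (w n) x ^ 2) (f := fun _ => 0)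
    (fun _ => (√(∫ y, η.normed volume y ^ 2) * √K) ^ 2)
    (fun n => (((memLp_mollify η (hw n)).1.1.pow 2)).restrict) (integrable_const _)
    (fun n => Eventually.of_forall fun x => by
      rw [Real.norm_eq_abs, abs_pow]
      exact pow_le_pow_left₀ (abs_nonneg _) (hb n x) 2)
    (Eventually.of_forall h0)
  simpa using this

/-- Outside a large ball the logarithmic weight makes the mass small. Inside, `w` is replaced by its
mollification with an error controlled by the gradient, and the mollified part tends to `0` on the
ball. The radii are chosen so that each of the three contributions is at most `ε / 4`, after the
factors `2` from squaring. -/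
lemma tendsto_massSq_of_weak_zero {lam : ℝ} (hlam : 1 < lam) {w : ℕ → Plane → ℝ} {K : ℝ}
    (hw : ∀ n, MemW lam (w n)) (hK : ∀ n, wSq lam (w n) ≤ K)
    (hweak : L2WeakTendsto w fun _ => 0) : Tendsto (fun n => massSq (w n)) atTop (𝓝 0) := by
  have hK0 : 0 ≤ K := (wSq_nonneg hlam.le _).trans (hK 0)
  refine Metric.tendsto_atTop.2 fun ε hε => ?_
  -- the tail radius
  set R : ℝ := Real.exp (4 * (K + 1) / ε) with hR
  have hR0 : 0 < R := Real.exp_pos _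
  have hlogR : 4 * (K + 1) / ε ≤ Real.log (lam + R) := by
    rw [Real.le_log_iff_exp_le (by positivity)]
    linarith
  have hlog0 : 0 < Real.log (lam + R) := lt_of_lt_of_le (by positivity) hlogR
  have htail : (Real.log (lam + R))⁻¹ * K ≤ ε / 4 := by
    rw [inv_mul_le_iff₀ hlog0]
    have := mul_le_mul_of_nonneg_right hlogR (by positivity : 0 ≤ ε / 4)
    have e : 4 * (K + 1) / ε * (ε / 4) = K + 1 := by field_simp
    linarith
  -- the mollification radius
  set r : ℝ := √(ε / (16 * (K + 1))) with hr
  have hr0 : 0 < r := Real.sqrt_pos.2 (by positivity)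
  let η : ContDiffBump (0 : Plane) := ⟨r / 2, r, by positivity, by linarith⟩
  have hmol : ∀ n, ∫ x, (mollify η (w n) x - w n x) ^ 2 ≤ ε / 8 := fun n => by
    refine (integral_mollify_sub_sq_le η (hw n).1).trans ?_
    have h1 : gradSq (w n) ≤ K + 1 := (gradSq_le_wSq hlam.le _).trans (by linarith [hK n])
    have h2 : η.rOut ^ 2 = ε / (16 * (K + 1)) := Real.sq_sqrt (by positivity)
    rw [h2]
    refine (mul_le_mul_of_nonneg_left h1 (by positivity)).trans_eq ?_
    field_simp
    norm_num
  have hm := tendsto_setIntegral_mollify_sq η (R := R) (fun n => (hw n).1.1)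
    (fun n => (massSq_le_wSq hlam.le _).trans (hK n)) hweak
  obtain ⟨N, hN⟩ := (hm.eventually (gt_mem_nhds (by positivity : (0 : ℝ) < ε / 8))).exists_forall_of_atTop
  refine ⟨N, fun n hn => ?_⟩
  rw [Real.dist_0_eq_abs, abs_of_nonneg (massSq_nonneg _)]
  have hmn := (memLp_mollify η (hw n).1.1).1
  have i1 : Integrable ((Metric.ball (0 : Plane) R).indicator fun x => mollify η (w n) x ^ 2) :=
    hmn.integrable_sq.indicator measurableSet_ball
  have i2 := (hmn.sub (hw n).1.1).integrable_sq
  have i3 := (hw n).2.const_mul (Real.log (lam + R))⁻¹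
  simp only [Pi.sub_apply] at i2
  have hle : massSq (w n) ≤ ∫ x, ((2 * (Metric.ball (0 : Plane) R).indicator
      (fun x => mollify η (w n) x ^ 2) x + 2 * (mollify η (w n) x - w n x) ^ 2) +
        (Real.log (lam + R))⁻¹ * (Real.log (lam + ‖x‖) * w n x ^ 2)) := by
    refine integral_mono (hw n).1.1.integrable_sq
      (((i1.const_mul 2).add (i2.const_mul 2)).add i3) fun x => ?_
    simp only
    have h3 : 0 ≤ (Real.log (lam + R))⁻¹ * (Real.log (lam + ‖x‖) * w n x ^ 2) :=
      mul_nonneg (inv_nonneg.2 hlog0.le) (mul_nonneg (logWeight_nonneg hlam.le x) (sq_nonneg _))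
    by_cases hx : x ∈ Metric.ball (0 : Plane) R
    · rw [indicator_of_mem hx]
      nlinarith [sq_nonneg (mollify η (w n) x + (mollify η (w n) x - w n x))]
    · rw [indicator_of_notMem hx]
      rw [mem_ball_zero_iff, not_lt] at hx
      have h4 : Real.log (lam + R) ≤ Real.log (lam + ‖x‖) :=
        Real.log_le_log (by positivity) (by linarith)
      have h5 : w n x ^ 2 ≤ (Real.log (lam + R))⁻¹ * (Real.log (lam + ‖x‖) * w n x ^ 2) := by
        rw [← mul_assoc]
        refine le_mul_of_one_le_left (sq_nonneg _) ?_
        rw [inv_mul_eq_div, one_le_div hlog0]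
        exact h4
      nlinarith [sq_nonneg (mollify η (w n) x - w n x)]
  have e12 : Integrable fun x => 2 * (Metric.ball (0 : Plane) R).indicator
      (fun x => mollify η (w n) x ^ 2) x + 2 * (mollify η (w n) x - w n x) ^ 2 :=
    (i1.const_mul 2).add (i2.const_mul 2)
  rw [integral_add e12 i3, integral_add (i1.const_mul 2) (i2.const_mul 2), integral_const_mul,
    integral_const_mul, integral_const_mul, integral_indicator measurableSet_ball] at hle
  have h1 := hN n hn
  have h2 := hmol n
  have h3 : (Real.log (lam + R))⁻¹ * (∫ x, Real.log (lam + ‖x‖) * w n x ^ 2) ≤ ε / 4 :=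
    (mul_le_mul_of_nonneg_left ((logSq_le_wSq (w n)).trans (hK n))
      (inv_nonneg.2 hlog0.le)).trans htail
  linarith

lemma tendsto_eLpNorm_of_massSq {w : ℕ → Plane → ℝ} (hw : ∀ n, MemLp (w n) 2 volume)
    (h : Tendsto (fun n => massSq (w n)) atTop (𝓝 0)) :
    Tendsto (fun n => eLpNorm (w n) 2 volume) atTop (𝓝 0) := by
  have e : ∀ n, eLpNorm (w n) 2 volume = ENNReal.ofReal √(massSq (w n)) := by
    intro n
    have h1 := norm_toLp_sq (hw n)
    simp only [Real.norm_eq_abs, sq_abs] at h1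
    have h2 : ‖(hw n).toLp‖ = √(massSq (w n)) := by
      rw [massSq, ← h1, Real.sqrt_sq (norm_nonneg _)]
    rw [← h2, Lp.norm_toLp, ENNReal.ofReal_toReal (hw n).2.ne]
  simp_rw [e]
  have := ENNReal.continuous_ofReal.tendsto _ |>.comp ((Real.continuous_sqrt.tendsto _).comp h)
  rw [Real.sqrt_zero, ENNReal.ofReal_zero] at this
  exact this

/-- Compactness of the embedding of `W^λ` into `L²`. -/
lemma exists_strong_subseq {lam : ℝ} (hlam : 1 < lam) {u : ℕ → Plane → ℝ} {K : ℝ}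
    (hu : ∀ n, MemW lam (u n)) (hK : ∀ n, wSq lam (u n) ≤ K) :
    ∃ (k : ℕ → ℕ) (a : Plane → ℝ) (G : ℝ), StrictMono k ∧ MemW lam a ∧
      Tendsto (fun n => massSq fun x => u (k n) x - a x) atTop (𝓝 0) ∧
      (∀ᵐ x, Tendsto (fun n => u (k n) x) atTop (𝓝 (a x))) ∧
      Tendsto (fun n => gradSq (u (k n))) atTop (𝓝 G) ∧ gradSq a ≤ G := by
  obtain ⟨k₁, a, hk₁, ha, hweak⟩ := exists_wWeakTendsto hlam hu hK
  have hw : ∀ n, MemW lam fun x => u (k₁ n) x - a x := fun n => (hu _).sub ha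
  have h0 : L2WeakTendsto (fun n x => u (k₁ n) x - a x) fun _ => (0 : ℝ) := by
    intro φ hφ
    have h1 := hweak.fn φ hφ
    have h2 : ∀ n, ∫ x, inner ℝ (u (k₁ n) x - a x) (φ x) =
        (∫ x, inner ℝ (u (k₁ n) x) (φ x)) - ∫ x, inner ℝ (a x) (φ x) := by
      intro n
      have i1 : Integrable fun x => inner ℝ (u (k₁ n) x) (φ x) := (hu (k₁ n)).1.1.integrable_mul hφ |>.congr
        (Eventually.of_forall fun x => by simp [mul_comm])
      have i2 : Integrable fun x => inner ℝ (a x) (φ x) := ha.1.1.integrable_mul hφ |>.congr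
        (Eventually.of_forall fun x => by simp [mul_comm])
      rw [← integral_sub i1 i2]
      simp_rw [inner_sub_left]
    simp_rw [h2]
    simpa using h1.sub_const (∫ x, inner ℝ (a x) (φ x))
  have hmass := tendsto_massSq_of_weak_zero hlam hw (K := 2 * K + 2 * wSq lam a)
    (fun n => (wSq_sub_le hlam.le (hu _) ha).trans (by linarith [hK (k₁ n)])) h0
  obtain ⟨k₂, hk₂, hae⟩ := (tendstoInMeasure_of_tendsto_eLpNorm (by norm_num)
    (fun n => (hu (k₁ n)).1.1.1) ha.1.1.1
    (tendsto_eLpNorm_of_massSq (fun n => (hw n).1.1) hmass)).exists_seq_tendsto_ae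
  obtain ⟨G, -, k₃, hk₃, hG⟩ := (isCompact_Icc (a := (0 : ℝ)) (b := K)).tendsto_subseq
    (x := fun n => gradSq (u (k₁ (k₂ n))))
    fun n => ⟨gradSq_nonneg _, (gradSq_le_wSq hlam.le _).trans (hK _)⟩
  refine ⟨fun n => k₁ (k₂ (k₃ n)), a, G, (hk₁.comp hk₂).comp hk₃, ha,
    hmass.comp (hk₂.comp hk₃).tendsto_atTop, ?_, hG, ?_⟩
  · filter_upwards [hae] with x hx
    exact hx.comp hk₃.tendsto_atTop
  · exact gradSq_le_of_weak (fun n => (hu _).1) ha.1 ((hweak.grad.comp hk₂).comp hk₃) hG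

/-! ### Continuity of the power term -/

/-- For `t ≤ s`, Bernoulli's inequality at `t / s` is the tangent line bound `s^q - t^q ≤ q (s - t)
s^(q-1)`; the second power only makes the estimate symmetric. -/
lemma abs_rpow_sub_rpow_le {s t q : ℝ} (hs : 0 ≤ s) (ht : 0 ≤ t) (hq : 1 < q) :
    |s ^ q - t ^ q| ≤ q * (|s - t| * (s ^ (q - 1) + t ^ (q - 1))) := by
  wlog hst : t ≤ s generalizing s t
  · rw [abs_sub_comm, abs_sub_comm s t, add_comm]
    exact this ht hs (le_of_not_ge hst)
  have h1 : t ^ q ≤ s ^ q := Real.rpow_le_rpow ht hst (by linarith)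
  rw [abs_of_nonneg (by linarith), abs_of_nonneg (by linarith)]
  have h2 : 0 ≤ q * ((s - t) * t ^ (q - 1)) := by
    have : 0 ≤ s - t := by linarith
    positivity
  rcases hs.eq_or_lt with rfl | hs0
  · have : t = 0 := le_antisymm hst ht
    subst this
    simp
  have h3 := one_add_mul_self_le_rpow_one_add (s := t / s - 1)
    (by linarith [div_nonneg ht hs]) (p := q) hq.le
  rw [add_sub_cancel, Real.div_rpow ht hs, le_div_iff₀ (by positivity)] at h3
  have h4 : s ^ q = s ^ (q - 1) * s := by
    rw [← Real.rpow_add_one hs0.ne']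
    ring_nf
  have h5 : (1 + q * (t / s - 1)) * s ^ q = s ^ q - q * ((s - t) * s ^ (q - 1)) := by
    rw [h4]
    field_simp
    ring
  linarith

/-- Cauchy–Schwarz with one factor tending to `0` in `L²` and the other bounded there; all three
parts of the power term are treated this way. -/
lemma tendsto_integral_of_abs_sub_le {F D S : ℕ → Plane → ℝ} {G : Plane → ℝ} {c C : ℝ}
    (hF : ∀ n, Integrable (F n)) (hG : Integrable G) (hD : ∀ n, MemLp (D n) 2 volume)
    (hS : ∀ n, MemLp (S n) 2 volume) (hc : 0 ≤ c)
    (hle : ∀ n x, |F n x - G x| ≤ c * (D n x * S n x))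
    (hD0 : Tendsto (fun n => ∫ x, D n x ^ 2) atTop (𝓝 0)) (hSC : ∀ n, ∫ x, S n x ^ 2 ≤ C) :
    Tendsto (fun n => ∫ x, F n x) atTop (𝓝 (∫ x, G x)) := by
  rw [tendsto_iff_norm_sub_tendsto_zero]
  have hlim : Tendsto (fun n => c * (√(∫ x, D n x ^ 2) * √C)) atTop (𝓝 0) := by
    have := (((Real.continuous_sqrt.tendsto _).comp hD0).mul_const √C).const_mul c
    rw [Real.sqrt_zero, zero_mul, mul_zero] at this
    exact this
  refine squeeze_zero (fun n => norm_nonneg _) (fun n => ?_) hlim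
  have hi : Integrable fun x => D n x * S n x := (hD n).integrable_mul (hS n)
  rw [← integral_sub (hF n) hG]
  refine (norm_integral_le_of_norm_le (hi.const_mul c) (Eventually.of_forall (hle n))).trans ?_
  rw [integral_const_mul]
  refine mul_le_mul_of_nonneg_left ?_ hc
  refine (le_abs_self _).trans ((abs_integral_mul_le (hD n) (hS n)).trans ?_)
  gcongr
  exact hSC n

lemma rpow_mul_rpow_le {s t a b : ℝ} (hs : 0 ≤ s) (ht : 0 ≤ t) (ha : 0 ≤ a) (hb : 0 ≤ b) :
    s ^ a * t ^ b ≤ s ^ (a + b) + t ^ (a + b) := by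
  rcases le_total s t with h | h
  · have h1 : s ^ a * t ^ b ≤ t ^ a * t ^ b := by gcongr
    rw [← Real.rpow_add_of_nonneg ht ha hb] at h1
    linarith [Real.rpow_nonneg hs (a + b)]
  · have h1 : s ^ a * t ^ b ≤ s ^ a * s ^ b := by gcongr
    rw [← Real.rpow_add_of_nonneg hs ha hb] at h1
    linarith [Real.rpow_nonneg ht (a + b)]

/-- The two variables are changed one at a time. Mixed powers of total degree `2p - 1` are then
bounded by pure ones, so the same majorant serves for the coupling and the pure powers. -/
lemma abs_coupling_sub_le {p : ℝ} (hp : 2 ≤ p) (s t a b : ℝ) :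
    |(|s * t| ^ p - |a * b| ^ p)| ≤ 2 * p * ((|s - a| + |t - b|) *
      (|s| ^ (2 * p - 1) + |t| ^ (2 * p - 1) + (|a| ^ (2 * p - 1) + |b| ^ (2 * p - 1)))) := by
  have hp0 : 0 ≤ p := by linarith
  have e1 : |s * t| ^ p = |s| ^ p * |t| ^ p := by
    rw [abs_mul, Real.mul_rpow (abs_nonneg _) (abs_nonneg _)]
  have e2 : |a * b| ^ p = |a| ^ p * |b| ^ p := by
    rw [abs_mul, Real.mul_rpow (abs_nonneg _) (abs_nonneg _)]
  have e3 : p - 1 + p = 2 * p - 1 := by ring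
  have key : ∀ x y z : ℝ, |(|x| ^ p - |y| ^ p)| * |z| ^ p ≤ p * (|x - y| *
      (|x| ^ (2 * p - 1) + |y| ^ (2 * p - 1) + 2 * |z| ^ (2 * p - 1))) := by
    intro x y z
    have h1 := abs_rpow_sub_rpow_le (abs_nonneg x) (abs_nonneg y) (by linarith : 1 < p)
    have h2 := rpow_mul_rpow_le (abs_nonneg x) (abs_nonneg z) (by linarith : 0 ≤ p - 1) hp0
    have h3 := rpow_mul_rpow_le (abs_nonneg y) (abs_nonneg z) (by linarith : 0 ≤ p - 1) hp0
    rw [e3] at h2 h3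
    calc |(|x| ^ p - |y| ^ p)| * |z| ^ p
        ≤ p * (|(|x| - |y|)| * (|x| ^ (p - 1) + |y| ^ (p - 1))) * |z| ^ p := by gcongr
      _ = p * (|(|x| - |y|)| * (|x| ^ (p - 1) * |z| ^ p + |y| ^ (p - 1) * |z| ^ p)) := by ring
      _ ≤ p * (|x - y| * (|x| ^ (2 * p - 1) + |y| ^ (2 * p - 1) + 2 * |z| ^ (2 * p - 1))) := by
          refine mul_le_mul_of_nonneg_left (mul_le_mul (abs_abs_sub_abs_le x y) (by linarith)
            (by positivity) (abs_nonneg _)) hp0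
  have h1 := key s a t
  have h2 := key t b a
  have h3 : |(|s * t| ^ p - |a * b| ^ p)| ≤
      |(|s| ^ p - |a| ^ p)| * |t| ^ p + |(|t| ^ p - |b| ^ p)| * |a| ^ p := by
    rw [e1, e2]
    have : |s| ^ p * |t| ^ p - |a| ^ p * |b| ^ p =
        (|s| ^ p - |a| ^ p) * |t| ^ p + (|t| ^ p - |b| ^ p) * |a| ^ p := by ring
    rw [this]
    refine (abs_add_le _ _).trans_eq ?_
    rw [abs_mul, abs_mul, abs_of_nonneg (by positivity : 0 ≤ |t| ^ p),
      abs_of_nonneg (by positivity : 0 ≤ |a| ^ p)]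
  have n1 : 0 ≤ p * |s - a| := by positivity
  have n2 : 0 ≤ p * |t - b| := by positivity
  have m1 : 0 ≤ |s| ^ (2 * p - 1) := by positivity
  have m2 : 0 ≤ |t| ^ (2 * p - 1) := by positivity
  have m3 : 0 ≤ |a| ^ (2 * p - 1) := by positivity
  have m4 : 0 ≤ |b| ^ (2 * p - 1) := by positivity
  nlinarith [mul_nonneg n1 m1, mul_nonneg n1 m2, mul_nonneg n1 m3, mul_nonneg n1 m4,
    mul_nonneg n2 m1, mul_nonneg n2 m2, mul_nonneg n2 m3, mul_nonneg n2 m4]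

lemma MemH1.memLp_rpow {u : Plane → ℝ} (hu : MemH1 u) {q : ℝ} (hq : 1 ≤ q) :
    MemLp (fun x => |u x| ^ q) 2 volume := by
  rw [memLp_two_iff_integrable_sq (aestronglyMeasurable_abs_rpow hu.1.1 q)]
  have e : ∀ x, (|u x| ^ q) ^ 2 = |u x| ^ (q * 2) := fun x => by
    rw [Real.rpow_mul (abs_nonneg _), Real.rpow_two]
  simp_rw [e]
  exact hu.integrable_rpow (by linarith)

lemma exists_integral_rpow_bound {q : ℝ} (hq : 4 ≤ q) (K : ℝ) : ∃ C : ℝ, 0 ≤ C ∧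
    ∀ u : Plane → ℝ, MemH1 u → massSq u ≤ K → gradSq u ≤ K → ∫ x, |u x| ^ q ≤ C := by
  obtain ⟨C, k, hC, h⟩ := exists_integral_rpow_le hq
  refine ⟨C * (|K| * (|K| + |K| ^ (k + 1))), by positivity, fun u hu hM hG => (h u hu).trans ?_⟩
  have h1 := massSq_nonneg u
  have h2 := gradSq_nonneg u
  have h3 := le_abs_self K
  have h4 : massSq u ≤ |K| := hM.trans h3
  have h5 : gradSq u ≤ |K| := hG.trans h3
  gcongr

lemma tendsto_powerTerm {p : ℝ} (hp : 2 ≤ p) {β : ℕ → ℝ} {β₀ : ℝ} (hβ : Tendsto β atTop (𝓝 β₀))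
    {u v : ℕ → Plane → ℝ} {a b : Plane → ℝ} {K : ℝ} (hu : ∀ n, MemH1 (u n))
    (hv : ∀ n, MemH1 (v n)) (ha : MemH1 a) (hb : MemH1 b)
    (huK : ∀ n, massSq (u n) ≤ K ∧ gradSq (u n) ≤ K)
    (hvK : ∀ n, massSq (v n) ≤ K ∧ gradSq (v n) ≤ K)
    (hua : Tendsto (fun n => massSq fun x => u n x - a x) atTop (𝓝 0))
    (hvb : Tendsto (fun n => massSq fun x => v n x - b x) atTop (𝓝 0)) :
    Tendsto (fun n => powerTerm p (β n) (u n) (v n)) atTop (𝓝 (powerTerm p β₀ a b)) := by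
  have hq : 1 ≤ 2 * p - 1 := by linarith
  -- The exponent is that of the squared majorant `S`; it is at least `6`, so the
  -- Gagliardo–Nirenberg bound for `q ≥ 4` applies.
  obtain ⟨C, hC, hCb⟩ := exists_integral_rpow_bound (q := (2 * p - 1) * 2) (by linarith)
    (max K (max (max (massSq a) (gradSq a)) (max (massSq b) (gradSq b))))
  let D : ℕ → Plane → ℝ := fun n x => |u n x - a x| + |v n x - b x|
  let S : ℕ → Plane → ℝ := fun n x => |u n x| ^ (2 * p - 1) + |v n x| ^ (2 * p - 1) +
    (|a x| ^ (2 * p - 1) + |b x| ^ (2 * p - 1))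
  have hdu : ∀ n, MemLp (fun x => u n x - a x) 2 volume := fun n => (hu n).1.sub ha.1
  have hdv : ∀ n, MemLp (fun x => v n x - b x) 2 volume := fun n => (hv n).1.sub hb.1
  have hD : ∀ n, MemLp (D n) 2 volume := fun n => (hdu n).norm.add (hdv n).norm
  have hS : ∀ n, MemLp (S n) 2 volume := fun n =>
    (((hu n).memLp_rpow hq).add ((hv n).memLp_rpow hq)).add
      ((ha.memLp_rpow hq).add (hb.memLp_rpow hq))
  have hD0 : Tendsto (fun n => ∫ x, D n x ^ 2) atTop (𝓝 0) := by
    have hlim : Tendsto (fun n => 2 * (massSq fun x => u n x - a x) +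
        2 * massSq fun x => v n x - b x) atTop (𝓝 0) := by
      simpa using (hua.const_mul 2).add (hvb.const_mul 2)
    refine squeeze_zero (fun n => integral_nonneg fun x => sq_nonneg _) (fun n => ?_) hlim
    have i1 := (hdu n).integrable_sq.const_mul 2
    have i2 := (hdv n).integrable_sq.const_mul 2
    have e : 2 * (massSq fun x => u n x - a x) + 2 * (massSq fun x => v n x - b x) =
        ∫ x, (2 * (u n x - a x) ^ 2 + 2 * (v n x - b x) ^ 2) := by
      rw [integral_add i1 i2, integral_const_mul, integral_const_mul]
      rfl
    rw [e]
    refine integral_mono (hD n).integrable_sq (i1.add i2) fun x => ?_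
    simp only [D]
    rw [← sq_abs (u n x - a x), ← sq_abs (v n x - b x)]
    nlinarith [sq_nonneg (|u n x - a x| - |v n x - b x|)]
  have hSC : ∀ n, ∫ x, S n x ^ 2 ≤ 16 * C := by
    intro n
    have e : ∀ (w : Plane → ℝ) (x : Plane), (|w x| ^ (2 * p - 1)) ^ 2 = |w x| ^ ((2 * p - 1) * 2) :=
      fun w x => by rw [Real.rpow_mul (abs_nonneg _), Real.rpow_two]
    have i : ∀ w : Plane → ℝ, MemH1 w → Integrable fun x => |w x| ^ ((2 * p - 1) * 2) :=
      fun w hw => hw.integrable_rpow (by linarith)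
    have b1 := hCb (u n) (hu n) ((huK n).1.trans (le_max_left _ _))
      ((huK n).2.trans (le_max_left _ _))
    have b2 := hCb (v n) (hv n) ((hvK n).1.trans (le_max_left _ _))
      ((hvK n).2.trans (le_max_left _ _))
    have b3 := hCb a ha (by simp) (by simp)
    have b4 := hCb b hb (by simp) (by simp)
    have i12 := (i _ (hu n)).add (i _ (hv n))
    have i34 := (i _ ha).add (i _ hb)
    have hle : ∫ x, S n x ^ 2 ≤ ∫ x, 4 * ((|u n x| ^ ((2 * p - 1) * 2) +
        |v n x| ^ ((2 * p - 1) * 2)) + (|a x| ^ ((2 * p - 1) * 2) +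
          |b x| ^ ((2 * p - 1) * 2))) := by
      refine integral_mono (hS n).integrable_sq ((i12.add i34).const_mul 4) fun x => ?_
      simp only [S, ← e]
      set A := |u n x| ^ (2 * p - 1)
      set B := |v n x| ^ (2 * p - 1)
      set A' := |a x| ^ (2 * p - 1)
      set B' := |b x| ^ (2 * p - 1)
      nlinarith [sq_nonneg (A - B), sq_nonneg (A' - B'), sq_nonneg (A + B - (A' + B'))]
    have j12 : Integrable fun x => |u n x| ^ ((2 * p - 1) * 2) + |v n x| ^ ((2 * p - 1) * 2) := i12
    have j34 : Integrable fun x => |a x| ^ ((2 * p - 1) * 2) + |b x| ^ ((2 * p - 1) * 2) := i34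
    rw [integral_const_mul, integral_add j12 j34, integral_add (i _ (hu n)) (i _ (hv n)),
      integral_add (i _ ha) (i _ hb)] at hle
    linarith
  have hpow : ∀ s t : ℝ, |(|s| ^ (2 * p) - |t| ^ (2 * p))| ≤
      2 * p * (|s - t| * (|s| ^ (2 * p - 1) + |t| ^ (2 * p - 1))) := fun s t => by
    refine (abs_rpow_sub_rpow_le (abs_nonneg s) (abs_nonneg t) (by linarith)).trans ?_
    have := abs_abs_sub_abs_le s t
    gcongr
  have hp2 : 0 ≤ 2 * p := by linarith
  have t1 : Tendsto (fun n => ∫ x, |u n x| ^ (2 * p)) atTop (𝓝 (∫ x, |a x| ^ (2 * p))) := by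
    refine tendsto_integral_of_abs_sub_le (fun n => (hu n).integrable_rpow (by linarith))
      (ha.integrable_rpow (by linarith)) hD hS hp2 (fun n x => (hpow _ _).trans ?_) hD0 hSC
    have q1 : |u n x - a x| ≤ D n x := le_add_of_nonneg_right (abs_nonneg _)
    have q2 : |u n x| ^ (2 * p - 1) + |a x| ^ (2 * p - 1) ≤ S n x := by
      have m2 : 0 ≤ |v n x| ^ (2 * p - 1) := by positivity
      have m4 : 0 ≤ |b x| ^ (2 * p - 1) := by positivity
      simp only [S]
      linarith
    gcongr
  have t2 : Tendsto (fun n => ∫ x, |v n x| ^ (2 * p)) atTop (𝓝 (∫ x, |b x| ^ (2 * p))) := by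
    refine tendsto_integral_of_abs_sub_le (fun n => (hv n).integrable_rpow (by linarith))
      (hb.integrable_rpow (by linarith)) hD hS hp2 (fun n x => (hpow _ _).trans ?_) hD0 hSC
    have q1 : |v n x - b x| ≤ D n x := le_add_of_nonneg_left (abs_nonneg _)
    have q2 : |v n x| ^ (2 * p - 1) + |b x| ^ (2 * p - 1) ≤ S n x := by
      have m2 : 0 ≤ |u n x| ^ (2 * p - 1) := by positivity
      have m4 : 0 ≤ |a x| ^ (2 * p - 1) := by positivity
      simp only [S]
      linarith
    gcongr
  have t3 : Tendsto (fun n => ∫ x, |u n x * v n x| ^ p) atTop (𝓝 (∫ x, |a x * b x| ^ p)) :=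
    tendsto_integral_of_abs_sub_le (fun n => integrable_abs_mul_rpow (by linarith) (hu n) (hv n))
      (integrable_abs_mul_rpow (by linarith) ha hb) hD hS hp2
      (fun n x => abs_coupling_sub_le hp _ _ _ _) hD0 hSC
  exact (t1.add t2).add ((hβ.const_mul 2).mul t3)

/-! ### Continuity of the near part of the logarithmic energy -/

lemma integral_abs_sq_sub_sq_le {u a : Plane → ℝ} (hu : MemLp u 2 volume) (ha : MemLp a 2 volume) :
    ∫ x, |u x ^ 2 - a x ^ 2| ≤
      √(massSq fun x => u x - a x) * √(2 * massSq u + 2 * massSq a) := by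
  have h := abs_integral_mul_le (hu.sub ha).norm (hu.add ha).norm
  have e : ∀ x, |u x - a x| * |u x + a x| = |u x ^ 2 - a x ^ 2| := fun x => by
    rw [← abs_mul]
    congr 1
    ring
  simp only [Pi.sub_apply, Pi.add_apply, Real.norm_eq_abs, e, sq_abs] at h
  refine (le_abs_self _).trans (h.trans ?_)
  refine mul_le_mul_of_nonneg_left (Real.sqrt_le_sqrt ?_) (Real.sqrt_nonneg _)
  have i1 := hu.integrable_sq.const_mul 2
  have i2 := ha.integrable_sq.const_mul 2
  have e2 : 2 * massSq u + 2 * massSq a = ∫ x, (2 * u x ^ 2 + 2 * a x ^ 2) := by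
    rw [integral_add i1 i2, integral_const_mul, integral_const_mul]
    rfl
  rw [e2]
  refine integral_mono (hu.add ha).integrable_sq (i1.add i2) fun x => ?_
  simp only
  nlinarith [sq_nonneg (u x - a x)]

lemma tendsto_integral_abs_density_sub {u v : ℕ → Plane → ℝ} {a b : Plane → ℝ} {K : ℝ}
    (hu : ∀ n, MemLp (u n) 2 volume) (hv : ∀ n, MemLp (v n) 2 volume) (ha : MemLp a 2 volume)
    (hb : MemLp b 2 volume) (huK : ∀ n, massSq (u n) ≤ K) (hvK : ∀ n, massSq (v n) ≤ K)
    (hua : Tendsto (fun n => massSq fun x => u n x - a x) atTop (𝓝 0))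
    (hvb : Tendsto (fun n => massSq fun x => v n x - b x) atTop (𝓝 0)) :
    Tendsto (fun n => ∫ x, |density (u n) (v n) x - density a b x|) atTop (𝓝 0) := by
  have hlim : Tendsto (fun n => √(massSq fun x => u n x - a x) * √(2 * K + 2 * massSq a) +
      √(massSq fun x => v n x - b x) * √(2 * K + 2 * massSq b)) atTop (𝓝 0) := by
    have := (((Real.continuous_sqrt.tendsto _).comp hua).mul_const √(2 * K + 2 * massSq a)).add
      (((Real.continuous_sqrt.tendsto _).comp hvb).mul_const √(2 * K + 2 * massSq b))
    rw [Real.sqrt_zero, zero_mul, zero_mul, zero_add] at this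
    exact this
  refine squeeze_zero (fun n => integral_nonneg fun x => abs_nonneg _) (fun n => ?_) hlim
  have i1 : Integrable fun x => |u n x ^ 2 - a x ^ 2| :=
    ((hu n).integrable_sq.sub ha.integrable_sq).abs
  have i2 : Integrable fun x => |v n x ^ 2 - b x ^ 2| :=
    ((hv n).integrable_sq.sub hb.integrable_sq).abs
  have i3 : Integrable fun x => |density (u n) (v n) x - density a b x| :=
    (((hu n).integrable_sq.add (hv n).integrable_sq).sub
      (ha.integrable_sq.add hb.integrable_sq)).abs
  have h1 : ∫ x, |density (u n) (v n) x - density a b x| ≤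
      (∫ x, |u n x ^ 2 - a x ^ 2|) + ∫ x, |v n x ^ 2 - b x ^ 2| := by
    rw [← integral_add i1 i2]
    refine integral_mono i3 (i1.add i2) fun x => ?_
    simp only [density]
    rw [add_sub_add_comm]
    exact abs_add_le _ _
  refine h1.trans (add_le_add ((integral_abs_sq_sub_sq_le (hu n) ha).trans ?_)
    ((integral_abs_sq_sub_sq_le (hv n) hb).trans ?_))
  · have := huK n
    gcongr
  · have := hvK n
    gcongr

lemma nearLog_neg (z : Plane) : nearLog (-z) = nearLog z := by
  rw [nearLog, nearLog, norm_neg]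

/-- Symmetry of the form `B` gives `B(f, f) - B(g, g) = B(f, f - g) + B(g, f - g)`. The difference
is placed in the slot where only its `L¹` norm is needed, which is the norm in which densities
converge. -/
lemma abs_kernelForm_near_sub_le {f g : Plane → ℝ} (hf : MemLp f 2 volume)
    (hg : MemLp g 2 volume) (hf1 : Integrable f) (hg1 : Integrable g) :
    |kernelForm nearLog f f - kernelForm nearLog g g| ≤ √(∫ y, nearLog y ^ 2) *
      (√(∫ y, f y ^ 2) + √(∫ y, g y ^ 2)) * ∫ x, |f x - g x| := by
  have hd : Integrable fun x => f x + -1 * g x := hf1.add (hg1.const_mul (-1))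
  have hK1 : KernelIntegrable nearLog f fun x => -1 * g x :=
    kernelIntegrable_near hf (hg1.const_mul (-1))
  have hK2 : KernelIntegrable nearLog g fun x => -1 * g x :=
    kernelIntegrable_near hg (hg1.const_mul (-1))
  have e1 := kernelForm_add_right (kernelIntegrable_near hf hf1) hK1
  have e2 := kernelForm_add_right (kernelIntegrable_near hg hf1) hK2
  rw [kernelForm_const_mul_right] at e1 e2
  rw [kernelForm_comm nearLog_neg g f] at e2
  have e : kernelForm nearLog f f - kernelForm nearLog g g =
      kernelForm nearLog f (fun x => f x + -1 * g x) +
        kernelForm nearLog g (fun x => f x + -1 * g x) := by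
    rw [e1, e2]
    ring
  have h1 := abs_kernelForm_near_le hf hd
  have h2 := abs_kernelForm_near_le hg hd
  have e3 : ∫ x, |f x + -1 * g x| = ∫ x, |f x - g x| :=
    integral_congr_ae (Eventually.of_forall fun x => by
      simp only
      congr 1
      ring)
  rw [e3] at h1 h2
  rw [e]
  refine (abs_add_le _ _).trans ((add_le_add h1 h2).trans_eq ?_)
  ring

/-! ### A priori bounds -/

/-- The far part of the logarithmic energy. -/
noncomputable def farEnergy (u v : Plane → ℝ) : ℝ := kernelForm farLog (density u v) (density u v)

/-- The near part of the logarithmic energy. -/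
noncomputable def nearEnergy (u v : Plane → ℝ) : ℝ := kernelForm nearLog (density u v) (density u v)

lemma logEnergy_eq_far_sub_near {lam : ℝ} (hlam : 1 ≤ lam) {u v : Plane → ℝ} (hu : MemW lam u)
    (hv : MemW lam v) : logEnergy u v = farEnergy u v - nearEnergy u v := by
  rw [logEnergy_eq hlam hu hv, kernelForm_log hlam (hu.logDensity hlam hv) (hu.logDensity hlam hv)]
  rfl

lemma farEnergy_nonneg (u v : Plane → ℝ) : 0 ≤ farEnergy u v :=
  integral_nonneg fun _ => mul_nonneg (mul_nonneg (farLog_nonneg _) (density_nonneg _ _ _))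
    (density_nonneg _ _ _)

lemma exists_integral_density_sq_le : ∃ C : ℝ, 0 < C ∧ ∀ u v : Plane → ℝ, MemH1 u → MemH1 v →
    ∫ x, density u v x ^ 2 ≤ C * (pairMass u v * pairGrad u v) := by
  obtain ⟨C, hC, h⟩ := exists_integral_pow_le 1
  refine ⟨2 * C + 1, by positivity, fun u v hu hv => ?_⟩
  obtain ⟨i1, h1⟩ := h u hu
  obtain ⟨i2, h2⟩ := h v hv
  have hle : ∫ x, density u v x ^ 2 ≤ ∫ x, (2 * u x ^ (2 * (1 + 1)) + 2 * v x ^ (2 * (1 + 1))) := by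
    refine integral_mono_of_nonneg (Eventually.of_forall fun x => sq_nonneg _)
      ((i1.const_mul 2).add (i2.const_mul 2)) (Eventually.of_forall fun x => ?_)
    have e : ∀ r : ℝ, r ^ (2 * (1 + 1)) = (r ^ 2) ^ 2 := fun r => by ring
    simp only [density, e]
    nlinarith [sq_nonneg (u x ^ 2 - v x ^ 2)]
  rw [integral_add (i1.const_mul 2) (i2.const_mul 2), integral_const_mul, integral_const_mul] at hle
  rw [pow_one] at h1 h2
  have m1 := massSq_nonneg u
  have m2 := massSq_nonneg v
  have g1 := gradSq_nonneg u
  have g2 := gradSq_nonneg v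
  have h3 : massSq u * gradSq u + massSq v * gradSq v ≤ pairMass u v * pairGrad u v := by
    unfold pairMass pairGrad
    nlinarith [mul_nonneg m1 g2, mul_nonneg m2 g1]
  have h4 : 0 ≤ pairMass u v * pairGrad u v := mul_nonneg (pairMass_nonneg _ _) (pairGrad_nonneg _ _)
  nlinarith [mul_le_mul_of_nonneg_left h3 hC]

/-- The Cauchy–Schwarz bound is `κ √(C M A) M`. Young's inequality trades it for a fraction of the
gradient small enough to be absorbed by the `2A` in `J_β`, plus a cubic mass term. -/
lemma exists_abs_nearEnergy_le {lam : ℝ} (hlam : 1 ≤ lam) : ∃ C : ℝ, 0 < C ∧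
    ∀ u v : Plane → ℝ, MemW lam u → MemW lam v →
      |nearEnergy u v| ≤ pairGrad u v / 2 + C * pairMass u v ^ 3 := by
  obtain ⟨C, hC, h⟩ := exists_integral_density_sq_le
  set κ := √(∫ y, nearLog y ^ 2) with hκ
  refine ⟨κ ^ 2 * C / 2 + 1, by positivity, fun u v hu hv => ?_⟩
  have hd := hu.logDensity hlam hv
  have h1 := abs_kernelForm_near_le hd.memLp hd.integrable
  simp_rw [abs_of_nonneg (density_nonneg u v _)] at h1
  rw [integral_density hu.1.1 hv.1.1] at h1
  set M := pairMass u v with hM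
  set A := pairGrad u v with hA
  have hM0 : 0 ≤ M := pairMass_nonneg u v
  have hA0 : 0 ≤ A := pairGrad_nonneg u v
  have h2 : √(∫ x, density u v x ^ 2) ≤ √(C * (M * A)) := Real.sqrt_le_sqrt (h u v hu.1 hv.1)
  set s := √(C * (M * A)) with hs
  have hs2 : s ^ 2 = C * (M * A) := Real.sq_sqrt (by positivity)
  have hs0 : 0 ≤ s := Real.sqrt_nonneg _
  have h3 : |nearEnergy u v| ≤ κ * s * M := by
    refine h1.trans ?_
    gcongr
  have h4 : κ * s * M ≤ A / 2 + κ ^ 2 * C / 2 * M ^ 3 := by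
    rcases hM0.eq_or_lt with h0 | h0
    · rw [← h0]
      simp
      positivity
    -- Completing this square is Young's inequality with the weights that produce exactly `A / 2`;
    -- dividing out `2 C M` requires `M > 0`.
    · have h5 : 0 ≤ (s - κ * C * M ^ 2) ^ 2 := sq_nonneg _
      have h6 : 2 * C * M * (κ * s * M) ≤ 2 * C * M * (A / 2 + κ ^ 2 * C / 2 * M ^ 3) := by
        nlinarith
      exact le_of_mul_le_mul_left h6 (by positivity)
  have h7 : 0 ≤ M ^ 3 := by positivity
  calc |nearEnergy u v| ≤ _ := h3.trans h4
    _ ≤ A / 2 + (κ ^ 2 * C / 2 + 1) * M ^ 3 := by linarith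

/-- The quotient of the two coefficients is `(8p - 4) / (2p - 3)`, which decreases in `p` and equals
`12` at `p = 2`. -/
lemma powerCoeff_le {p P E : ℝ} (hp : 2 ≤ p) (h : (2 * p - 3) / (4 * p) * P ≤ E)
    (hP : 0 ≤ P) : (4 * p - 2) / (2 * p) * P ≤ 16 * E := by
  have hp0 : 0 < p := by linarith
  rw [div_mul_eq_mul_div, div_le_iff₀ (by positivity)] at h ⊢
  nlinarith

/-- The reduced energy controls mass and power term at once, and `J_β ≤ 0` then bounds `2A` plus the
far energy by those and the near energy. The power term already contains `β`, so the bound is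
uniform over all `β ≥ 0`. -/
lemma exists_bound_of_nehari_nonpos {p lam : ℝ} (hp : 2 ≤ p) (hlam : 1 ≤ lam) (E : ℝ) :
    ∃ R : ℝ, 0 < R ∧ ∀ (β : ℝ) (u v : Plane → ℝ), 0 ≤ β → MemW lam u → MemW lam v →
      pairNehari p β u v ≤ 0 → pairReduced p β u v ≤ E →
        pairMass u v ≤ R ∧ pairGrad u v ≤ R ∧ farEnergy u v ≤ R := by
  obtain ⟨C, hC, h⟩ := exists_abs_nearEnergy_le hlam
  set M₀ := √(16 * |E|) with hM₀
  -- Of the `20 |E|`, a share of `16 |E|` bounds the power term and `4 |E|` bounds `M² / 4`.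
  refine ⟨M₀ + (20 * |E| + C * M₀ ^ 3) + 1, by positivity, fun β u v hβ hu hv hJ hI => ?_⟩
  have hP := powerTerm_nonneg (p := p) hβ u v
  have hEa := le_abs_self E
  have hPc : 0 ≤ (2 * p - 3) / (4 * p) * powerTerm p β u v :=
    mul_nonneg (div_nonneg (by linarith) (by linarith)) hP
  have hM2 : pairMass u v ^ 2 ≤ 16 * |E| := by
    unfold pairReduced at hI
    linarith
  have hMM : pairMass u v ≤ M₀ := Real.le_sqrt_of_sq_le hM2
  have hPE := powerCoeff_le hp (P := powerTerm p β u v) (E := |E|) (by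
    unfold pairReduced at hI
    linarith [sq_nonneg (pairMass u v)]) hP
  have hM0 := pairMass_nonneg u v
  have hA0 := pairGrad_nonneg u v
  have hF0 := farEnergy_nonneg u v
  have hN := (le_abs_self _).trans (h u v hu hv)
  have hM3 : C * pairMass u v ^ 3 ≤ C * M₀ ^ 3 := by gcongr
  rw [pairNehari, logEnergy_eq_far_sub_near hlam hu hv] at hJ
  have hx : 0 ≤ C * M₀ ^ 3 := by positivity
  have hE0 := abs_nonneg E
  have hM₀0 : 0 ≤ M₀ := Real.sqrt_nonneg _
  refine ⟨by linarith, by linarith, by linarith⟩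

lemma integrable_farLog_mul {lam : ℝ} (hlam : 1 ≤ lam) {f : Plane → ℝ} (hf : LogDensity lam f)
    (x : Plane) : Integrable fun y => farLog (x - y) * f y := by
  refine ((hf.integrable.norm.const_mul (Real.log (lam + ‖x‖))).add hf.moment.norm).mono'
    ((measurable_farLog.comp (measurable_const.sub measurable_id)).aestronglyMeasurable.mul
      hf.integrable.1) (Eventually.of_forall fun y => ?_)
  simp only [Pi.add_apply, norm_mul, Real.norm_of_nonneg (logWeight_nonneg hlam y),
    Real.norm_of_nonneg (farLog_nonneg _)]
  rw [← add_mul]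
  exact mul_le_mul_of_nonneg_right (farLog_sub_le hlam x y) (norm_nonneg _)

/-- There is a point around which the logarithmic moment of the density is at most its average. -/
lemma exists_moment_le {lam : ℝ} (hlam : 1 ≤ lam) {u v : Plane → ℝ} (hu : MemW lam u)
    (hv : MemW lam v) (hM : 0 < pairMass u v) :
    ∃ x, ∫ y, farLog (x - y) * density u v y ≤ farEnergy u v / pairMass u v := by
  by_contra! hcon
  have hd := hu.logDensity hlam hv
  set c := farEnergy u v / pairMass u v with hc
  have hi := kernelIntegrable_far hlam hd hd
  have hfar : farEnergy u v = ∫ x, (∫ y, farLog (x - y) * density u v y) * density u v x := by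
    rw [farEnergy, kernelForm, Measure.volume_eq_prod, integral_prod _ hi]
    simp_rw [integral_mul_const]
  have hi2 : Integrable fun x => (∫ y, farLog (x - y) * density u v y) * density u v x := by
    have := Integrable.integral_prod_left (μ := volume) (ν := volume) hi
    simpa only [integral_mul_const] using this
  -- The moment averaged against the density is exactly `c`. If it exceeded `c` at every point, the
  -- density would have to vanish almost everywhere.
  have hzero : ∫ x, ((∫ y, farLog (x - y) * density u v y) - c) * density u v x = 0 := by
    simp_rw [sub_mul]
    rw [integral_sub hi2 (hd.integrable.const_mul c), integral_const_mul,
      integral_density hu.1.1 hv.1.1, ← hfar, hc]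
    field_simp
    ring
  have hnn : ∀ x, 0 ≤ ((∫ y, farLog (x - y) * density u v y) - c) * density u v x := fun x =>
    mul_nonneg (sub_nonneg.2 (hcon x).le) (density_nonneg _ _ _)
  have hi3 : Integrable fun x => ((∫ y, farLog (x - y) * density u v y) - c) * density u v x := by
    simp_rw [sub_mul]
    exact hi2.sub (hd.integrable.const_mul c)
  have hae := (integral_eq_zero_iff_of_nonneg hnn hi3).1 hzero
  have hd0 : density u v =ᵐ[volume] fun _ => 0 := by
    filter_upwards [hae] with x hx
    rcases mul_eq_zero.1 hx with h | h
    · exact absurd h (sub_pos.2 (hcon x)).ne'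
    · exact h
  have : pairMass u v = 0 := by
    rw [← integral_density hu.1.1 hv.1.1, integral_congr_ae hd0, integral_zero]
  linarith

/-- The bound carries the factor `M` in front of the gradient term, so for small mass the power term
can be absorbed by the gradient. Bounds on `β` and on the gradient make `D` uniform. -/
lemma exists_powerTerm_le {p : ℝ} (hp : 2 ≤ p) {B R : ℝ} (hB : 0 ≤ B) (hR : 0 ≤ R) :
    ∃ D : ℝ, 0 ≤ D ∧ ∀ (β : ℝ) (u v : Plane → ℝ), 0 ≤ β → β ≤ B → MemH1 u → MemH1 v →
      pairGrad u v ≤ R →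
        (4 * p - 2) / (2 * p) * powerTerm p β u v ≤ D * (pairMass u v * pairGrad u v) := by
  obtain ⟨C, k, hC, h⟩ := exists_integral_rpow_le (q := 2 * p) (by linarith)
  refine ⟨2 * ((1 + B) * (C * (1 + R ^ k))), by positivity, fun β u v hβ hβB hu hv hA => ?_⟩
  have hP := powerTerm_nonneg (p := p) hβ u v
  have m1 := massSq_nonneg u
  have m2 := massSq_nonneg v
  have g1 := gradSq_nonneg u
  have g2 := gradSq_nonneg v
  have hA0 := pairGrad_nonneg u v
  have one : ∀ w : Plane → ℝ, MemH1 w → gradSq w ≤ pairGrad u v →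
      ∫ x, |w x| ^ (2 * p) ≤ C * (massSq w * (pairGrad u v * (1 + R ^ k))) := by
    intro w hw hle
    refine (h w hw).trans ?_
    have hm := massSq_nonneg w
    have hg := gradSq_nonneg w
    have e : gradSq w + gradSq w ^ (k + 1) = gradSq w * (1 + gradSq w ^ k) := by ring
    rw [e]
    have : gradSq w ≤ R := hle.trans hA
    gcongr
  have h1 := one u hu (by unfold pairGrad; linarith)
  have h2 := one v hv (by unfold pairGrad; linarith)
  have hb : (4 * p - 2) / (2 * p) ≤ 2 := by
    rw [div_le_iff₀ (by linarith)]
    linarith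
  calc (4 * p - 2) / (2 * p) * powerTerm p β u v ≤ 2 * powerTerm p β u v := by gcongr
    _ ≤ 2 * ((1 + β) * ((∫ x, |u x| ^ (2 * p)) + ∫ x, |v x| ^ (2 * p))) := by
        have := powerTerm_le (p := p) (by linarith) hβ hu hv
        linarith
    _ ≤ 2 * ((1 + B) * (C * (massSq u * (pairGrad u v * (1 + R ^ k))) +
          C * (massSq v * (pairGrad u v * (1 + R ^ k))))) := by
        gcongr
    _ = _ := by
        rw [pairMass]
        ring

/-- If the mass `M` is small, `J_β ≤ 0` forces `A / 2` plus the far energy to be at most `Q M²`.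
Some centre then has moment at most `Q M`, so half of the mass lies in a ball of fixed radius about
it. On that ball Cauchy–Schwarz and Gagliardo–Nirenberg bound the mass by a multiple of `√(M A)`,
which is of order `M^(3/2)`, impossible for small `M`. This is what excludes vanishing. -/
lemma exists_mass_lower_bound {p lam : ℝ} (hp : 2 ≤ p) (hlam : 1 ≤ lam) (E : ℝ) {B : ℝ}
    (hB : 0 ≤ B) : ∃ m : ℝ, 0 < m ∧ ∀ (β : ℝ) (u v : Plane → ℝ), 0 ≤ β → β ≤ B → MemW lam u →
      MemW lam v → 0 < pairMass u v → pairNehari p β u v ≤ 0 → pairReduced p β u v ≤ E →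
        m ≤ pairMass u v := by
  obtain ⟨R, hR, hbound⟩ := exists_bound_of_nehari_nonpos hp hlam E
  obtain ⟨D, hD, hpow⟩ := exists_powerTerm_le hp hB hR.le
  obtain ⟨C, hC, hnear⟩ := exists_abs_nearEnergy_le hlam
  obtain ⟨S, hS, hdens⟩ := exists_integral_density_sq_le
  -- The two summands come from `M² / 4` in `J_β` and from the cubic near-energy term, used with `M
  -- ≤ 1`.
  set Q : ℝ := 1 / 4 + C with hQ
  have hQ0 : 0 < Q := by positivity
  let k : Plane → ℝ := (Metric.ball (0 : Plane) (Real.exp (2 * Q))).indicator fun _ => 1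
  have hk : MemLp k 2 volume :=
    memLp_indicator_const 2 measurableSet_ball 1 (Or.inr measure_ball_lt_top.ne)
  set ν := ∫ x, k x ^ 2 with hν
  have hν0 : 0 ≤ ν := integral_nonneg fun _ => sq_nonneg _
  -- Chebyshev's inequality in pointwise form: outside the ball of radius `exp (2 Q)` the far
  -- logarithm is at least `2 Q`. A moment of at most `Q M` therefore leaves at most half the mass
  -- outside.
  have hpt : ∀ z, 1 ≤ (2 * Q)⁻¹ * farLog z + k z := by
    intro z
    by_cases hz : z ∈ Metric.ball (0 : Plane) (Real.exp (2 * Q))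
    · have : k z = 1 := indicator_of_mem hz _
      rw [this]
      have := mul_nonneg (inv_nonneg.2 (by positivity : 0 ≤ 2 * Q)) (farLog_nonneg z)
      linarith
    · have : k z = 0 := indicator_of_notMem hz _
      rw [this, add_zero, inv_mul_eq_div, one_le_div (by positivity)]
      rw [mem_ball_zero_iff, not_lt] at hz
      refine le_trans ?_ (le_max_right _ _)
      rw [Real.le_log_iff_exp_le (lt_of_lt_of_le (Real.exp_pos _) hz)]
      exact hz
  set L := 16 * ν * S * Q with hL
  have hL0 : 0 ≤ L := by positivity
  -- The three summands serve for `M ≤ 1`, for absorbing the power term by `D M ≤ 1`, and for the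
  -- contradiction with `1 ≤ L M`.
  refine ⟨1 / (1 + D + L), by positivity, fun β u v hβ hβB hu hv hM hJ hI => ?_⟩
  by_contra! hlt
  rw [lt_div_iff₀ (by positivity)] at hlt
  set M := pairMass u v with hMdef
  have hDM : 0 ≤ M * D := by positivity
  have hLM : 0 ≤ M * L := by positivity
  have hM1 : M ≤ 1 := by nlinarith
  have hDM1 : M * D ≤ 1 := by nlinarith
  have hLM1 : M * L < 1 := by nlinarith
  obtain ⟨-, hAR, -⟩ := hbound β u v hβ hu hv hJ hI
  have hP := hpow β u v hβ hβB hu.1 hv.1 hAR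
  have hN := (le_abs_self _).trans (hnear u v hu hv)
  have hA0 := pairGrad_nonneg u v
  have hF0 := farEnergy_nonneg u v
  set A := pairGrad u v with hA
  rw [pairNehari, logEnergy_eq_far_sub_near hlam hu hv] at hJ
  have hDA : D * (M * A) ≤ A := by nlinarith
  have hM3 : M ^ 3 ≤ M ^ 2 := pow_le_pow_of_le_one hM.le hM1 (by norm_num)
  have hAF : A / 2 + farEnergy u v ≤ Q * M ^ 2 := by
    have := mul_le_mul_of_nonneg_left hM3 hC.le
    rw [hQ]
    linarith
  obtain ⟨x, hx⟩ := exists_moment_le hlam hu hv hM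
  have hd := hu.logDensity hlam hv
  have hxM : ∫ y, farLog (x - y) * density u v y ≤ Q * M := by
    refine hx.trans ?_
    rw [div_le_iff₀ hM]
    nlinarith
  have i1 := (integrable_farLog_mul hlam hd x).const_mul (2 * Q)⁻¹
  have i2 := integrable_mul_comp_sub hk hd.memLp x
  have hle : M ≤ (2 * Q)⁻¹ * (Q * M) + √ν * √(S * (M * A)) := by
    calc M = ∫ y, density u v y := (integral_density hu.1.1 hv.1.1).symm
      _ ≤ ∫ y, ((2 * Q)⁻¹ * (farLog (x - y) * density u v y) + k (x - y) * density u v y) := by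
          refine integral_mono hd.integrable (i1.add i2) fun y => ?_
          have := mul_le_mul_of_nonneg_right (hpt (x - y)) (density_nonneg u v y)
          simp only
          linarith
      _ = (2 * Q)⁻¹ * (∫ y, farLog (x - y) * density u v y) + ∫ y, k (x - y) * density u v y := by
          rw [integral_add i1 i2, integral_const_mul]
      _ ≤ (2 * Q)⁻¹ * (Q * M) + √ν * √(S * (M * A)) := by
          have h1 := (le_abs_self _).trans (integral_mul_comp_sub_le hk hd.memLp x)
          have h2 : √(∫ y, density u v y ^ 2) ≤ √(S * (M * A)) :=
            Real.sqrt_le_sqrt (hdens u v hu.1 hv.1)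
          have h3 : 0 ≤ √ν := Real.sqrt_nonneg _
          have h4 : (2 * Q)⁻¹ * (∫ y, farLog (x - y) * density u v y) ≤ (2 * Q)⁻¹ * (Q * M) := by
            gcongr
          have h5 := mul_le_mul_of_nonneg_left h2 h3
          linarith
  have e1 : (2 * Q)⁻¹ * (Q * M) = M / 2 := by
    field_simp
  rw [e1, ← Real.sqrt_mul hν0] at hle
  have h6 : M / 2 ≤ √(ν * (S * (M * A))) := by linarith
  have h7 : (M / 2) ^ 2 ≤ ν * (S * (M * A)) :=
    (Real.le_sqrt (by positivity) (by positivity)).1 h6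
  have h8 : A ≤ 2 * (Q * M ^ 2) := by linarith
  have h9 : ν * (S * (M * A)) ≤ ν * (S * (M * (2 * (Q * M ^ 2)))) := by gcongr
  have h10 : M ^ 2 * 1 ≤ M ^ 2 * (M * L) := by
    rw [hL]
    nlinarith
  have h11 := le_of_mul_le_mul_left h10 (by positivity)
  have hν1 : 0 ≤ M * L := hLM
  linarith

/-! ### Compactness of bounded-energy sequences below the Nehari–Pohozaev manifold -/

lemma farLog_neg (z : Plane) : farLog (-z) = farLog z := by rw [farLog, farLog, norm_neg]

lemma logWeight_le {lam : ℝ} (hlam : 1 ≤ lam) (x : Plane) :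
    Real.log (lam + ‖x‖) ≤ farLog x + Real.log (lam + 1) := by
  have hx := norm_nonneg x
  rcases le_total ‖x‖ 1 with h | h
  · have h1 := farLog_nonneg x
    have h2 : Real.log (lam + ‖x‖) ≤ Real.log (lam + 1) :=
      Real.log_le_log (by positivity) (by linarith)
    linarith
  · have h1 : Real.log ‖x‖ ≤ farLog x := le_max_right _ _
    have h2 : Real.log (lam + ‖x‖) ≤ Real.log (‖x‖ * (lam + 1)) :=
      Real.log_le_log (by positivity) (by nlinarith)
    rw [Real.log_mul (by positivity) (by positivity)] at h2
    linarith

lemma logSq_add_le {lam : ℝ} (hlam : 1 ≤ lam) {u v : Plane → ℝ} (hu : MemW lam u)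
    (hv : MemW lam v) : logSq lam u + logSq lam v ≤
      (∫ x, farLog x * density u v x) + Real.log (lam + 1) * pairMass u v := by
  have hd := hu.logDensity hlam hv
  have hi : Integrable fun x => farLog x * density u v x := by
    simpa only [zero_sub, farLog_neg] using integrable_farLog_mul hlam hd 0
  rw [logSq, logSq, ← integral_add hu.2 hv.2, ← integral_density hu.1.1 hv.1.1,
    ← integral_const_mul, ← integral_add hi (hd.integrable.const_mul _)]
  refine integral_mono (hu.2.add hv.2) (hi.add (hd.integrable.const_mul _)) fun x => ?_
  simp only
  rw [← mul_add, ← add_mul]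
  exact mul_le_mul_of_nonneg_right (logWeight_le hlam x) (density_nonneg _ _ _)

/-- A pair below the Nehari–Pohozaev manifold can be translated to a bounded set of `W^λ`. -/
lemma exists_translate_bound {p lam : ℝ} (hp : 2 ≤ p) (hlam : 1 ≤ lam) (E : ℝ) {B : ℝ}
    (hB : 0 ≤ B) : ∃ K : ℝ, ∀ (β : ℝ) (u v : Plane → ℝ), 0 ≤ β → β ≤ B → MemW lam u →
      MemW lam v → 0 < pairMass u v → pairNehari p β u v ≤ 0 → pairReduced p β u v ≤ E →
        ∃ y : Plane, wSq lam (fun x => u (x - y)) ≤ K ∧ wSq lam (fun x => v (x - y)) ≤ K := by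
  obtain ⟨R, hR, hbound⟩ := exists_bound_of_nehari_nonpos hp hlam E
  obtain ⟨m, hm, hlow⟩ := exists_mass_lower_bound hp hlam E hB
  refine ⟨R + R + (R / m + Real.log (lam + 1) * R), fun β u v hβ hβB hu hv hM hJ hI => ?_⟩
  obtain ⟨h1, h2, h3⟩ := hbound β u v hβ hu hv hJ hI
  have hmM := hlow β u v hβ hβB hu hv hM hJ hI
  obtain ⟨x₀, hx₀⟩ := exists_moment_le hlam hu hv hM
  -- Translating by `-x₀` moves the good centre to the origin, where the far moment controls the
  -- logarithmic weight up to a multiple of the mass.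
  have hu' := hu.comp_sub_right hlam (-x₀)
  have hv' := hv.comp_sub_right hlam (-x₀)
  have hlog := logSq_add_le hlam hu' hv'
  have e : ∫ x, farLog x * density (fun x => u (x - -x₀)) (fun x => v (x - -x₀)) x =
      ∫ y, farLog (x₀ - y) * density u v y := by
    rw [← integral_add_right_eq_self (fun y => farLog (x₀ - y) * density u v y) x₀]
    refine integral_congr_ae (Eventually.of_forall fun x => ?_)
    simp only [density, sub_neg_eq_add, sub_add_cancel_right, farLog_neg]
  have h4 : farEnergy u v / pairMass u v ≤ R / m := by gcongr
  rw [e, pairMass_comp_sub_right] at hlog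
  have hl : 0 ≤ Real.log (lam + 1) := Real.log_nonneg (by linarith)
  have h5 := mul_le_mul_of_nonneg_left h1 hl
  have g := pairGrad_comp_sub_right hu.1 hv.1 (-x₀)
  have q := pairMass_comp_sub_right u v (-x₀)
  unfold pairGrad at g h2
  unfold pairMass at q h1
  have a1 := gradSq_nonneg (fun x => u (x - -x₀))
  have a2 := gradSq_nonneg (fun x => v (x - -x₀))
  have a3 := massSq_nonneg (fun x => u (x - -x₀))
  have a4 := massSq_nonneg (fun x => v (x - -x₀))
  have a5 := logSq_nonneg hlam (fun x => u (x - -x₀))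
  have a6 := logSq_nonneg hlam (fun x => v (x - -x₀))
  exact ⟨-x₀, by unfold wSq; linarith, by unfold wSq; linarith⟩

lemma tendsto_nearEnergy {lam : ℝ} (hlam : 1 ≤ lam) {u v : ℕ → Plane → ℝ} {a b : Plane → ℝ} {K : ℝ}
    (hu : ∀ n, MemW lam (u n)) (hv : ∀ n, MemW lam (v n)) (ha : MemW lam a) (hb : MemW lam b)
    (huK : ∀ n, massSq (u n) ≤ K ∧ gradSq (u n) ≤ K)
    (hvK : ∀ n, massSq (v n) ≤ K ∧ gradSq (v n) ≤ K)
    (h : Tendsto (fun n => ∫ x, |density (u n) (v n) x - density a b x|) atTop (𝓝 0)) :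
    Tendsto (fun n => nearEnergy (u n) (v n)) atTop (𝓝 (nearEnergy a b)) := by
  obtain ⟨C, hC, hdens⟩ := exists_integral_density_sq_le
  have hb2 : ∀ n, ∫ x, density (u n) (v n) x ^ 2 ≤ C * ((K + K) * (K + K)) := by
    intro n
    refine (hdens _ _ (hu n).1 (hv n).1).trans ?_
    have := pairMass_nonneg (u n) (v n)
    have := pairGrad_nonneg (u n) (v n)
    refine mul_le_mul_of_nonneg_left (mul_le_mul ?_ ?_ ‹_› ?_) hC.le
    · exact add_le_add (huK n).1 (hvK n).1
    · exact add_le_add (huK n).2 (hvK n).2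
    · linarith [(huK n).1, (hvK n).1, massSq_nonneg (u n), massSq_nonneg (v n)]
  rw [tendsto_iff_norm_sub_tendsto_zero]
  have hlim := h.const_mul (√(∫ y, nearLog y ^ 2) *
    (√(C * ((K + K) * (K + K))) + √(∫ y, density a b y ^ 2)))
  rw [mul_zero] at hlim
  refine squeeze_zero (fun n => norm_nonneg _) (fun n => ?_) hlim
  have hd := (hu n).logDensity hlam (hv n)
  have hd' := ha.logDensity hlam hb
  refine (abs_kernelForm_near_sub_le hd.memLp hd'.memLp hd.integrable hd'.integrable).trans ?_
  gcongr
  exact hb2 n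

/-- Only Fatou is available here, because `L²` convergence does not prevent logarithmic moments from
being lost at infinity. For this reason limits satisfy `J_β ≤ 0` rather than equality. -/
lemma farEnergy_le_of_tendsto {lam : ℝ} (hlam : 1 ≤ lam) {u v : ℕ → Plane → ℝ} {a b : Plane → ℝ}
    {c : ℕ → ℝ} {A : ℝ} (hu : ∀ n, MemW lam (u n)) (hv : ∀ n, MemW lam (v n))
    (hd : ∀ᵐ x, Tendsto (fun n => density (u n) (v n) x) atTop (𝓝 (density a b x)))
    (hc : ∀ n, farEnergy (u n) (v n) ≤ c n) (hA : Tendsto c atTop (𝓝 A)) : farEnergy a b ≤ A := by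
  have hae : ∀ᵐ z : Plane × Plane, Tendsto (fun n => farLog (z.1 - z.2) *
      density (u n) (v n) z.2 * density (u n) (v n) z.1) atTop
      (𝓝 (farLog (z.1 - z.2) * density a b z.2 * density a b z.1)) := by
    filter_upwards [(Measure.quasiMeasurePreserving_fst (μ := (volume : Measure Plane))
      (ν := (volume : Measure Plane))).ae hd, (Measure.quasiMeasurePreserving_snd
      (μ := (volume : Measure Plane)) (ν := (volume : Measure Plane))).ae hd] with z h1 h2
    exact (h2.const_mul _).mul h1
  exact (integral_le_of_tendsto_ae (fun n => kernelIntegrable_far hlam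
    ((hu n).logDensity hlam (hv n)) ((hu n).logDensity hlam (hv n)))
    (fun n z => mul_nonneg (mul_nonneg (farLog_nonneg _) (density_nonneg _ _ _))
      (density_nonneg _ _ _)) hae hc hA).2

/-- A sequence below the Nehari–Pohozaev manifolds that is bounded in `W^λ` has a subsequence that
converges strongly in `L²` to a pair below the limiting manifold. -/
lemma exists_subseq_limit {p lam : ℝ} (hp : 2 ≤ p) (hlam : 1 < lam) {β : ℕ → ℝ} {β₀ K : ℝ}
    (hβ : Tendsto β atTop (𝓝 β₀)) {u v : ℕ → Plane → ℝ} (hu : ∀ n, MemW lam (u n))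
    (hv : ∀ n, MemW lam (v n)) (huK : ∀ n, wSq lam (u n) ≤ K) (hvK : ∀ n, wSq lam (v n) ≤ K)
    (hJ : ∀ n, pairNehari p (β n) (u n) (v n) ≤ 0) :
    ∃ (k : ℕ → ℕ) (a b : Plane → ℝ), StrictMono k ∧ MemW lam a ∧ MemW lam b ∧
      Tendsto (fun n => massSq fun x => u (k n) x - a x) atTop (𝓝 0) ∧
      Tendsto (fun n => massSq fun x => v (k n) x - b x) atTop (𝓝 0) ∧
      Tendsto (fun n => pairMass (u (k n)) (v (k n))) atTop (𝓝 (pairMass a b)) ∧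
      pairNehari p β₀ a b ≤ 0 ∧
      Tendsto (fun n => pairReduced p (β (k n)) (u (k n)) (v (k n))) atTop
        (𝓝 (pairReduced p β₀ a b)) := by
  obtain ⟨k₁, a, G, hk₁, ha, hua, haea, hGa, hleG⟩ := exists_strong_subseq hlam hu huK
  obtain ⟨k₂, b, H, hk₂, hb, hvb, haeb, hHb, hleH⟩ :=
    exists_strong_subseq hlam (u := fun n => v (k₁ n)) (fun n => hv _) fun n => hvK _
  set k : ℕ → ℕ := fun n => k₁ (k₂ n) with hk
  have hkm : StrictMono k := hk₁.comp hk₂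
  have hua' := hua.comp hk₂.tendsto_atTop
  have hmg : ∀ w : ℕ → Plane → ℝ, (∀ n, wSq lam (w n) ≤ K) → ∀ n,
      massSq (w n) ≤ K ∧ gradSq (w n) ≤ K := fun w hw n =>
    ⟨(massSq_le_wSq hlam.le _).trans (hw n), (gradSq_le_wSq hlam.le _).trans (hw n)⟩
  have hu1 := fun n => hmg u huK (k n)
  have hv1 := fun n => hmg v hvK (k n)
  have hdens := tendsto_integral_abs_density_sub (u := fun n => u (k n)) (v := fun n => v (k n))
    (fun n => (hu _).1.1) (fun n => (hv _).1.1) ha.1.1 hb.1.1 (fun n => (hu1 n).1)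
    (fun n => (hv1 n).1) hua' hvb
  have hmass : Tendsto (fun n => pairMass (u (k n)) (v (k n))) atTop (𝓝 (pairMass a b)) := by
    rw [tendsto_iff_norm_sub_tendsto_zero]
    refine squeeze_zero (fun n => norm_nonneg _) (fun n => ?_) hdens
    rw [← integral_density (hu _).1.1 (hv _).1.1, ← integral_density ha.1.1 hb.1.1,
      ← integral_sub ((hu _).logDensity hlam.le (hv _)).integrable (ha.logDensity hlam.le hb).integrable]
    exact norm_integral_le_integral_norm _
  have hpow := tendsto_powerTerm hp (hβ.comp hkm.tendsto_atTop) (fun n => (hu (k n)).1)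
    (fun n => (hv (k n)).1) ha.1 hb.1 hu1 hv1 hua' hvb
  have hnear := tendsto_nearEnergy hlam.le (fun n => hu (k n)) (fun n => hv (k n)) ha hb hu1 hv1 hdens
  refine ⟨k, a, b, hkm, ha, hb, hua', hvb, hmass, ?_,
    ((hmass.pow 2).div_const 16).add (hpow.const_mul _)⟩
  have hae : ∀ᵐ x, Tendsto (fun n => density (u (k n)) (v (k n)) x) atTop (𝓝 (density a b x)) := by
    filter_upwards [haea, haeb] with x hx hy
    exact ((hx.comp hk₂.tendsto_atTop).pow 2).add (hy.pow 2)
  have hgrad := (hGa.comp hk₂.tendsto_atTop).add hHb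
  -- `J ≤ 0` is solved for the far energy. Everything else converges, except that the limit of the
  -- gradient terms may exceed the gradient of the limit; that sign is favourable too.
  have hlim := ((((hmass.pow 2).const_mul (1 / 4)).add hnear).add
    (hpow.const_mul ((4 * p - 2) / (2 * p)))).sub (hgrad.const_mul 2)
  have hfar := farEnergy_le_of_tendsto hlam.le (fun n => hu (k n)) (fun n => hv (k n)) hae
    (fun n => by
      have := hJ (k n)
      rw [pairNehari, logEnergy_eq_far_sub_near hlam.le (hu _) (hv _), pairGrad] at this
      simp only [Function.comp_apply]
      linarith) hlim
  rw [pairNehari, logEnergy_eq_far_sub_near hlam.le ha hb, pairGrad]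
  linarith

/-- Compactness: a sequence below the Nehari–Pohozaev manifolds with bounded energy converges, up
to translations and subsequences, to a nontrivial pair below the limiting manifold. -/
lemma exists_translate_limit {p lam : ℝ} (hp : 2 ≤ p) (hlam : 1 < lam) {β : ℕ → ℝ} {β₀ E : ℝ}
    (hβ0 : ∀ n, 0 ≤ β n) (hβ : Tendsto β atTop (𝓝 β₀)) {u v : ℕ → Plane → ℝ}
    (hu : ∀ n, MemW lam (u n)) (hv : ∀ n, MemW lam (v n)) (hM : ∀ n, 0 < pairMass (u n) (v n))
    (hJ : ∀ n, pairNehari p (β n) (u n) (v n) ≤ 0)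
    (hI : ∀ n, pairReduced p (β n) (u n) (v n) ≤ E) :
    ∃ (k : ℕ → ℕ) (y : ℕ → Plane) (a b : Plane → ℝ) (K : ℝ), StrictMono k ∧ MemW lam a ∧
      MemW lam b ∧ (∀ n, wSq lam (fun x => u (k n) (x - y n)) ≤ K) ∧
      (∀ n, wSq lam (fun x => v (k n) (x - y n)) ≤ K) ∧
      Tendsto (fun n => massSq fun x => u (k n) (x - y n) - a x) atTop (𝓝 0) ∧
      Tendsto (fun n => massSq fun x => v (k n) (x - y n) - b x) atTop (𝓝 0) ∧
      0 < pairMass a b ∧ pairNehari p β₀ a b ≤ 0 ∧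
      Tendsto (fun n => pairReduced p (β (k n)) (u (k n)) (v (k n))) atTop
        (𝓝 (pairReduced p β₀ a b)) := by
  obtain ⟨B, hB⟩ := hβ.bddAbove_range
  have hBn : ∀ n, β n ≤ B := fun n => hB (mem_range_self n)
  have hB0 : 0 ≤ B := (hβ0 0).trans (hBn 0)
  obtain ⟨K, hK⟩ := exists_translate_bound hp hlam.le E hB0
  obtain ⟨m, hm, hlow⟩ := exists_mass_lower_bound hp hlam.le E hB0
  choose y hy using fun n =>
    hK (β n) (u n) (v n) (hβ0 n) (hBn n) (hu n) (hv n) (hM n) (hJ n) (hI n)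
  obtain ⟨k, a, b, hk, ha, hb, hua, hvb, hmass, hneh, hred⟩ := exists_subseq_limit hp hlam hβ
    (fun n => (hu n).comp_sub_right hlam.le (y n)) (fun n => (hv n).comp_sub_right hlam.le (y n))
    (fun n => (hy n).1) (fun n => (hy n).2) fun n => by
      rw [pairNehari_comp_sub_right hlam.le p (β n) (hu n) (hv n)]
      exact hJ n
  simp only [pairMass_comp_sub_right] at hmass
  simp only [pairReduced, powerTerm_comp_sub_right, pairMass_comp_sub_right] at hred
  refine ⟨k, fun n => y (k n), a, b, K, hk, ha, hb, fun n => (hy _).1, fun n => (hy _).2, hua, hvb,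
    ?_, hneh, hred⟩
  -- The uniform lower bound on the mass passes to the limit by strong `L²` convergence, so the
  -- limit is nontrivial.
  exact hm.trans_le (ge_of_tendsto' hmass fun n =>
    hlow _ _ _ (hβ0 _) (hBn _) (hu _) (hv _) (hM _) (hJ _) (hI _))

/-! ### Existence of minimizers -/

/-- A pair of functions realizing the ground level on the Nehari–Pohozaev manifold. -/
structure IsGround (p β lam : ℝ) (u v : Plane → ℝ) : Prop where
  memW_fst : MemW lam u
  memW_snd : MemW lam v
  mass_pos : 0 < pairMass u v
  nehari : pairNehari p β u v = 0
  energy : pairEnergy p β u v = groundLevel p β lam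

lemma isGround_of_pairReduced_le {p β lam : ℝ} (hp : 2 ≤ p) (hlam : 1 < lam) (hβ : 0 ≤ β)
    {u v : Plane → ℝ} (hu : MemW lam u) (hv : MemW lam v) (hM : 0 < pairMass u v)
    (hJ : pairNehari p β u v ≤ 0) (hI : pairReduced p β u v ≤ groundLevel p β lam) :
    IsGround p β lam u v :=
  have h := minimizer_of_pairReduced_le hp hlam hβ hu hv hM hJ hI
  ⟨hu, hv, hM, h.1, h.2⟩

lemma IsGround.pairReduced {p β lam : ℝ} (hp : 2 ≤ p) {u v : Plane → ℝ}
    (h : IsGround p β lam u v) : pairReduced p β u v = groundLevel p β lam :=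
  (pairEnergy_eq_pairReduced hp h.nehari).symm.trans h.energy

lemma powerTerm_swap (p β : ℝ) (u v : Plane → ℝ) : powerTerm p β u v = powerTerm p β v u := by
  simp only [powerTerm, mul_comm (u _)]
  ring

lemma logEnergy_swap (u v : Plane → ℝ) : logEnergy u v = logEnergy v u := by
  simp only [logEnergy, add_comm (u _ ^ 2)]

lemma IsGround.swap {p β lam : ℝ} {u v : Plane → ℝ} (h : IsGround p β lam u v) :
    IsGround p β lam v u := by
  refine ⟨h.memW_snd, h.memW_fst, ?_, ?_, ?_⟩
  · simpa only [pairMass, add_comm] using h.mass_pos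
  · rw [← h.nehari, pairNehari, pairNehari, pairGrad, pairGrad, pairMass, pairMass,
      logEnergy_swap v, powerTerm_swap p β v, add_comm (gradSq v), add_comm (massSq v)]
  · rw [← h.energy, pairEnergy, pairEnergy, pairGrad, pairGrad,
      logEnergy_swap v, powerTerm_swap p β v, add_comm (gradSq v)]

lemma exists_test_massSq_pos : ∃ φ : Plane → ℝ, IsTest φ ∧ 0 < massSq φ := by
  let f : ContDiffBump (0 : Plane) := ⟨1, 2, one_pos, one_lt_two⟩
  have hf : IsTest f := ⟨f.contDiff, f.hasCompactSupport⟩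
  refine ⟨f, hf, ?_⟩
  refine (integral_pos_iff_support_of_nonneg (fun x => sq_nonneg (f x)) hf.memLp.integrable_sq).2 ?_
  refine (Metric.measure_ball_pos volume (0 : Plane) (by norm_num : (0 : ℝ) < 1)).trans_le
    (measure_mono fun x hx => ?_)
  simp [f.one_of_mem_closedBall (Metric.ball_subset_closedBall hx)]

lemma exists_dilate_nehari_eq_zero {p β lam : ℝ} (hp : 2 ≤ p) (hlam : 1 < lam) (hβ : 0 ≤ β)
    {u v : Plane → ℝ} (hu : MemW lam u) (hv : MemW lam v) (hM : 0 < pairMass u v) :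
    ∃ t, 0 < t ∧ pairNehari p β (dilate t u) (dilate t v) = 0 := by
  obtain ⟨t, ht, h⟩ := exists_fibreReduced_eq_zero (A := pairGrad u v) (V := logEnergy u v) hp hM
    (powerTerm_nonneg (p := p) hβ u v)
  refine ⟨t, ht, ?_⟩
  rwa [pairNehari_dilate hlam p β hu hv ht, fibreNehari_eq_zero_iff ht]

lemma groundLevel_le_dilate {p β lam : ℝ} (hp : 2 ≤ p) (hlam : 1 < lam) (hβ : 0 ≤ β)
    {u v : Plane → ℝ} (hu : MemW lam u) (hv : MemW lam v) (hM : 0 < pairMass u v) {t : ℝ}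
    (ht : 0 < t) (h : pairNehari p β (dilate t u) (dilate t v) = 0) :
    groundLevel p β lam ≤ pairEnergy p β (dilate t u) (dilate t v) := by
  refine groundLevel_le hp hβ (memW_dilate hlam hu ht) (memW_dilate hlam hv ht) ?_ h
  rw [pairMass_dilate u v ht]
  positivity

lemma manifold_nonempty {p β lam : ℝ} (hp : 2 ≤ p) (hlam : 1 < lam) (hβ : 0 ≤ β) :
    (manifold p β lam).Nonempty := by
  obtain ⟨φ, hφ, hpos⟩ := exists_test_massSq_pos
  have hW : MemW lam φ := hφ.memW (by linarith)
  have hM : 0 < pairMass φ φ := add_pos hpos hpos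
  obtain ⟨t, ht, h⟩ := exists_dilate_nehari_eq_zero hp hlam hβ hW hW hM
  refine ⟨_, toW_mem_manifold (memW_dilate hlam hW ht) (memW_dilate hlam hW ht) ?_ h⟩
  rw [pairMass_dilate φ φ ht]
  positivity

/-- The constraint may be lost to `J_β ≤ 0` along a minimizing sequence, but the reduced energy
converges to the infimum. That is enough for the projection argument to restore `J_β = 0`. -/
lemma exists_isGround {p β lam : ℝ} (hp : 2 ≤ p) (hlam : 1 < lam) (hβ : 0 ≤ β) :
    ∃ u v, IsGround p β lam u v := by
  obtain ⟨e, -, he, hmem⟩ := exists_seq_tendsto_sInf ((manifold_nonempty hp hlam hβ).image (energy p β))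
    (bddBelow_energy lam hp hβ)
  choose w hw hwe using hmem
  have hred : ∀ n, pairReduced p β (rep (w n).1) (rep (w n).2) = e n := fun n => by
    rw [← hwe n, energy_eq_pairEnergy, pairEnergy_eq_pairReduced hp (hw n).2]
  obtain ⟨E, hE⟩ := he.bddAbove_range
  obtain ⟨k, y, a, b, K, hk, ha, hb, -, -, -, -, hM, hJ, hlim⟩ := exists_translate_limit hp hlam
    (β := fun _ => β) (β₀ := β) (E := E) (fun _ => hβ) tendsto_const_nhds
    (fun n => memW_rep (w n).1) (fun n => memW_rep (w n).2)
    (fun n => pairMass_rep_pos.2 (hw n).1) (fun n => (hw n).2.le)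
    (fun n => (hred n).trans_le (hE (mem_range_self n)))
  simp only [hred] at hlim
  exact ⟨a, b, isGround_of_pairReduced_le hp hlam hβ ha hb hM hJ
    (tendsto_nhds_unique hlim (he.comp hk.tendsto_atTop)).le⟩

lemma MemW.abs {lam : ℝ} {u : Plane → ℝ} (hu : MemW lam u) : MemW lam fun x => |u x| :=
  ⟨hu.1.abs.1, by simpa only [sq_abs] using hu.2⟩

/-- Only the gradient term can change, and it can only decrease, so `J_β ≤ 0` while the reduced
energy is unchanged. -/
lemma IsGround.abs {p β lam : ℝ} (hp : 2 ≤ p) (hlam : 1 < lam) (hβ : 0 ≤ β) {u v : Plane → ℝ}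
    (h : IsGround p β lam u v) : IsGround p β lam (fun x => |u x|) (fun x => |v x|) := by
  have hm : pairMass (fun x => |u x|) (fun x => |v x|) = pairMass u v := by
    simp only [pairMass, massSq, sq_abs]
  have hP : powerTerm p β (fun x => |u x|) (fun x => |v x|) = powerTerm p β u v := by
    simp only [powerTerm, abs_mul, abs_abs]
  have hV : logEnergy (fun x => |u x|) (fun x => |v x|) = logEnergy u v := by
    simp only [logEnergy, sq_abs]
  refine isGround_of_pairReduced_le hp hlam hβ h.memW_fst.abs h.memW_snd.abs (hm ▸ h.mass_pos) ?_ ?_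
  · have hJ := h.nehari
    have h1 := h.memW_fst.1.abs.2
    have h2 := h.memW_snd.1.abs.2
    rw [pairNehari, pairGrad] at hJ ⊢
    rw [hm, hP, hV]
    linarith
  · have hI := h.pairReduced hp
    rw [HartreeFock.pairReduced] at hI ⊢
    rw [hm, hP, hI]

/-! ### The Euler–Lagrange equation -/

/-- For `|s| ≤ 1` the derivative is dominated by `q (|u| + |φ|)^q |w|`. The weight `w` allows one
statement for the pure power (`w = 1`) and the coupling (`w = |v|^p`). -/
lemma hasDerivAt_integral_abs_rpow {q : ℝ} (hq : 2 ≤ q) {u φ w : Plane → ℝ}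
    (hu : AEStronglyMeasurable u volume) (hφ : AEStronglyMeasurable φ volume)
    (hw : AEStronglyMeasurable w volume)
    (hi : Integrable fun x => (|u x| + |φ x|) ^ q * |w x|) :
    Integrable (fun x => |u x| ^ (q - 2) * u x * φ x * w x) ∧
    HasDerivAt (fun s => ∫ x, |u x + s * φ x| ^ q * w x)
      (q * ∫ x, |u x| ^ (q - 2) * u x * φ x * w x) 0 := by
  have hm : ∀ s : ℝ, AEStronglyMeasurable (fun x => u x + s * φ x) volume := fun s =>
    hu.add (hφ.const_mul s)
  have hle : ∀ (s : ℝ) (x : Plane), |s| ≤ 1 → |u x + s * φ x| ≤ |u x| + |φ x| := fun s x hs => by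
    refine (abs_add_le _ _).trans (add_le_add le_rfl ?_)
    rw [abs_mul]
    exact mul_le_of_le_one_left (abs_nonneg _) hs
  have key := hasDerivAt_integral_of_dominated_loc_of_deriv_le (μ := (volume : Measure Plane))
    (F := fun s x => |u x + s * φ x| ^ q * w x)
    (F' := fun s x => q * |u x + s * φ x| ^ (q - 2) * (u x + s * φ x) * φ x * w x)
    (bound := fun x => q * ((|u x| + |φ x|) ^ q * |w x|)) (x₀ := (0 : ℝ))
    (Metric.ball_mem_nhds 0 one_pos)
    (Eventually.of_forall fun s => (aestronglyMeasurable_abs_rpow (hm s) q).mul hw)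
    (hi.mono' ((aestronglyMeasurable_abs_rpow (hm 0) q).mul hw) (Eventually.of_forall fun x => by
      rw [norm_mul, Real.norm_of_nonneg (by positivity), Real.norm_eq_abs]
      exact mul_le_mul_of_nonneg_right (Real.rpow_le_rpow (abs_nonneg _) (hle 0 x (by simp))
        (by linarith)) (abs_nonneg _)))
    (((((aestronglyMeasurable_abs_rpow (hm 0) (q - 2)).const_mul q).mul (hm 0)).mul hφ).mul hw)
    (Eventually.of_forall fun x s hs => by
      have hs1 : |s| ≤ 1 := by simpa using (mem_ball_zero_iff.1 hs).le
      have h1 := hle s x hs1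
      have h2 : |φ x| ≤ |u x| + |φ x| := by linarith [abs_nonneg (u x)]
      have h3 : (0 : ℝ) ≤ |u x| + |φ x| := by positivity
      have h4 : (|u x| + |φ x|) ^ q =
          (|u x| + |φ x|) ^ (q - 2) * (|u x| + |φ x|) * (|u x| + |φ x|) := by
        rw [mul_assoc, ← sq, ← Real.rpow_natCast _ 2, ← Real.rpow_add_of_nonneg h3 (by linarith)
          (by positivity)]
        congr 1
        push_cast
        ring
      rw [h4]
      simp only [norm_mul, Real.norm_eq_abs, Real.abs_rpow_of_nonneg (abs_nonneg _), abs_abs,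
        abs_of_nonneg (by linarith : (0 : ℝ) ≤ q)]
      rw [mul_assoc q, mul_assoc q, mul_assoc q]
      gcongr)
    (hi.const_mul q)
    (Eventually.of_forall fun x s _ => by
      have h1 : HasDerivAt (fun s : ℝ => u x + s * φ x) (φ x) s := by
        simpa using ((hasDerivAt_id s).mul_const (φ x)).const_add (u x)
      exact ((hasDerivAt_abs_rpow (u x + s * φ x) (by linarith : 1 < q)).comp s h1).mul_const (w x))
  simp only [zero_mul, add_zero] at key
  have e : ∀ x, q * |u x| ^ (q - 2) * u x * φ x * w x =
      q * (|u x| ^ (q - 2) * u x * φ x * w x) := fun x => by ring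
  simp only [e, integral_const_mul] at key
  exact ⟨(integrable_const_mul_iff (IsUnit.mk0 q (by linarith)) _).1 key.1, key.2⟩

lemma hasDerivAt_powerTerm {p β : ℝ} (hp : 2 ≤ p) {u v φ : Plane → ℝ} (hu : MemH1 u)
    (hv : MemH1 v) (hφ : IsTest φ) :
    HasDerivAt (fun s => powerTerm p β (fun x => u x + s * φ x) v)
      (2 * p * ∫ x, (|u x| ^ (2 * p - 2) * u x + β * |v x| ^ p * |u x| ^ (p - 2) * u x) * φ x) 0 := by
  have hg : MemH1 fun x => |u x| + |φ x| := by
    obtain ⟨h1, g, h2, h3⟩ := hu.abs.1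
    obtain ⟨k1, k, k2, k3⟩ := hφ.memH1.abs.1
    exact ⟨h1.add k1, _, h2.add k2, IsWeakGradient.add h1 k1 h2 k2 h3 k3⟩
  have habs : ∀ x, |(|u x| + |φ x|)| = |u x| + |φ x| := fun x => abs_of_nonneg (by positivity)
  obtain ⟨i1, d1⟩ := hasDerivAt_integral_abs_rpow (q := 2 * p) (by linarith) hu.1.1 hφ.memLp.1
    (w := fun _ => 1) aestronglyMeasurable_const (by
      simpa only [abs_one, mul_one, habs] using hg.integrable_rpow (q := 2 * p) (by linarith))
  obtain ⟨i2, d2⟩ := hasDerivAt_integral_abs_rpow (q := p) hp hu.1.1 hφ.memLp.1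
    (w := fun x => |v x| ^ p) (aestronglyMeasurable_abs_rpow hv.1.1 p) (by
      refine (integrable_abs_mul_rpow (p := p) (by linarith) hg hv).congr
        (Eventually.of_forall fun x => ?_)
      simp only
      rw [abs_mul, Real.mul_rpow (abs_nonneg _) (abs_nonneg _), habs,
        abs_of_nonneg (by positivity : 0 ≤ |v x| ^ p)])
  simp only [mul_one] at i1 d1
  have e : ∀ x, (|u x| ^ (2 * p - 2) * u x + β * |v x| ^ p * |u x| ^ (p - 2) * u x) * φ x =
      |u x| ^ (2 * p - 2) * u x * φ x + β * (|u x| ^ (p - 2) * u x * φ x * |v x| ^ p) :=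
    fun x => by ring
  simp only [e]
  rw [integral_add i1 (i2.const_mul β), integral_const_mul]
  have hd := (d1.add_const (∫ x, |v x| ^ (2 * p))).add (d2.const_mul (2 * β))
  refine (hd.congr_of_eventuallyEq (Eventually.of_forall fun s => ?_)).congr_deriv (by ring)
  simp only [powerTerm, Pi.add_apply, abs_mul, Real.mul_rpow (abs_nonneg _) (abs_nonneg _)]

lemma hasDerivAt_pairGrad {u v φ : Plane → ℝ} (hu : MemH1 u) (hφ : IsTest φ) :
    HasDerivAt (fun s => pairGrad (fun x => u x + s * φ x) v)
      (2 * ∫ x, inner ℝ (weakGrad u x) (gradient φ x)) 0 := by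
  simp only [pairGrad, gradSq_add_smul_test hu hφ]
  set a := 2 * ∫ x, inner ℝ (weakGrad u x) (gradient φ x)
  have h := (((hasDerivAt_id (0 : ℝ)).mul_const a).const_add (gradSq u)).add
    (((hasDerivAt_id (0 : ℝ)).pow 2).mul_const (∫ x, ‖gradient φ x‖ ^ 2)) |>.add_const (gradSq v)
  simpa using h

lemma hasDerivAt_pairMass {u v φ : Plane → ℝ} (hu : MemLp u 2 volume) (hφ : IsTest φ) :
    HasDerivAt (fun s => pairMass (fun x => u x + s * φ x) v) (2 * ∫ x, u x * φ x) 0 := by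
  have e : ∀ s : ℝ, massSq (fun x => u x + s * φ x) =
      massSq u + s * (2 * ∫ x, u x * φ x) + s ^ 2 * massSq φ := fun s => by
    have i1 := hu.integrable_sq
    have i2 := (integrable_mul_test hu hφ).const_mul (s * 2)
    have i3 := hφ.memLp.integrable_sq.const_mul (s ^ 2)
    rw [massSq, massSq, massSq, ← mul_assoc, ← integral_const_mul, ← integral_const_mul,
      ← integral_add i1 i2, ← integral_add (by exact i1.add i2) i3]
    refine integral_congr_ae (Eventually.of_forall fun x => ?_)
    simp only
    ring
  simp only [pairMass, e]
  set a := 2 * ∫ x, u x * φ x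
  have h := (((hasDerivAt_id (0 : ℝ)).mul_const a).const_add (massSq u)).add
    (((hasDerivAt_id (0 : ℝ)).pow 2).mul_const (massSq φ)) |>.add_const (massSq v)
  simpa using h

/-- The density of the perturbed pair is `ρ + 2 s uφ + s² φ²`, so the energy is a polynomial of
degree four in `s` by bilinearity. Its linear coefficient is `4 B(ρ, uφ)`, where `B` is the
logarithmic form, by symmetry. -/
lemma hasDerivAt_logEnergy {lam : ℝ} (hlam : 1 ≤ lam) {u v φ : Plane → ℝ} (hu : MemW lam u)
    (hv : MemW lam v) (hφ : IsTest φ) :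
    HasDerivAt (fun s => logEnergy (fun x => u x + s * φ x) v)
      (4 * ∫ x, potential u v x * u x * φ x) 0 := by
  have hφW : MemW lam φ := hφ.memW (by linarith)
  set B : (Plane → ℝ) → (Plane → ℝ) → ℝ := kernelForm fun z => Real.log ‖z‖ with hB
  have hcomm : ∀ f g, B f g = B g f := kernelForm_comm fun z => by rw [norm_neg]
  have hadd : ∀ f g h, LogDensity lam f → LogDensity lam g → LogDensity lam h →
      B f (fun x => g x + h x) = B f g + B f h := fun f g h hf hg hh =>
    kernelForm_add_right (kernelIntegrable_log hlam hf hg) (kernelIntegrable_log hlam hf hh)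
  have hsmul : ∀ f g c, B f (fun x => c * g x) = c * B f g := fun f g c =>
    kernelForm_const_mul_right _ f g c
  set ρ := density u v with hρ
  set f : Plane → ℝ := fun x => u x * φ x with hf
  set g : Plane → ℝ := fun x => φ x * φ x with hg
  have dρ : LogDensity lam ρ := hu.logDensity hlam hv
  have df : LogDensity lam f := hu.logDensity_mul hlam hφW
  have dg : LogDensity lam g := hφW.logDensity_mul hlam hφW
  have expand : ∀ (h : Plane → ℝ) (s : ℝ), LogDensity lam h →
      B h (fun x => ρ x + (2 * s * f x + s ^ 2 * g x)) = B h ρ + (2 * s * B h f + s ^ 2 * B h g) :=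
    fun h s dh => by
      rw [hadd h _ _ dh dρ ((df.const_mul (2 * s)).add (dg.const_mul (s ^ 2))),
        hadd h _ _ dh (df.const_mul _) (dg.const_mul _), hsmul, hsmul]
  have e : ∀ s : ℝ, logEnergy (fun x => u x + s * φ x) v = B ρ ρ + s * (4 * B ρ f) +
      s ^ 2 * ((4 * B f f + 2 * B ρ g) + s * (4 * B f g) + s ^ 2 * B g g) := fun s => by
    have hW : MemW lam fun x => u x + s * φ x := MemW.add hu (MemW.smul s hφW)
    have hd : density (fun x => u x + s * φ x) v =
        fun x => ρ x + (2 * s * f x + s ^ 2 * g x) := by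
      funext x
      simp only [hρ, hf, hg, density]
      ring
    have dS : LogDensity lam fun x => ρ x + (2 * s * f x + s ^ 2 * g x) :=
      dρ.add ((df.const_mul (2 * s)).add (dg.const_mul (s ^ 2)))
    rw [logEnergy_eq hlam hW hv, hd, ← hB, expand _ s dS, hcomm _ ρ, hcomm _ f, hcomm _ g,
      expand ρ s dρ, expand f s df, expand g s dg, hcomm f ρ, hcomm g ρ, hcomm g f]
    ring
  have hpot : ∫ x, potential u v x * u x * φ x = B ρ f := by
    rw [hB, hρ, ← integral_potential_mul hlam hu hv df]
    simp only [hf, mul_assoc]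
  rw [hpot]
  simp only [e]
  have hpoly : ∀ a b c d k : ℝ, HasDerivAt
      (fun s : ℝ => a + s * b + s ^ 2 * (c + s * d + s ^ 2 * k)) b 0 := fun a b c d k => by
    have h0 := hasDerivAt_id' (0 : ℝ)
    have h2 : HasDerivAt (fun s : ℝ => s ^ 2) 0 0 := by simpa using h0.fun_pow 2
    have h := ((h0.mul_const b).const_add a).fun_add (h2.fun_mul
      (((h0.mul_const d).const_add c).fun_add (h2.mul_const k)))
    simpa using h
  exact hpoly _ _ _ _ _

/-- The curve `s ↦ (u + sφ, v)` need not lie on the manifold; each of its points is compared with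
the ground level through its projection along the fibre. The second equation follows by exchanging
the components. -/
lemma IsGround.weakEquation {p β lam : ℝ} (hp : 2 ≤ p) (hlam : 1 < lam) (hβ : 0 ≤ β)
    {u v : Plane → ℝ} (h : IsGround p β lam u v) : WeakEquation p β u v := by
  intro φ hφ
  have hu := h.memW_fst
  have hv := h.memW_snd
  have e0 : (fun x => u x + 0 * φ x) = u := by
    funext x
    ring
  have key := fibre_critical hp (hasDerivAt_pairGrad (v := v) hu.1 hφ)
    (hasDerivAt_logEnergy hlam.le hu hv hφ) (hasDerivAt_pairMass (v := v) hu.1.1 hφ)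
    (hasDerivAt_powerTerm (β := β) hp hu.1 hv.1 hφ) (by simpa only [e0] using h.mass_pos)
    (fun s => powerTerm_nonneg hβ _ _)
    (by
      simp only [e0]
      rw [← pairNehari_eq_fibre]
      exact h.nehari)
    (fun s t ht hM hJ => by
      have hW : MemW lam fun x => u x + s * φ x :=
        MemW.add hu (MemW.smul s (hφ.memW (by linarith)))
      simp only [e0]
      rw [← pairEnergy_eq_fibre, h.energy, ← pairEnergy_dilate hlam p β hW hv ht]
      refine groundLevel_le_dilate hp hlam hβ hW hv hM ht ?_
      rwa [pairNehari_dilate hlam p β hW hv ht])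
  have hp0 : p ≠ 0 := by linarith
  have e1 : ∀ I : ℝ, 1 / (2 * p) * (2 * p * I) = I := fun I => by field_simp
  rw [e1] at key
  linarith

/-! ### Weak convergence in `W^λ` -/

/-- The embedding `u ↦ (u, ∇u, √log(λ + |x|) u)` of `W^λ` into a product of `L²` spaces. -/
noncomputable def embedding {lam : ℝ} (hlam : 1 ≤ lam) : W lam →ₗ[ℝ]
    Lp ℝ 2 (volume : Measure Plane) × Lp Plane 2 (volume : Measure Plane) ×
      Lp ℝ 2 (volume : Measure Plane) where
  toFun w := (w, (memW_rep w).1.memLp_weakGrad.toLp _, ((memW_rep w).memLp_weighted hlam).toLp _)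
  map_add' w z := by
    have hw := memW_rep w
    have hz := memW_rep z
    have e : rep (w + z) =ᵐ[volume] fun x => rep w x + rep z x := Lp.coeFn_add _ _
    refine Prod.ext rfl (Prod.ext ?_ ?_)
    · simp only [Prod.snd_add, Prod.fst_add]
      rw [← MemLp.toLp_add, MemLp.toLp_eq_toLp_iff, weakGrad_congr e]
      exact weakGrad_ae_eq (hw.1.memLp_weakGrad.add hz.1.memLp_weakGrad)
        (IsWeakGradient.add hw.1.1 hz.1.1 hw.1.memLp_weakGrad hz.1.memLp_weakGrad
          hw.1.isWeakGradient hz.1.isWeakGradient)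
    · simp only [Prod.snd_add]
      rw [← MemLp.toLp_add, MemLp.toLp_eq_toLp_iff]
      filter_upwards [e] with x hx
      simp only [weighted, hx, Pi.add_apply, mul_add]
  map_smul' c w := by
    have hw := memW_rep w
    have e : rep (c • w) =ᵐ[volume] fun x => c * rep w x := Lp.coeFn_smul _ _
    refine Prod.ext rfl (Prod.ext ?_ ?_)
    · simp only [Prod.smul_snd, Prod.smul_fst, RingHom.id_apply]
      rw [← MemLp.toLp_const_smul, MemLp.toLp_eq_toLp_iff, weakGrad_congr e]
      exact weakGrad_ae_eq (hw.1.memLp_weakGrad.const_smul c) (hw.1.isWeakGradient.smul c)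
    · simp only [Prod.smul_snd, RingHom.id_apply]
      rw [← MemLp.toLp_const_smul, MemLp.toLp_eq_toLp_iff]
      filter_upwards [e] with x hx
      simp only [weighted, hx, Pi.smul_apply, smul_eq_mul]
      ring

lemma wNorm_le_norm_embedding {lam : ℝ} (hlam : 1 ≤ lam) (w : W lam) :
    wNorm w ≤ 2 * ‖embedding hlam w‖ := by
  have h1 : massSq (rep w) ≤ ‖embedding hlam w‖ ^ 2 := by
    rw [massSq_rep]
    exact pow_le_pow_left₀ (norm_nonneg _) (norm_fst_le (embedding hlam w)) 2
  have h2 : gradSq (rep w) ≤ ‖embedding hlam w‖ ^ 2 := by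
    rw [gradSq, ← norm_toLp_sq (memW_rep w).1.memLp_weakGrad]
    exact pow_le_pow_left₀ (norm_nonneg _)
      ((norm_fst_le (embedding hlam w).2).trans (norm_snd_le (embedding hlam w))) 2
  have h3 : logSq lam (rep w) ≤ ‖embedding hlam w‖ ^ 2 := by
    have e := norm_toLp_sq ((memW_rep w).memLp_weighted hlam)
    simp only [Real.norm_eq_abs, sq_abs, integral_weighted_sq hlam] at e
    rw [← e]
    exact pow_le_pow_left₀ (norm_nonneg _)
      ((norm_snd_le (embedding hlam w).2).trans (norm_snd_le (embedding hlam w))) 2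
  refine Real.sqrt_le_iff.2 ⟨by positivity, ?_⟩
  nlinarith [sq_nonneg ‖embedding hlam w‖]

/-- A linear functional dominated by the norm of an injective linear map extends continuously. -/
lemma exists_strongDual_comp_eq {V E : Type*} [AddCommGroup V] [Module ℝ V] [NormedAddCommGroup E]
    [NormedSpace ℝ E] {T : V →ₗ[ℝ] E} (hT : Function.Injective T) {ℓ : V →ₗ[ℝ] ℝ} {C : ℝ}
    (hℓ : ∀ z, |ℓ z| ≤ C * ‖T z‖) : ∃ G : StrongDual ℝ E, ∀ z, ℓ z = G (T z) := by
  let e := LinearEquiv.ofInjective T hT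
  have hb : ∀ x, ‖(ℓ ∘ₗ e.symm.toLinearMap) x‖ ≤ C * ‖x‖ := fun x => by
    obtain ⟨z, rfl⟩ := e.surjective x
    simpa [e] using hℓ z
  obtain ⟨G, hG, -⟩ := exists_extension_norm_eq (𝕜 := ℝ) (LinearMap.range T)
    ((ℓ ∘ₗ e.symm.toLinearMap).mkContinuous C hb)
  refine ⟨G, fun z => ?_⟩
  have h := hG (e z)
  simp only [LinearMap.mkContinuous_apply, LinearMap.comp_apply, LinearEquiv.coe_coe,
    LinearEquiv.symm_apply_apply] at h
  exact h.symm

/-- Bounded linear functionals on `W^λ` are represented by triples of `L²` functions. -/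
lemma exists_representation {lam : ℝ} (hlam : 1 ≤ lam) {ℓ : W lam →ₗ[ℝ] ℝ} {C : ℝ}
    (hℓ : ∀ z, |ℓ z| ≤ C * wNorm z) : ∃ (f : Plane → ℝ) (g : Plane → Plane) (h : Plane → ℝ),
      MemLp f 2 volume ∧ MemLp g 2 volume ∧ MemLp h 2 volume ∧
      ∀ z : W lam, ℓ z = (∫ x, inner ℝ (rep z x) (f x)) +
        (∫ x, inner ℝ (weakGrad (rep z) x) (g x)) +
          ∫ x, inner ℝ (weighted lam (rep z) x) (h x) := by
  have hb : ∀ z, |ℓ z| ≤ |C| * 2 * ‖embedding hlam z‖ := fun z => by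
    refine (hℓ z).trans ((mul_le_mul_of_nonneg_right (le_abs_self C) (Real.sqrt_nonneg _)).trans ?_)
    rw [mul_assoc]
    exact mul_le_mul_of_nonneg_left (wNorm_le_norm_embedding hlam z) (abs_nonneg C)
  obtain ⟨G, hG⟩ := exists_strongDual_comp_eq (fun w z h => Subtype.ext (congrArg Prod.fst h)) hb
  let G₁ := G.comp (ContinuousLinearMap.inl ℝ _ _)
  let G₂ := (G.comp (ContinuousLinearMap.inr ℝ _ _)).comp (ContinuousLinearMap.inl ℝ _ _)
  let G₃ := (G.comp (ContinuousLinearMap.inr ℝ _ _)).comp (ContinuousLinearMap.inr ℝ _ _)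
  let f := (InnerProductSpace.toDual ℝ (Lp ℝ 2 (volume : Measure Plane))).symm G₁
  let g := (InnerProductSpace.toDual ℝ (Lp Plane 2 (volume : Measure Plane))).symm G₂
  let h := (InnerProductSpace.toDual ℝ (Lp ℝ 2 (volume : Measure Plane))).symm G₃
  refine ⟨f, g, h, Lp.memLp f, Lp.memLp g, Lp.memLp h, fun z => ?_⟩
  have hz := memW_rep z
  rw [← inner_toLp hz.1.1 (Lp.memLp f), ← inner_toLp hz.1.memLp_weakGrad (Lp.memLp g),
    ← inner_toLp (hz.memLp_weighted hlam) (Lp.memLp h), Lp.toLp_coeFn, Lp.toLp_coeFn,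
    Lp.toLp_coeFn, Lp.toLp_coeFn, real_inner_comm, real_inner_comm g, real_inner_comm h,
    InnerProductSpace.toDual_symm_apply, InnerProductSpace.toDual_symm_apply,
    InnerProductSpace.toDual_symm_apply, hG]
  simp only [G₁, G₂, G₃, ContinuousLinearMap.comp_apply, ContinuousLinearMap.inl_apply,
    ContinuousLinearMap.inr_apply, ← map_add]
  congr 1
  simp [embedding]

lemma WWeakTendsto.congr_left {lam : ℝ} {u : ℕ → Plane → ℝ} {a b : Plane → ℝ}
    (h : WWeakTendsto lam u a) (hab : a =ᵐ[volume] b) : WWeakTendsto lam u b :=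
  ⟨h.fn.congr_right hab, weakGrad_congr hab ▸ h.grad,
    h.weight.congr_right (hab.mono fun x hx => by simp only [weighted, hx])⟩

/-- A bounded sequence of `W^λ` that converges in `L²` converges weakly in `W^λ`. -/
lemma weakTendsto_of_massSq {lam : ℝ} (hlam : 1 < lam) {z : ℕ → W lam} {w₀ : W lam} {K : ℝ}
    (hK : ∀ n, wSq lam (rep (z n)) ≤ K)
    (h0 : Tendsto (fun n => massSq fun x => rep (z n) x - rep w₀ x) atTop (𝓝 0)) :
    WeakTendsto z atTop w₀ := by
  rintro ℓ ⟨C, hℓ⟩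
  obtain ⟨f, g, h, hf, hg, hh, hrep⟩ := exists_representation hlam.le hℓ
  -- Every subsequence has a further one converging weakly in all three components, and `L²`
  -- convergence identifies the limit. As functionals are triples of `L²` pairings, this suffices.
  refine tendsto_of_subseq_tendsto fun ns hns => ?_
  obtain ⟨k, a, hk, ha, hw⟩ := exists_wWeakTendsto hlam (u := fun n => rep (z (ns n)))
    (fun n => memW_rep _) fun n => hK _
  have hae : a =ᵐ[volume] rep w₀ := by
    refine ae_eq_of_test ha.1.1 (memW_rep w₀).1.1 fun φ hφ => ?_
    refine tendsto_nhds_unique (hw.fn.tendsto_mul hφ.memLp) ?_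
    rw [tendsto_iff_norm_sub_tendsto_zero]
    have hsub := h0.comp (hns.comp hk.tendsto_atTop)
    have hlim := ((Real.continuous_sqrt.tendsto 0).comp hsub).mul_const √(massSq φ)
    rw [Real.sqrt_zero, zero_mul] at hlim
    refine squeeze_zero (fun n => norm_nonneg _) (fun n => ?_) hlim
    rw [← integral_sub (integrable_mul_test (memW_rep _).1.1 hφ)
      (integrable_mul_test (memW_rep w₀).1.1 hφ)]
    simp only [← sub_mul]
    exact abs_integral_mul_le ((memW_rep (z (ns (k n)))).1.1.sub (memW_rep w₀).1.1) hφ.memLp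
  have hw' := hw.congr_left hae
  refine ⟨k, ?_⟩
  simp only [hrep]
  exact ((hw'.fn f hf).add (hw'.grad g hg)).add (hw'.weight h hh)

/-! ### Minimal solutions -/

lemma IsGround.isMinimalSolution {p β lam : ℝ} (hp : 2 ≤ p) (hlam : 1 < lam) (hβ : 0 ≤ β)
    {w : W lam × W lam} (h : IsGround p β lam (rep w.1) (rep w.2)) (h1 : ∀ᵐ x, 0 ≤ rep w.1 x)
    (h2 : ∀ᵐ x, 0 ≤ rep w.2 x) : IsMinimalSolution p β w :=
  ⟨h1, h2, ⟨h.weakEquation hp hlam hβ, h.swap.weakEquation hp hlam hβ⟩,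
    ⟨pairMass_rep_pos.1 h.mass_pos, h.nehari⟩, h.energy⟩

lemma IsGround.congr {p β lam : ℝ} {u v u' v' : Plane → ℝ} (h : IsGround p β lam u v)
    (hu : u =ᵐ[volume] u') (hv : v =ᵐ[volume] v') : IsGround p β lam u' v' :=
  ⟨h.memW_fst.congr hu, h.memW_snd.congr hv, pairMass_congr hu hv ▸ h.mass_pos,
    pairNehari_congr (p := p) (β := β) hu hv ▸ h.nehari,
    pairEnergy_congr (p := p) (β := β) hu hv ▸ h.energy⟩

lemma IsGround.isMinimalSolution_toW {p β lam : ℝ} (hp : 2 ≤ p) (hlam : 1 < lam) (hβ : 0 ≤ β)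
    {u v : Plane → ℝ} (h : IsGround p β lam u v) (hu : ∀ x, 0 ≤ u x) (hv : ∀ x, 0 ≤ v x) :
    IsMinimalSolution p β (toW h.memW_fst, toW h.memW_snd) := by
  have e1 := rep_toW h.memW_fst
  have e2 := rep_toW h.memW_snd
  exact (h.congr e1.symm e2.symm).isMinimalSolution hp hlam hβ
    (e1.mono fun x hx => (hu x).trans_eq hx.symm) (e2.mono fun x hx => (hv x).trans_eq hx.symm)

lemma exists_isMinimalSolution {p β lam : ℝ} (hp : 2 ≤ p) (hlam : 1 < lam) (hβ : 0 ≤ β) :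
    ∃ w : W lam × W lam, IsMinimalSolution p β w := by
  obtain ⟨u, v, h⟩ := exists_isGround hp hlam hβ
  exact ⟨_, (h.abs hp hlam hβ).isMinimalSolution_toW hp hlam hβ (fun x => abs_nonneg _)
    fun x => abs_nonneg _⟩

lemma IsMinimalSolution.isGround {p β lam : ℝ} {w : W lam × W lam} (h : IsMinimalSolution p β w) :
    IsGround p β lam (rep w.1) (rep w.2) :=
  ⟨memW_rep _, memW_rep _, pairMass_rep_pos.2 h.mem_manifold.1, h.mem_manifold.2, h.energy_eq⟩

/-! ### Semitrivial minimizers for small coupling -/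

lemma add_rpow_superadditive {r a b : ℝ} (hr : 1 ≤ r) (ha : 0 ≤ a) (hb : 0 ≤ b) :
    a ^ r + b ^ r ≤ (a + b) ^ r := by
  exact_mod_cast NNReal.add_rpow_le_rpow_add ⟨a, ha⟩ ⟨b, hb⟩ hr

/-- With exponent `p / 2 ≥ 1` applied to `(a² + b²)² = a⁴ + b⁴ + 2 (ab)²`, superadditivity gives the
pure powers plus `2^(p/2) |ab|^p`, and `2β ≤ 2 ≤ 2^(p/2)`. -/
lemma coupling_le {p β : ℝ} (hp : 2 ≤ p) (hβ1 : β ≤ 1) (a b : ℝ) :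
    |a| ^ (2 * p) + |b| ^ (2 * p) + 2 * β * |a * b| ^ p ≤ |√(a ^ 2 + b ^ 2)| ^ (2 * p) := by
  have hr : 1 ≤ p / 2 := by linarith
  have e4 : ∀ c : ℝ, |c| ^ (2 * p) = ((c ^ 2) ^ 2) ^ (p / 2) := fun c => by
    rw [← sq_abs c, ← pow_mul, ← Real.rpow_natCast, ← Real.rpow_mul (abs_nonneg c)]
    congr 1
    push_cast
    ring
  have e2 : |a * b| ^ p = ((a * b) ^ 2) ^ (p / 2) := by
    rw [← sq_abs (a * b), ← Real.rpow_natCast, ← Real.rpow_mul (abs_nonneg _)]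
    congr 1
    push_cast
    ring
  rw [e4, e4, e4, e2, Real.sq_sqrt (by positivity),
    show (a ^ 2 + b ^ 2) ^ 2 = (a ^ 2) ^ 2 + (b ^ 2) ^ 2 + 2 * (a * b) ^ 2 by ring]
  have h1 := add_rpow_superadditive hr (sq_nonneg (a ^ 2)) (sq_nonneg (b ^ 2))
  have h2 := add_rpow_superadditive hr
    (add_nonneg (sq_nonneg (a ^ 2)) (sq_nonneg (b ^ 2))) (by positivity : 0 ≤ 2 * (a * b) ^ 2)
  have h3 : (2 : ℝ) ≤ 2 ^ (p / 2) := Real.self_le_rpow_of_one_le one_le_two hr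
  have h4 : 0 ≤ ((a * b) ^ 2) ^ (p / 2) := by positivity
  rw [Real.mul_rpow two_pos.le (sq_nonneg _)] at h2
  nlinarith [mul_le_mul_of_nonneg_right h3 h4, mul_nonneg (sub_nonneg.2 hβ1) h4]

lemma gradSq_zero : gradSq (fun _ => 0) = 0 := by
  rw [gradSq_eq (g := fun _ => 0) MemLp.zero fun φ _ i => by simp]
  simp

lemma massSq_zero : massSq (fun _ => 0) = 0 := by simp [massSq]

lemma powerTerm_zero_right {p : ℝ} (hp : 2 ≤ p) (β : ℝ) (u : Plane → ℝ) :
    powerTerm p β u (fun _ => 0) = ∫ x, |u x| ^ (2 * p) := by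
  simp [powerTerm, Real.zero_rpow (by linarith : p ≠ 0), Real.zero_rpow (by linarith : 2 * p ≠ 0)]

lemma pairNehari_zero_right {p : ℝ} (hp : 2 ≤ p) (β β' : ℝ) (u : Plane → ℝ) :
    pairNehari p β u (fun _ => 0) = pairNehari p β' u (fun _ => 0) := by
  rw [pairNehari, pairNehari, powerTerm_zero_right hp, powerTerm_zero_right hp]

lemma pairEnergy_zero_right {p : ℝ} (hp : 2 ≤ p) (β β' : ℝ) (u : Plane → ℝ) :
    pairEnergy p β u (fun _ => 0) = pairEnergy p β' u (fun _ => 0) := by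
  rw [pairEnergy, pairEnergy, powerTerm_zero_right hp, powerTerm_zero_right hp]

lemma dilate_zero (t : ℝ) : dilate t (fun _ => 0) = fun _ => 0 := by
  funext x
  simp [dilate]

lemma fibreEnergy_mono {p A A' V M P P' t : ℝ} (hp : 2 ≤ p) (ht : 0 < t) (hA : A ≤ A')
    (hP : P' ≤ P) : fibreEnergy p A V M P t ≤ fibreEnergy p A' V M P' t := by
  have h1 : t ^ 4 * A ≤ t ^ 4 * A' := mul_le_mul_of_nonneg_left hA (by positivity)
  have h2 : t ^ (4 * p - 2) * P' ≤ t ^ (4 * p - 2) * P :=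
    mul_le_mul_of_nonneg_left hP (by positivity)
  have h3 := mul_le_mul_of_nonneg_left h2 (by positivity : 0 ≤ 1 / (2 * p))
  unfold fibreEnergy
  linarith

lemma MemW.sqrt_add_sq {lam : ℝ} {u v : Plane → ℝ} (hu : MemW lam u) (hv : MemW lam v) :
    MemW lam fun x => √(u x ^ 2 + v x ^ 2) := by
  refine ⟨(hu.1.sqrt_add_sq hv.1).1, (hu.2.add hv.2).congr (Eventually.of_forall fun x => ?_)⟩
  simp only [Pi.add_apply]
  rw [Real.sq_sqrt (by positivity), mul_add]

/-- For weak coupling the semitrivial pairs reach the ground level. -/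
lemma IsGround.exists_semitrivial {p β lam : ℝ} (hp : 2 ≤ p) (hlam : 1 < lam) (hβ : 0 ≤ β)
    (hβ1 : β ≤ 1) {u v : Plane → ℝ} (h : IsGround p β lam u v) :
    ∃ U : Plane → ℝ, (∀ x, 0 ≤ U x) ∧ MemW lam U ∧ 0 < pairMass U (fun _ => 0) ∧
      pairNehari p 0 U (fun _ => 0) = 0 ∧ pairEnergy p 0 U (fun _ => 0) ≤ groundLevel p β lam := by
  have hu := h.memW_fst
  have hv := h.memW_snd
  set z : Plane → ℝ := fun x => √(u x ^ 2 + v x ^ 2) with hz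
  have hzW : MemW lam z := hu.sqrt_add_sq hv
  have h0 := MemW.zero lam
  have hsq : ∀ x, z x ^ 2 = u x ^ 2 + v x ^ 2 := fun x => Real.sq_sqrt (by positivity)
  have hM : pairMass z (fun _ => 0) = pairMass u v := by
    rw [pairMass, massSq_zero, add_zero, massSq]
    simp only [hsq]
    exact integral_add hu.1.1.integrable_sq hv.1.1.integrable_sq
  have hV : logEnergy z (fun _ => 0) = logEnergy u v := by
    simp [logEnergy, hsq]
  have hA : pairGrad z (fun _ => 0) ≤ pairGrad u v := by
    rw [pairGrad, gradSq_zero, add_zero]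
    exact (hu.1.sqrt_add_sq hv.1).2
  have hP : powerTerm p β u v ≤ powerTerm p 0 z (fun _ => 0) := by
    have i1 := hu.1.integrable_rpow (q := 2 * p) (by linarith)
    have i2 := hv.1.integrable_rpow (q := 2 * p) (by linarith)
    have i3 := (integrable_abs_mul_rpow (p := p) (by linarith) hu.1 hv.1).const_mul (2 * β)
    rw [powerTerm_zero_right hp, powerTerm, ← integral_const_mul, ← integral_add i1 i2,
      ← integral_add (by exact i1.add i2) i3]
    exact integral_mono ((i1.add i2).add i3) (hzW.1.integrable_rpow (by linarith))
      fun x => coupling_le hp hβ1 _ _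
  have hMz : 0 < pairMass z (fun _ => 0) := hM ▸ h.mass_pos
  obtain ⟨t, ht, hJ⟩ := exists_dilate_nehari_eq_zero hp hlam le_rfl hzW h0 hMz (β := 0)
  have hmass := pairMass_dilate z (fun _ => 0) ht
  have hen := pairEnergy_dilate hlam p 0 hzW h0 ht
  rw [dilate_zero] at hJ hmass hen
  refine ⟨dilate t z, fun x => ?_, memW_dilate hlam hzW ht, ?_, hJ, ?_⟩
  · exact mul_nonneg (sq_nonneg t) (Real.sqrt_nonneg _)
  · rw [hmass]
    positivity
  · rw [hen, hM, hV, ← h.energy, pairEnergy_eq_fibre]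
    -- At the parameter `t` that projects `(z, 0)`, its energy is at most that of the fibre of `(u,
    -- v)`, whose maximum is attained at `1`.
    refine (fibreEnergy_mono hp ht hA hP).trans
      (fibreEnergy_le_one hp (powerTerm_nonneg hβ u v) ht ?_)
    rw [← pairNehari_eq_fibre]
    exact h.nehari

/-- There is a nonnegative semitrivial pair that is a minimizer for every coupling in `[0, 1]`. -/
lemma exists_semitrivial_isGround {p lam : ℝ} (hp : 2 ≤ p) (hlam : 1 < lam) :
    ∃ U : Plane → ℝ, (∀ x, 0 ≤ U x) ∧ (∀ β, 0 ≤ β → groundLevel p β lam ≤ groundLevel p 0 lam) ∧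
      ∀ β, 0 ≤ β → β ≤ 1 → IsGround p β lam U (fun _ => 0) := by
  obtain ⟨u, v, h⟩ := exists_isGround (β := 0) hp hlam le_rfl
  obtain ⟨U, hU, hW, hM, hJ, hI⟩ := h.exists_semitrivial hp hlam le_rfl zero_le_one
  -- A semitrivial pair lies on every manifold with the same energy, so the decoupled level bounds
  -- all others from above.
  have hle : ∀ β, 0 ≤ β → groundLevel p β lam ≤ groundLevel p 0 lam := fun β hβ =>
    (groundLevel_le hp hβ hW (MemW.zero lam) hM (pairNehari_zero_right hp β 0 U ▸ hJ)).trans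
      (pairEnergy_zero_right hp β 0 U ▸ hI)
  refine ⟨U, hU, hle, fun β hβ hβ1 => ⟨hW, MemW.zero lam, hM, pairNehari_zero_right hp β 0 U ▸ hJ, ?_⟩⟩
  refine le_antisymm ?_ (groundLevel_le hp hβ hW (MemW.zero lam) hM
    (pairNehari_zero_right hp β 0 U ▸ hJ))
  rw [pairEnergy_zero_right hp β 0]
  refine hI.trans ?_
  -- The reverse inequality for `β ≤ 1`: a minimizer for `β` yields a semitrivial competitor on
  -- `M_0` of no larger energy.
  obtain ⟨u', v', h'⟩ := exists_isGround hp hlam hβ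
  obtain ⟨U', -, hW', hM', hJ', hI'⟩ := h'.exists_semitrivial hp hlam hβ hβ1
  exact (groundLevel_le hp le_rfl hW' (MemW.zero lam) hM' hJ').trans hI'

/-! ### Strong coupling -/

/-- The power term is dropped, and `-t log t ≤ 1` on `(0, 1]` tames the logarithm, so the bound does
not depend on `P` and thus not on `β`. -/
lemma fibreEnergy_le_mul {p A V M P t : ℝ} (hp : 2 ≤ p) (hP : 0 ≤ P) (ht : 0 < t)
    (ht1 : t ≤ 1) : fibreEnergy p A V M P t ≤ (|A| + |V| + M ^ 2) * t := by
  have h1 : 0 ≤ 1 / (2 * p) * (t ^ (4 * p - 2) * P) := by positivity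
  have h2 : -(Real.log t * t) ≤ 1 :=
    (neg_le_abs _).trans (Real.abs_log_mul_self_lt t ht ht1).le
  have h3 : t ^ 4 ≤ t := by simpa using pow_le_pow_of_le_one ht.le ht1 (by norm_num : 1 ≤ 4)
  have h4 : t ^ 3 ≤ t := by simpa using pow_le_pow_of_le_one ht.le ht1 (by norm_num : 1 ≤ 3)
  have h5 : ∀ c : ℝ, t ^ 4 * c ≤ t * |c| := fun c =>
    (mul_le_mul_of_nonneg_left (le_abs_self c) (by positivity)).trans
      (mul_le_mul_of_nonneg_right h3 (abs_nonneg c))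
  have h6 : -(t ^ 4 * (Real.log t * M ^ 2)) ≤ t * M ^ 2 := by
    have h7 := mul_le_mul_of_nonneg_left h2 (by positivity : 0 ≤ t ^ 3)
    have h8 := mul_le_mul_of_nonneg_right (h7.trans ((mul_one _).trans_le h4)) (sq_nonneg M)
    linarith
  have hA := h5 A
  have hV := h5 V
  have hA0 := mul_nonneg ht.le (abs_nonneg A)
  have hV0 := mul_nonneg ht.le (abs_nonneg V)
  have hM0 := mul_nonneg ht.le (sq_nonneg M)
  unfold fibreEnergy
  linarith

lemma exists_test_coupling_pos {p : ℝ} (hp : 2 ≤ p) :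
    ∃ φ : Plane → ℝ, IsTest φ ∧ 0 < massSq φ ∧ 0 < ∫ x, |φ x * φ x| ^ p := by
  obtain ⟨φ, hφ, hpos⟩ := exists_test_massSq_pos
  refine ⟨φ, hφ, hpos, (integral_nonneg fun x => by positivity).lt_of_ne fun h0 => hpos.ne' ?_⟩
  rw [eq_comm, integral_eq_zero_iff_of_nonneg (fun x => by positivity)
    (integrable_abs_mul_rpow (by linarith) hφ.memH1 hφ.memH1)] at h0
  refine integral_eq_zero_of_ae (h0.mono fun x hx => ?_)
  have h1 := (Real.rpow_eq_zero (abs_nonneg _) (by linarith)).1 hx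
  rw [abs_eq_zero] at h1
  simp only [Pi.zero_apply, sq, h1]

/-- For a fixed pair `(φ, φ)` the power term grows linearly in `β`, so at any given small parameter
the reduced function is eventually negative. By monotonicity the projection parameter lies below,
where the energy is small uniformly in `β`. -/
lemma tendsto_groundLevel {p lam : ℝ} (hp : 2 ≤ p) (hlam : 1 < lam) :
    Tendsto (fun β => groundLevel p β lam) atTop (𝓝 0) := by
  obtain ⟨φ, hφ, hm, hQ⟩ := exists_test_coupling_pos hp
  have hW : MemW lam φ := hφ.memW (by linarith)
  have hM : 0 < pairMass φ φ := add_pos hm hm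
  set A := pairGrad φ φ
  set V := logEnergy φ φ
  set M := pairMass φ φ
  set Q := ∫ x, |φ x * φ x| ^ p
  set K := |A| + |V| + M ^ 2 with hK
  have hK0 : 0 < K := by positivity
  rw [Metric.tendsto_nhds]
  intro δ hδ
  set ε := min 1 (δ / (2 * K)) with hε
  have hε0 : 0 < ε := lt_min one_pos (by positivity)
  have hε1 : ε ≤ 1 := min_le_left _ _
  have hεδ : K * ε < δ := by
    have : K * ε ≤ K * (δ / (2 * K)) := mul_le_mul_of_nonneg_left (min_le_right _ _) hK0.le
    have e : K * (δ / (2 * K)) = δ / 2 := by field_simp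
    linarith
  set b := (4 * p - 2) / (2 * p) * (2 * Q) * ε ^ (4 * p - 6) with hb
  have hc : 0 < (4 * p - 2) / (2 * p) := div_pos (by linarith) (by linarith)
  have hb0 : 0 < b := by positivity
  filter_upwards [eventually_ge_atTop 0, (tendsto_id.const_mul_atTop hb0).eventually_gt_atTop
    (fibreReduced p A V M (powerTerm p 0 φ φ) ε)] with β hβ hlarge
  have hP := powerTerm_nonneg (p := p) hβ φ φ
  have hneg : fibreReduced p A V M (powerTerm p β φ φ) ε < 0 := by
    have e : powerTerm p β φ φ = powerTerm p 0 φ φ + 2 * β * Q := by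
      simp only [powerTerm, Q]
      ring
    have e2 : fibreReduced p A V M (powerTerm p β φ φ) ε =
        fibreReduced p A V M (powerTerm p 0 φ φ) ε - b * β := by
      rw [e, hb]
      simp only [fibreReduced]
      ring
    rw [e2]
    simp only [id] at hlarge
    linarith
  obtain ⟨t, ht, h0⟩ := exists_fibreReduced_eq_zero (A := A) (V := V) hp hM hP
  have htε : t ≤ ε := by
    by_contra! hlt
    have := fibreReduced_lt (A := A) (V := V) hp hM hP hε0 hlt
    linarith
  have hle : groundLevel p β lam ≤ K * t := by
    refine (groundLevel_le_dilate hp hlam hβ hW hW hM ht ?_).trans ?_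
    · rwa [pairNehari_dilate hlam p β hW hW ht, fibreNehari_eq_zero_iff ht]
    · rw [pairEnergy_dilate hlam p β hW hW ht]
      exact fibreEnergy_le_mul hp hP ht (htε.trans hε1)
  have hnn : 0 ≤ groundLevel p β lam := by
    refine Real.sInf_nonneg ?_
    rintro _ ⟨w, hw, rfl⟩
    exact energy_nonneg_of_mem hp hβ hw
  rw [dist_zero_right, Real.norm_of_nonneg hnn]
  exact (hle.trans (mul_le_mul_of_nonneg_left htε hK0.le)).trans_lt hεδ

lemma IsMinimalSolution.massSq_le {p β lam : ℝ} (hp : 2 ≤ p) (hβ : 0 ≤ β) {w : W lam × W lam}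
    (h : IsMinimalSolution p β w) :
    massSq (rep w.1) + massSq (rep w.2) ≤ 4 * √(groundLevel p β lam) := by
  have hred := h.isGround.pairReduced hp
  have hP : 0 ≤ (2 * p - 3) / (4 * p) * powerTerm p β (rep w.1) (rep w.2) :=
    mul_nonneg (div_nonneg (by linarith) (by linarith)) (powerTerm_nonneg hβ _ _)
  rw [pairReduced] at hred
  have h1 : (pairMass (rep w.1) (rep w.2) / 4) ^ 2 ≤ groundLevel p β lam := by
    linarith
  have h2 := Real.le_sqrt_of_sq_le h1
  rw [pairMass] at h2
  linarith

lemma tendsto_norm_of_massSq_le {p lam : ℝ} (hp : 2 ≤ p) (hlam : 1 < lam) {w : ℝ → W lam}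
    (h : ∀ β, 0 ≤ β → massSq (rep (w β)) ≤ 4 * √(groundLevel p β lam)) :
    Tendsto (fun β => ‖(w β : Lp ℝ 2 (volume : Measure Plane))‖) atTop (𝓝 0) := by
  have h1 := ((Real.continuous_sqrt.tendsto 0).comp (tendsto_groundLevel hp hlam)).const_mul 4
  rw [Real.sqrt_zero, mul_zero] at h1
  have h2 := (Real.continuous_sqrt.tendsto 0).comp h1
  rw [Real.sqrt_zero] at h2
  refine squeeze_zero' (Eventually.of_forall fun β => norm_nonneg _) ?_ h2
  filter_upwards [eventually_ge_atTop 0] with β hβ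
  refine Real.le_sqrt_of_sq_le ?_
  rw [← massSq_rep]
  exact h β hβ

/-! ### Vanishing coupling -/

lemma wSq_congr {lam : ℝ} {u v : Plane → ℝ} (h : u =ᵐ[volume] v) : wSq lam u = wSq lam v := by
  rw [wSq, gradSq_congr h, massSq_congr h, logSq_congr h, wSq]

lemma weakTendsto_toW {lam : ℝ} (hlam : 1 < lam) {u : ℕ → Plane → ℝ} {a : Plane → ℝ} {K : ℝ}
    (hu : ∀ n, MemW lam (u n)) (ha : MemW lam a) (hK : ∀ n, wSq lam (u n) ≤ K)
    (h : Tendsto (fun n => massSq fun x => u n x - a x) atTop (𝓝 0)) :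
    WeakTendsto (fun n => toW (hu n)) atTop (toW ha) := by
  refine weakTendsto_of_massSq hlam (K := K) (fun n => ?_) (h.congr fun n => ?_)
  · rw [wSq_congr (rep_toW (hu n))]
    exact hK n
  · refine massSq_congr ?_
    filter_upwards [rep_toW (hu n), rep_toW ha] with x h1 h2
    rw [h1, h2]

/-- Minimizers for every `β_n` have reduced energy at most `c_0`, which is the only bound needed for
compactness. The limit has reduced energy at most `c_0` as well and is therefore a minimizer for `β
= 0`. -/
lemma exists_translate_weakTendsto {p lam : ℝ} (hp : 2 ≤ p) (hlam : 1 < lam) {β : ℕ → ℝ}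
    {w : ℕ → W lam × W lam} (hβ0 : ∀ n, 0 ≤ β n) (hβ : Tendsto β atTop (𝓝 0))
    (hw : ∀ n, IsMinimalSolution p (β n) (w n)) :
    ∃ (k : ℕ → ℕ) (y : ℕ → Plane) (z : ℕ → W lam × W lam) (w₀ : W lam × W lam),
      StrictMono k ∧
      (∀ n, IsTranslate (z n).1 (w (k n)).1 (y n) ∧ IsTranslate (z n).2 (w (k n)).2 (y n)) ∧
      w₀ ∈ manifold p 0 lam ∧
      WeakTendsto (fun n => (z n).1) atTop w₀.1 ∧
      WeakTendsto (fun n => (z n).2) atTop w₀.2 ∧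
      energy p 0 w₀ = groundLevel p 0 lam := by
  obtain ⟨-, -, hle, -⟩ := exists_semitrivial_isGround hp hlam
  have hg := fun n => (hw n).isGround
  have hred : ∀ n, pairReduced p (β n) (rep (w n).1) (rep (w n).2) ≤ groundLevel p 0 lam :=
    fun n => ((hg n).pairReduced hp).trans_le (hle _ (hβ0 n))
  obtain ⟨k, y, a, b, K, hk, ha, hb, hua, hvb, hma, hmb, hM, hJ, hlim⟩ :=
    exists_translate_limit hp hlam hβ0 hβ (fun n => (hg n).memW_fst) (fun n => (hg n).memW_snd)
      (fun n => (hg n).mass_pos) (fun n => (hg n).nehari.le) hred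
  have h0 : IsGround p 0 lam a b := isGround_of_pairReduced_le hp hlam le_rfl ha hb hM hJ
    (le_of_tendsto' hlim fun n => hred _)
  have h1 := fun n => (hg (k n)).memW_fst.comp_sub_right hlam.le (y n)
  have h2 := fun n => (hg (k n)).memW_snd.comp_sub_right hlam.le (y n)
  exact ⟨k, y, fun n => (toW (h1 n), toW (h2 n)), (toW ha, toW hb), hk,
    fun n => ⟨rep_toW (h1 n), rep_toW (h2 n)⟩, toW_mem_manifold ha hb hM h0.nehari,
    weakTendsto_toW hlam h1 ha hua hma, weakTendsto_toW hlam h2 hb hvb hmb,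
    (energy_toW p 0 ha hb).trans h0.energy⟩

/-- The family equals one fixed semitrivial minimizer for `β ≤ 1` and is arbitrary beyond, so it is
eventually constant as `β → 0⁺`. -/
lemma exists_minimal_family {p lam : ℝ} (hp : 2 ≤ p) (hlam : 1 < lam) :
    ∃ w : ℝ → W lam × W lam,
      (∀ β : ℝ, 0 ≤ β → IsMinimalSolution p β (w β)) ∧
      ∃ w₀ ∈ manifold p 0 lam,
        WeakTendsto (fun β => (w β).1) (𝓝[>] 0) w₀.1 ∧
        WeakTendsto (fun β => (w β).2) (𝓝[>] 0) w₀.2 ∧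
        energy p 0 w₀ = groundLevel p 0 lam := by
  classical
  obtain ⟨U, hU, -, hG⟩ := exists_semitrivial_isGround hp hlam
  have hG0 := hG 0 le_rfl zero_le_one
  set w₀ : W lam × W lam := (toW hG0.memW_fst, toW hG0.memW_snd) with hw₀
  have hmin : ∀ β, 0 ≤ β → β ≤ 1 → IsMinimalSolution p β w₀ := fun β hβ hβ1 =>
    (hG β hβ hβ1).isMinimalSolution_toW hp hlam hβ hU fun _ => le_rfl
  have hex : ∀ β : ℝ, ∃ z : W lam × W lam, 0 ≤ β → IsMinimalSolution p β z := fun β => by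
    by_cases hβ : 0 ≤ β
    · obtain ⟨z, hz⟩ := exists_isMinimalSolution hp hlam hβ
      exact ⟨z, fun _ => hz⟩
    · exact ⟨0, fun h => absurd h hβ⟩
  choose z hz using hex
  have hev : ∀ᶠ β : ℝ in 𝓝[>] 0, (if β ≤ 1 then w₀ else z β) = w₀ := by
    filter_upwards [mem_nhdsWithin_of_mem_nhds (Iio_mem_nhds (zero_lt_one' ℝ))] with β hβ
    exact if_pos (le_of_lt hβ)
  refine ⟨fun β => if β ≤ 1 then w₀ else z β, fun β hβ => ?_, w₀, (hmin 0 le_rfl zero_le_one).mem_manifold,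
    fun ℓ _ => ?_, fun ℓ _ => ?_, (hmin 0 le_rfl zero_le_one).energy_eq⟩
  · simp only
    split_ifs with h
    · exact hmin β hβ h
    · exact hz β hβ
  · exact tendsto_const_nhds.congr' (hev.mono fun β hβ => by simp only [hβ])
  · exact tendsto_const_nhds.congr' (hev.mono fun β hβ => by simp only [hβ])

end HartreeFock

/-! ### The main theorem -/

theorem theorem1p1 (p lam : ℝ) (hp : 2 ≤ p) (hlam : Real.exp (1 / 4) < lam) :
    -- for every `β ≥ 0`, the infimum `c_β` is finite and attained on `M_β`
    (∀ β : ℝ, 0 ≤ β → IsLeast (energy p β '' manifold p β lam) (groundLevel p β lam)) ∧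
    -- nonnegative weak solutions on `M_β` at level `c_β` exist for every `β ≥ 0`, and can be chosen
    -- so as to converge weakly, as `β → 0⁺`, to a minimizer of `I_0` on `M_0`
    (∃ w : ℝ → W lam × W lam,
      (∀ β : ℝ, 0 ≤ β → IsMinimalSolution p β (w β)) ∧
      ∃ w₀ ∈ manifold p 0 lam,
        WeakTendsto (fun β => (w β).1) (𝓝[>] 0) w₀.1 ∧
        WeakTendsto (fun β => (w β).2) (𝓝[>] 0) w₀.2 ∧
        energy p 0 w₀ = groundLevel p 0 lam) ∧
    -- whatever the choice of such solutions, this convergence holds along a subsequence of any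
    -- sequence `β_n → 0⁺`, up to translations
    (∀ (β : ℕ → ℝ) (w : ℕ → W lam × W lam), (∀ n, 0 < β n) → Tendsto β atTop (𝓝 0) →
      (∀ n, IsMinimalSolution p (β n) (w n)) →
      ∃ (k : ℕ → ℕ) (y : ℕ → Plane) (z : ℕ → W lam × W lam) (w₀ : W lam × W lam),
        StrictMono k ∧
        (∀ n, IsTranslate (z n).1 (w (k n)).1 (y n) ∧ IsTranslate (z n).2 (w (k n)).2 (y n)) ∧
        w₀ ∈ manifold p 0 lam ∧
        WeakTendsto (fun n => (z n).1) atTop w₀.1 ∧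
        WeakTendsto (fun n => (z n).2) atTop w₀.2 ∧
        energy p 0 w₀ = groundLevel p 0 lam) ∧
    -- whatever the choice of such solutions, their `L²` norms tend to `0` as `β → ∞`
    (∀ w : ℝ → W lam × W lam, (∀ β : ℝ, 0 ≤ β → IsMinimalSolution p β (w β)) →
      Tendsto (fun β => ‖((w β).1 : Lp ℝ 2 (volume : Measure Plane))‖) atTop (𝓝 0) ∧
      Tendsto (fun β => ‖((w β).2 : Lp ℝ 2 (volume : Measure Plane))‖) atTop (𝓝 0)) := by
  have hlam1 : 1 < lam := (Real.one_lt_exp_iff.2 (by norm_num)).trans hlam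
  refine ⟨fun β hβ => ?_, exists_minimal_family hp hlam1,
    fun β w hβ0 hβ hw => exists_translate_weakTendsto hp hlam1 (fun n => (hβ0 n).le) hβ hw,
    fun w hw => ⟨tendsto_norm_of_massSq_le hp hlam1 fun β hβ => ?_,
      tendsto_norm_of_massSq_le hp hlam1 fun β hβ => ?_⟩⟩
  · obtain ⟨w, hw⟩ := exists_isMinimalSolution (lam := lam) hp hlam1 hβ
    refine ⟨⟨w, hw.mem_manifold, hw.energy_eq⟩, ?_⟩
    intro e he
    exact csInf_le (bddBelow_energy lam hp hβ) he
  · linarith [(hw β hβ).massSq_le hp hβ, massSq_nonneg (rep (w β).2)]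
  · linarith [(hw β hβ).massSq_le hp hβ, massSq_nonneg (rep (w β).1)]
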